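/- **Conventions.** Let $\mathcal{E}$ be an elementary topos (finite limits, exponentials and a subobject classifier). A *fibered preorder* $\mathcal{X}$ on a category $\mathbb{C}$ is a fibration with preordered fibres, i.e. a preorder $\mathcal{X}_I$ of *predicates* for each object $I$ and monotone reindexing maps $u^*:\mathcal{X}_I\to\mathcal{X}_J$ for $u:J\to I$, functorial up to isomorphism. A *pre-stack of meet-semilattices* on $\mathcal{E}$ is a fibered preorder $\mathcal{A}$ on $\mathcal{E}$ whose fibres have finite meets (including a greatest element), preserved by reindexing, and such that $e^*\varphi\le e^*\psi$ implies $\varphi\le\psi$ for every regular epimorphism $e:J\to I$ and $\varphi,\psi\in\mathcal{A}_I$. A fibered preorder with finite meets *has implication* if its fibres have Heyting implications and reindexing preserves them; it *has universal quantification* if all reindexing maps have right adjoints, subject to the Beck–Chevalley condition for all pullback squares. It is *existential* if it has fibrewise finite meets preserved by reindexing, and left adjoints $\exists_u$ to all reindexing maps satisfying the Beck–Chevalley condition and the Frobenius law. A category is *locally cartesian closed* if it has finite limits and all its slices are cartesian closed. For an existential fibered preorder $\mathcal{X}$ on a category $\mathbb{C}$ with finite limits, $\mathrm{PER}(\mathcal{X})$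 is the category whose objects are pairs $(C,\rho)$ with $\rho\in\mathcal{X}_{C\times C}$ symmetric and transitive in the internal logic of $\mathcal{X}$, and whose morphisms $(C,\rho)\to(D,\sigma)$ are functional relations (predicates $\phi\in\mathcal{X}_{C\times D}$ that are strict, compatible with $\rho$ and $\sigma$, single-valued and total) up to logical equivalence, with relational composition. For a pre-stack of meet-semilattices $\mathcal{A}$ on $\mathcal{E}$: * $D\mathcal{A}$ is the fibered preorder on $\mathcal{E}$ whose predicates on $I$ are pairs $(u:J\to I,\ \varphi\in\mathcal{A}_J)$, where $(u:J\to I,\varphi)\le(v:K\to I,\psi)$ if there are a regular epimorphism $e:L\to J$ and a map $f:L\to K$ with $ue=vf$ and $e^*\varphi\le f^*\psi$; reindexing is by pullback. It is existential, and $\mathcal{E}[D\mathcal{A}]:=\mathrm{PER}(D\mathcal{A})$. * $|\mathcal{A}|$ is the total category of $\mathcal{A}$; its objects are pairs $(I,\varphi\in\mathcal{A}_I)$, and its morphisms $(J,\psi)\to(I,\varphi)$ are maps $u:J\to I$ with $\psi\le u^*\varphi$. Such a morphism is *cover-cartesian* if $u$ is a regular epimorphism and $u^*\varphi\le\psi$.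 The fibration of sieves $\mathrm{siev}(\mathcal{A})$ is the existential fibered preorder on $|\mathcal{A}|$ whose predicates on $X$ are the morphisms of $|\mathcal{A}|$ with codomain $X$, where $f\le g$ if $fe=gk$ for some $k$ and some cover-cartesian $e$; reindexing is by pullback. $\mathcal{E}\{\mathcal{A}\}$ is the full subcategory of $\mathrm{PER}(\mathrm{siev}(\mathcal{A}))$ on the total (i.e. reflexive) relations. **Theorem.** Let $\mathcal{E}$ be a topos and let $\mathcal{A}$ be a pre-stack of meet-semilattices on $\mathcal{E}$. The following are equivalent. 1. $D\mathcal{A}$ has implication and universal quantification. 2. $\mathcal{E}[D\mathcal{A}]$ is locally cartesian closed. 3. $\mathcal{E}\{\mathcal{A}\}$ is locally cartesian closed. -/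

import Mathlib

open CategoryTheory Limits

universe w v u

/-- A category is *cartesian closed* if it has finite products and all exponentials. -/
def IsCartesianClosed (C : Type u) [Category.{v} C] : Prop :=
  ∃ _ : CartesianMonoidalCategory C, Nonempty (MonoidalClosed C)

/-- A category is *locally cartesian closed* if it has finite limits and all its slices are
cartesian closed. -/
def IsLocallyCartesianClosed (C : Type u) [Category.{v} C] : Prop :=
  HasFiniteLimits C ∧ ∀ X : C, IsCartesianClosed (Over X)

/-- An (elementary) topos: finite limits, exponentials and a subobject classifier. -/
class IsElementaryTopos (E : Type u) [Category.{v} E] : Prop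
    extends HasFiniteLimits E, HasSubobjectClassifier E where
  isCartesianClosed : IsCartesianClosed E

/-! ### Every topos is a regular category -/

namespace ToposRegular

variable {E : Type u} [Category.{v} E]

/-- A property of generalised elements of `Y` is definable if it is represented by a subobject. -/
def Definable {Y : E} (P : ∀ ⦃K : E⦄, (K ⟶ Y) → Prop) : Prop :=
  ∃ (S : E) (m : S ⟶ Y), Mono m ∧ ∀ ⦃K : E⦄ (a : K ⟶ Y), P a ↔ ∃ b : K ⟶ S, b ≫ m = a

theorem Definable.stable {Y : E} {P : ∀ ⦃K : E⦄, (K ⟶ Y) → Prop} (h : Definable P)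
    ⦃K K' : E⦄ (k : K' ⟶ K) (a : K ⟶ Y) (ha : P a) : P (k ≫ a) := by
  obtain ⟨S, m, hm, H⟩ := h
  obtain ⟨b, rfl⟩ := (H a).1 ha
  exact (H _).2 ⟨k ≫ b, by simp⟩

theorem definable_eq [HasFiniteLimits E] {Y Z : E} (p q : Y ⟶ Z) :
    Definable (fun _ (a : _ ⟶ Y) => a ≫ p = a ≫ q) :=
  ⟨_, equalizer.ι p q, inferInstance, fun _ a =>
    ⟨fun h => ⟨equalizer.lift a h, by simp⟩, by
      rintro ⟨b, rfl⟩
      simp only [Category.assoc, equalizer.condition p q]⟩⟩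

theorem Definable.comap [HasFiniteLimits E] {Y Y' : E} {P : ∀ ⦃K : E⦄, (K ⟶ Y) → Prop}
    (h : Definable P) (g : Y' ⟶ Y) : Definable (fun _ (a : _ ⟶ Y') => P (a ≫ g)) := by
  obtain ⟨S, m, hm, H⟩ := h
  refine ⟨_, pullback.snd m g, inferInstance, fun K a => (H _).trans ⟨?_, ?_⟩⟩
  · rintro ⟨b, hb⟩
    exact ⟨pullback.lift b a hb, pullback.lift_snd _ _ _⟩
  · rintro ⟨b, rfl⟩
    exact ⟨b ≫ pullback.fst m g, by simp only [Category.assoc, pullback.condition]⟩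

theorem factors_iff [HasSubobjectClassifier E] {S Y : E} (m : S ⟶ Y) [Mono m] {K : E}
    (a : K ⟶ Y) : (∃ b : K ⟶ S, b ≫ m = a) ↔
      a ≫ HasSubobjectClassifier.χ m =
        Subobject.Classifier.χ₀ _ K ≫ HasSubobjectClassifier.truth E := by
  constructor
  · rintro ⟨b, rfl⟩
    rw [Category.assoc, HasSubobjectClassifier.comm, ← Category.assoc]
    congr 1
    exact Subsingleton.elim _ _
  · intro h
    exact ⟨(HasSubobjectClassifier.isPullback_χ m).lift a _ h,
      (HasSubobjectClassifier.isPullback_χ m).lift_fst _ _ _⟩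

theorem chi_ext [HasFiniteLimits E] [HasSubobjectClassifier E] {Y : E}
    (f g : Y ⟶ HasSubobjectClassifier.Ω E)
    (h : ∀ ⦃K : E⦄ (k : K ⟶ Y),
      k ≫ f = Subobject.Classifier.χ₀ _ K ≫ HasSubobjectClassifier.truth E ↔
      k ≫ g = Subobject.Classifier.χ₀ _ K ≫ HasSubobjectClassifier.truth E) : f = g := by
  have hg := IsPullback.of_hasPullback g (HasSubobjectClassifier.truth E)
  have e : ∀ {K : E} (x : K ⟶ HasSubobjectClassifier.Ω₀ E),
    x = Subobject.Classifier.χ₀ _ K := fun x => Subsingleton.elim _ _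
  have hw := hg.w
  rw [e (pullback.snd g _)] at hw
  rw [HasSubobjectClassifier.unique (pullback.fst g (HasSubobjectClassifier.truth E)) g
    (by rw [← e (pullback.snd g _)]; exact hg)]
  apply HasSubobjectClassifier.unique
  refine IsPullback.of_isLimit' ⟨(h _).2 hw⟩ (PullbackCone.IsLimit.mk _
    (fun s => hg.lift s.fst s.snd ?_) ?_ ?_ ?_)
  · have := s.condition
    rw [e s.snd] at this ⊢
    exact (h _).1 this
  · intro s
    simp
  · intro s
    exact Subsingleton.elim _ _
  · intro s m hm _
    rw [← cancel_mono (pullback.fst g (HasSubobjectClassifier.truth E)), hm]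
    simp

theorem Definable.imp [HasFiniteLimits E] [HasSubobjectClassifier E] {Y : E}
    {P Q : ∀ ⦃K : E⦄, (K ⟶ Y) → Prop} (hP : Definable P) (hQ : Definable Q) :
    Definable (fun K (a : K ⟶ Y) => ∀ ⦃K' : E⦄ (k : K' ⟶ K), P (k ≫ a) → Q (k ≫ a)) := by
  obtain ⟨S, m, hm, H⟩ := hP
  obtain ⟨T, n, hn, H'⟩ := hQ
  obtain ⟨D, d, hd, hD⟩ := definable_eq
    (HasSubobjectClassifier.χ (pullback.fst m n ≫ m)) (HasSubobjectClassifier.χ m)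
  refine ⟨D, d, hd, fun K a => Iff.trans ⟨?_, ?_⟩ (hD a)⟩
  · intro h
    refine chi_ext _ _ fun K' k => ?_
    rw [← Category.assoc, ← Category.assoc, ← factors_iff, ← factors_iff]
    constructor
    · rintro ⟨b, hb⟩
      exact ⟨b ≫ pullback.fst m n, by simpa using hb⟩
    · rintro ⟨b, hb⟩
      obtain ⟨c, hc⟩ := (H' _).1 (h k ((H _).2 ⟨b, hb⟩))
      exact ⟨pullback.lift b c (hb.trans hc.symm), by
        rw [pullback.lift_fst_assoc]; exact hb⟩
  · intro h K' k hk
    rw [H, factors_iff, Category.assoc, ← h, ← Category.assoc, ← factors_iff] at hk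
    obtain ⟨b, hb⟩ := hk
    exact (H' _).2 ⟨b ≫ pullback.snd m n, by rw [← hb]; simp [pullback.condition]⟩

theorem Definable.all [HasFiniteLimits E] [HasSubobjectClassifier E]
    [CartesianMonoidalCategory E] [MonoidalClosed E] {Y Z : E}
    {P : ∀ ⦃K : E⦄, (K ⟶ MonoidalCategory.tensorObj Z Y) → Prop} (hP : Definable P) :
    Definable (fun K (a : K ⟶ Y) => ∀ ⦃K' : E⦄ (k : K' ⟶ K) (z : K' ⟶ Z),
      P (CartesianMonoidalCategory.lift z (k ≫ a))) := by
  have hst := hP.stable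
  obtain ⟨S, m, hm, H⟩ := hP
  obtain ⟨D, d, hd, hD⟩ := definable_eq
    (MonoidalClosed.curry (HasSubobjectClassifier.χ m))
    (MonoidalClosed.curry (Subobject.Classifier.χ₀ _ (MonoidalCategory.tensorObj Z Y) ≫
      HasSubobjectClassifier.truth E))
  refine ⟨D, d, hd, fun K a => Iff.trans ?_ (hD a)⟩
  dsimp only
  rw [← MonoidalClosed.curry_natural_left, ← MonoidalClosed.curry_natural_left,
    (MonoidalClosed.curry_injective).eq_iff, ← Category.assoc,
    show MonoidalCategory.whiskerLeft Z a ≫ Subobject.Classifier.χ₀ _ _ =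
      Subobject.Classifier.χ₀ _ _ from Subsingleton.elim _ _, ← factors_iff, ← H]
  constructor
  · intro h
    have := h (CartesianMonoidalCategory.snd Z K) (CartesianMonoidalCategory.fst Z K)
    convert this using 1
    ext <;> simp
  · intro h K' k z
    have := hst (CartesianMonoidalCategory.lift z k) _ h
    convert this using 1
    ext <;> simp

section

variable [IsElementaryTopos E]

/-- A definable property that holds for an epimorphism holds everywhere. -/
theorem Definable.of_epi {X Y : E} {P : ∀ ⦃K : E⦄, (K ⟶ Y) → Prop} (hP : Definable P)
    (f : X ⟶ Y) [Epi f] (h : P f) ⦃K : E⦄ (a : K ⟶ Y) : P a := by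
  obtain ⟨S, m, hm, H⟩ := hP
  obtain ⟨b, hb⟩ := (H f).1 h
  have : Epi m := by
    have : Epi (b ≫ m) := hb ▸ inferInstance
    exact epi_of_epi b m
  have : IsIso m := isIso_of_mono_of_epi m
  exact (H a).2 ⟨a ≫ inv m, by simp⟩

open CartesianMonoidalCategory in
theorem epi_of_isPullback {P X Y Z : E} {f' : P ⟶ Z} {g' : P ⟶ X} {f : X ⟶ Y} {g : Z ⟶ Y}
    (sq : IsPullback g' f' f g) [Epi f] : Epi f' := by
  obtain ⟨_, ⟨_⟩⟩ := IsElementaryTopos.isCartesianClosed (E := E)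
  refine ⟨fun {W} p q hpq => ?_⟩
  have hD := ((definable_eq (E := E) (fst Z Y ≫ g) (snd Z Y)).imp
    (definable_eq (fst Z Y ≫ p) (fst Z Y ≫ q))).all
  have := hD.of_epi f ?_ g (𝟙 _) (𝟙 _) (𝟙 _)
  · simpa using this
  · intro K' k z K'' k' h
    simp only [Category.assoc, lift_fst_assoc, lift_snd] at h ⊢
    have h2 : (k' ≫ k) ≫ f = (k' ≫ z) ≫ g := by simpa using h.symm
    have e : k' ≫ z = sq.lift (k' ≫ k) (k' ≫ z) h2 ≫ f' := by simp
    have := sq.lift (k' ≫ k) (k' ≫ z) h2 ≫= hpq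
    rw [← Category.assoc, ← Category.assoc, ← e] at this
    simpa using this

open CartesianMonoidalCategory in
theorem isRegularEpi_of_epi {X Y : E} (f : X ⟶ Y) [Epi f] : IsRegularEpi f := by
  obtain ⟨_, ⟨_⟩⟩ := IsElementaryTopos.isCartesianClosed (E := E)
  refine IsRegularEpi.of_epi_of_exists fun W h hh => ?_
  have hD := ((definable_eq (E := E) (fst X (MonoidalCategory.tensorObj Y W) ≫ f)
    (snd X (MonoidalCategory.tensorObj Y W) ≫ fst Y W)).imp
    (definable_eq (fst X (MonoidalCategory.tensorObj Y W) ≫ h)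
    (snd X (MonoidalCategory.tensorObj Y W) ≫ snd Y W))).all
  have key : ∀ ⦃K : E⦄ (a : K ⟶ MonoidalCategory.tensorObj Y W),
      (∀ ⦃K' : E⦄ (k : K' ⟶ K) (z : K' ⟶ X) ⦃K'' : E⦄ (k' : K'' ⟶ K'),
        k' ≫ lift z (k ≫ a) ≫ fst X _ ≫ f = k' ≫ lift z (k ≫ a) ≫ snd X _ ≫ fst Y W →
        k' ≫ lift z (k ≫ a) ≫ fst X _ ≫ h = k' ≫ lift z (k ≫ a) ≫ snd X _ ≫ snd Y W) ↔
      ∀ ⦃K' : E⦄ (k : K' ⟶ K) (x : K' ⟶ X), x ≫ f = k ≫ a ≫ fst Y W →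
        x ≫ h = k ≫ a ≫ snd Y W := by
    intro K a
    simp only [lift_fst_assoc, lift_snd_assoc]
    constructor
    · intro H K' k x hx
      simpa using H k x (𝟙 _) (by simpa using hx)
    · intro H K' k z K'' k' hz
      simpa using H (k' ≫ k) (k' ≫ z) (by simpa using hz)
  simp only [Category.assoc, key] at hD
  obtain ⟨S, m, hm, H⟩ := hD
  obtain ⟨e, he⟩ := (H (lift f h)).1 (by
    intro K' k x hx
    simp only [lift_fst, lift_snd] at hx ⊢
    have := pullback.lift x k hx ≫= hh
    rwa [pullback.lift_fst_assoc, pullback.lift_snd_assoc] at this)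
  have hmS := (H m).2 ⟨𝟙 _, by simp⟩
  have hef : e ≫ m ≫ fst Y W = f := by rw [← Category.assoc, he, lift_fst]
  have heh : e ≫ m ≫ snd Y W = h := by rw [← Category.assoc, he, lift_snd]
  have : Epi (m ≫ fst Y W) := by
    have : Epi (e ≫ m ≫ fst Y W) := hef ▸ inferInstance
    exact epi_of_epi e _
  have : Mono (m ≫ fst Y W) := by
    refine ⟨fun {K} a b hab => ?_⟩
    have : Epi (pullback.snd f (a ≫ m ≫ fst Y W)) :=
      epi_of_isPullback (IsPullback.of_hasPullback f (a ≫ m ≫ fst Y W))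
    rw [← cancel_mono m]
    apply CartesianMonoidalCategory.hom_ext
    · simpa using hab
    · rw [← cancel_epi (pullback.snd f (a ≫ m ≫ fst Y W))]
      have h1 := hmS (pullback.snd f (a ≫ m ≫ fst Y W) ≫ a)
        (pullback.fst f (a ≫ m ≫ fst Y W)) (by simp [pullback.condition])
      have h2 := hmS (pullback.snd f (a ≫ m ≫ fst Y W) ≫ b)
        (pullback.fst f (a ≫ m ≫ fst Y W)) (by simp [pullback.condition, hab])
      simpa using h1.symm.trans h2
  have : IsIso (m ≫ fst Y W) := isIso_of_mono_of_epi _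
  refine ⟨inv (m ≫ fst Y W) ≫ m ≫ snd Y W, ?_⟩
  rw [← Category.assoc, show f ≫ inv (m ≫ fst Y W) = e by rw [← hef]; simp, heh]

open CartesianMonoidalCategory in
/-- Every morphism of a topos factors as an epimorphism followed by a monomorphism. -/
theorem exists_image {X Y : E} (f : X ⟶ Y) :
    ∃ (S : E) (e : X ⟶ S) (m : S ⟶ Y), Epi e ∧ Mono m ∧ e ≫ m = f := by
  obtain ⟨_, ⟨_⟩⟩ := IsElementaryTopos.isCartesianClosed (E := E)
  let Ω := HasSubobjectClassifier.Ω E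
  let tr := fun K : E => Subobject.Classifier.χ₀ _ K ≫ HasSubobjectClassifier.truth E
  have htr : ∀ {K L : E} (k : K ⟶ L), k ≫ tr L = tr K := fun k => by
    simp only [tr, ← Category.assoc]
    congr 1
    exact Subsingleton.elim _ _
  have hD := ((((definable_eq (E := E) (fst X (MonoidalCategory.tensorObj Ω Y) ≫ f)
    (snd X (MonoidalCategory.tensorObj Ω Y) ≫ snd Ω Y)).imp
    (definable_eq (snd X (MonoidalCategory.tensorObj Ω Y) ≫ fst Ω Y) (tr _))).all).imp
    (definable_eq (fst Ω Y) (tr _))).all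
  obtain ⟨S, m, hm, H⟩ := hD
  obtain ⟨e, he⟩ := (H f).1 (by
    intro K' k ω K'' k' h
    have := h (𝟙 _) (k' ≫ k) (𝟙 _) (by simp)
    simpa [htr] using this)
  refine ⟨S, e, m, ⟨fun {W} p q hpq => ?_⟩, hm, he⟩
  have hmS := (H m).2 ⟨𝟙 _, by simp⟩
  have := hmS (𝟙 _) (HasSubobjectClassifier.χ (equalizer.ι p q ≫ m) |> (m ≫ ·)) (𝟙 _) (by
    intro K' k z K'' k' h
    simp only [Category.id_comp, Category.assoc, lift_fst_assoc, lift_snd_assoc, lift_fst,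
      lift_snd, htr, comp_lift] at h ⊢
    have h1 : k' ≫ k = k' ≫ z ≫ e := by
      rw [← cancel_mono m]
      simpa [he] using h.symm
    have h2 := (factors_iff (equalizer.ι p q ≫ m) (k' ≫ k ≫ m)).1
      ⟨equalizer.lift (k' ≫ k) (by rw [h1]; simp [hpq]), by simp⟩
    simpa using h2)
  simp only [Category.id_comp, lift_fst, htr] at this
  obtain ⟨b, hb⟩ := (factors_iff (equalizer.ι p q ≫ m) m).2 this
  have hb' : b ≫ equalizer.ι p q = 𝟙 _ := by
    rw [← cancel_mono m]
    simpa using hb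
  calc p = (b ≫ equalizer.ι p q) ≫ p := by rw [hb', Category.id_comp]
    _ = (b ≫ equalizer.ι p q) ≫ q := by
      rw [Category.assoc, equalizer.condition, Category.assoc]
    _ = q := by rw [hb', Category.id_comp]

end

end ToposRegular

/-- Every topos is a regular category. -/
instance IsElementaryTopos.regular {E : Type u} [Category.{v} E] [IsElementaryTopos E] :
    Regular E where
  hasCoequalizer_of_isKernelPair {X Y Z f g₁ g₂} hk := by
    obtain ⟨S, e, m, _, _, rfl⟩ := ToposRegular.exists_image f
    have := ToposRegular.isRegularEpi_of_epi e
    have hk' : IsKernelPair e g₁ g₂ := IsKernelPair.cancel_right_of_mono hk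
    exact ⟨⟨⟨_, hk'.toCoequalizer (IsRegularEpi.getStruct e)⟩⟩⟩
  regularEpiIsStableUnderBaseChange := ⟨by
    intro X Y Z W f g f' g' sq (hg : IsRegularEpi _)
    have : Epi g := inferInstance
    have := ToposRegular.epi_of_isPullback sq
    exact ToposRegular.isRegularEpi_of_epi g'⟩

/-! ### Fibered preorders

A posetal fibration on `C`, presented (through the Grothendieck construction) by its fibres, which
are preorders, and by its reindexing maps, which are monotone and functorial up to isomorphism. -/

/-- A fibered preorder (posetal fibration with a cleavage) on a category `C`. -/
structure FiberedPreorder (C : Type u) [Category.{v} C] where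
  /-- The predicates on `I`, i.e. the objects of the fibre over `I`. -/
  Pred : C → Type w
  /-- The fibres are preorders. -/
  preorder : ∀ I, Preorder (Pred I)
  /-- Reindexing along `u`. -/
  reindex : ∀ {J I : C}, (J ⟶ I) → Pred I → Pred J
  reindex_mono : ∀ {J I : C} (u : J ⟶ I) {φ ψ : Pred I}, φ ≤ ψ → reindex u φ ≤ reindex u ψ
  reindex_id_le : ∀ {I : C} (φ : Pred I), reindex (𝟙 I) φ ≤ φ
  le_reindex_id : ∀ {I : C} (φ : Pred I), φ ≤ reindex (𝟙 I) φ
  reindex_comp_le : ∀ {K J I : C} (v : K ⟶ J) (u : J ⟶ I) (φ : Pred I),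
    reindex (v ≫ u) φ ≤ reindex v (reindex u φ)
  le_reindex_comp : ∀ {K J I : C} (v : K ⟶ J) (u : J ⟶ I) (φ : Pred I),
    reindex v (reindex u φ) ≤ reindex (v ≫ u) φ

namespace FiberedPreorder

attribute [instance] FiberedPreorder.preorder

section

variable {C : Type u} [Category.{v} C] (X : FiberedPreorder.{w} C)

/-- The pre-stack condition for the regular topology: reindexing along a regular epimorphism is
full (and, the fibres being preorders, faithful) as a functor to the category of descent data,
i.e. it reflects the order. -/
def IsPrestack : Prop :=
  ∀ ⦃J I : C⦄ (e : J ⟶ I), IsRegularEpi e → ∀ φ ψ : X.Pred I,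
    X.reindex e φ ≤ X.reindex e ψ → φ ≤ ψ

variable {X} in
/-- `χ` is a meet of `φ` and `ψ`. -/
def IsMeet {I : C} (φ ψ χ : X.Pred I) : Prop :=
  ∀ θ : X.Pred I, θ ≤ χ ↔ θ ≤ φ ∧ θ ≤ ψ

/-- Fibrewise finite meets that are preserved by reindexing. -/
class HasFiniteMeets : Prop where
  exists_top : ∀ I : C, ∃ t : X.Pred I, IsTop t
  reindex_top : ∀ {J I : C} (u : J ⟶ I) (t : X.Pred I), IsTop t → IsTop (X.reindex u t)
  exists_meet : ∀ {I : C} (φ ψ : X.Pred I), ∃ χ : X.Pred I, IsMeet φ ψ χ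
  reindex_meet : ∀ {J I : C} (u : J ⟶ I) (φ ψ χ : X.Pred I), IsMeet φ ψ χ →
    IsMeet (X.reindex u φ) (X.reindex u ψ) (X.reindex u χ)

/-- `ψ` is an existential quantification of `φ` along `u`. -/
def IsEx {J I : C} (u : J ⟶ I) (φ : X.Pred J) (ψ : X.Pred I) : Prop :=
  ∀ θ : X.Pred I, ψ ≤ θ ↔ φ ≤ X.reindex u θ

/-- `ψ` is a universal quantification of `φ` along `u`. -/
def IsAll {J I : C} (u : J ⟶ I) (φ : X.Pred J) (ψ : X.Pred I) : Prop :=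
  ∀ θ : X.Pred I, θ ≤ ψ ↔ X.reindex u θ ≤ φ

variable {X} in
/-- `χ` is a (Heyting) implication of `φ` and `ψ`: `θ ≤ χ` iff `θ ∧ φ ≤ ψ`. -/
def IsImp {I : C} (φ ψ χ : X.Pred I) : Prop :=
  ∀ θ μ : X.Pred I, IsMeet θ φ μ → (θ ≤ χ ↔ μ ≤ ψ)

/-- An existential fibration: finite meets, and existential quantification along all maps, subject
to the Beck-Chevalley condition and the Frobenius law. -/
class IsExistential : Prop extends X.HasFiniteMeets where
  exists_ex : ∀ {J I : C} (u : J ⟶ I) (φ : X.Pred J), ∃ ψ, X.IsEx u φ ψ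
  beckChevalley : ∀ {P J K I : C} {v' : P ⟶ J} {u' : P ⟶ K} {u : J ⟶ I} {v : K ⟶ I},
    IsPullback v' u' u v → ∀ (φ : X.Pred J) (ψ : X.Pred I), X.IsEx u φ ψ →
      X.IsEx u' (X.reindex v' φ) (X.reindex v ψ)
  frobenius : ∀ {J I : C} (u : J ⟶ I) (φ : X.Pred J) (ψ θ μ : X.Pred I) (ν : X.Pred J),
    X.IsEx u φ ψ → IsMeet θ ψ μ → IsMeet (X.reindex u θ) φ ν → X.IsEx u ν μ

/-- A fibered preorder *has implication* if its fibres have implications and reindexing preserves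
them. -/
def HasImplication : Prop :=
  (∀ {I : C} (φ ψ : X.Pred I), ∃ χ, IsImp φ ψ χ) ∧
  ∀ {J I : C} (u : J ⟶ I) (φ ψ χ : X.Pred I), IsImp φ ψ χ →
    IsImp (X.reindex u φ) (X.reindex u ψ) (X.reindex u χ)

/-- A fibered preorder *has universal quantification* if all reindexing maps have right adjoints,
subject to the Beck-Chevalley condition. -/
def HasUniversalQuantification : Prop :=
  (∀ {J I : C} (u : J ⟶ I) (φ : X.Pred J), ∃ ψ, X.IsAll u φ ψ) ∧
  ∀ {P J K I : C} {v' : P ⟶ J} {u' : P ⟶ K} {u : J ⟶ I} {v : K ⟶ I},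
    IsPullback v' u' u v → ∀ (φ : X.Pred J) (ψ : X.Pred I), X.IsAll u φ ψ →
      X.IsAll u' (X.reindex v' φ) (X.reindex v ψ)

end

/-! #### Chosen connectives -/

section

variable {C : Type u} [Category.{v} C] {X : FiberedPreorder.{w} C}

/-- A chosen greatest predicate on `I`. -/
noncomputable def top (X : FiberedPreorder.{w} C) [X.HasFiniteMeets] (I : C) : X.Pred I :=
  (HasFiniteMeets.exists_top (X := X) I).choose

theorem le_top [X.HasFiniteMeets] {I : C} (φ : X.Pred I) : φ ≤ X.top I :=
  (HasFiniteMeets.exists_top (X := X) I).choose_spec φ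

/-- A chosen meet of two predicates. -/
noncomputable def meet [X.HasFiniteMeets] {I : C} (φ ψ : X.Pred I) : X.Pred I :=
  (HasFiniteMeets.exists_meet φ ψ).choose

theorem isMeet_meet [X.HasFiniteMeets] {I : C} (φ ψ : X.Pred I) : IsMeet φ ψ (meet φ ψ) :=
  (HasFiniteMeets.exists_meet φ ψ).choose_spec

theorem le_meet_iff [X.HasFiniteMeets] {I : C} {θ φ ψ : X.Pred I} :
    θ ≤ meet φ ψ ↔ θ ≤ φ ∧ θ ≤ ψ :=
  isMeet_meet φ ψ θ

/-- A chosen existential quantification. -/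
noncomputable def ex [X.IsExistential] {J I : C} (u : J ⟶ I) (φ : X.Pred J) : X.Pred I :=
  (IsExistential.exists_ex u φ).choose

theorem isEx_ex [X.IsExistential] {J I : C} (u : J ⟶ I) (φ : X.Pred J) : X.IsEx u φ (ex u φ) :=
  (IsExistential.exists_ex u φ).choose_spec

theorem meet_le_left [X.HasFiniteMeets] {I : C} (φ ψ : X.Pred I) : meet φ ψ ≤ φ :=
  (le_meet_iff.1 le_rfl).1

theorem meet_le_right [X.HasFiniteMeets] {I : C} (φ ψ : X.Pred I) : meet φ ψ ≤ ψ :=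
  (le_meet_iff.1 le_rfl).2

theorem le_reindex_meet [X.HasFiniteMeets] {J I : C} (u : J ⟶ I) {φ ψ : X.Pred I}
    {θ : X.Pred J} (h₁ : θ ≤ X.reindex u φ) (h₂ : θ ≤ X.reindex u ψ) :
    θ ≤ X.reindex u (meet φ ψ) :=
  (HasFiniteMeets.reindex_meet u _ _ _ (isMeet_meet φ ψ) θ).2 ⟨h₁, h₂⟩

theorem reindex_le_reindex {K J J' I : C} (k : K ⟶ J) (u : J ⟶ I) (k' : K ⟶ J') (u' : J' ⟶ I)
    (h : k ≫ u = k' ≫ u') (φ : X.Pred I) :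
    X.reindex k (X.reindex u φ) ≤ X.reindex k' (X.reindex u' φ) :=
  (X.le_reindex_comp k u φ).trans (h ▸ X.reindex_comp_le k' u' φ)

/-- Introduction of the existential quantifier, for generalised elements. -/
theorem le_reindex_ex [X.IsExistential] {K J I : C} (u : J ⟶ I) (φ : X.Pred J) (j : K ⟶ J)
    (a : K ⟶ I) (h : j ≫ u = a) {θ : X.Pred K} (hθ : θ ≤ X.reindex j φ) :
    θ ≤ X.reindex a (ex u φ) :=
  hθ.trans ((X.reindex_mono j ((isEx_ex u φ _).1 le_rfl)).trans
    (h ▸ X.le_reindex_comp j u (ex u φ)))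

/-- Elimination of the existential quantifier, for generalised elements. -/
theorem le_of_le_reindex_ex [HasPullbacks C] [X.IsExistential] {K J I : C} (u : J ⟶ I)
    (φ : X.Pred J) (a : K ⟶ I) {θ ξ : X.Pred K} (hθ : θ ≤ X.reindex a (ex u φ))
    (H : ∀ {K' : C} (p : K' ⟶ K) (j : K' ⟶ J) (θ' : X.Pred K'), j ≫ u = p ≫ a →
      θ' ≤ X.reindex p θ → θ' ≤ X.reindex j φ → θ' ≤ X.reindex p ξ) : θ ≤ ξ := by
  have h₁ := IsExistential.beckChevalley (IsPullback.of_hasPullback u a) φ _ (isEx_ex u φ)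
  have h₂ := IsExistential.frobenius _ _ _ θ _ _ h₁ (isMeet_meet _ _) (isMeet_meet _ _)
  refine (le_meet_iff.2 ⟨le_rfl, hθ⟩).trans ((h₂ ξ).2 ?_)
  exact H _ _ _ pullback.condition (meet_le_left _ _) (meet_le_right _ _)

end

/-! #### Partial equivalence relations -/

section

variable {C : Type u} [Category.{v} C] [HasFiniteLimits C] {A B K L : C}

@[simp]
theorem lift_fst (a : K ⟶ A) (b : K ⟶ B) : prod.lift a b ≫ prod.fst = a := prod.lift_fst a b

@[simp]
theorem lift_snd (a : K ⟶ A) (b : K ⟶ B) : prod.lift a b ≫ prod.snd = b := prod.lift_snd a b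

@[simp]
theorem lift_fst_comp (a : K ⟶ A) (b : K ⟶ B) (c : A ⟶ L) :
    prod.lift a b ≫ prod.fst ≫ c = a ≫ c := prod.lift_fst_assoc a b c

@[simp]
theorem lift_snd_comp (a : K ⟶ A) (b : K ⟶ B) (c : B ⟶ L) :
    prod.lift a b ≫ prod.snd ≫ c = b ≫ c := prod.lift_snd_assoc a b c

end

section

variable {C : Type u} [Category.{v} C] [HasFiniteLimits C] {X : FiberedPreorder.{w} C}

/-- The predicate `ρ(a, b)` on `K`, for a binary predicate `ρ` and generalised elements
`a` and `b`. -/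
noncomputable def at₂ {A B K : C} (ρ : X.Pred (A ⨯ B)) (a : K ⟶ A) (b : K ⟶ B) : X.Pred K :=
  X.reindex (prod.lift a b) ρ

theorem le_at₂_of_le_reindex {A B K L : C} {ρ : X.Pred (A ⨯ B)} {a : K ⟶ A} {b : K ⟶ B}
    {θ : X.Pred K} (h : θ ≤ at₂ ρ a b) (p : L ⟶ K) {θ' : X.Pred L}
    (hθ : θ' ≤ X.reindex p θ) : θ' ≤ at₂ ρ (p ≫ a) (p ≫ b) := by
  refine hθ.trans ((X.reindex_mono p h).trans ((X.le_reindex_comp _ _ _).trans ?_))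
  rw [prod.comp_lift]
  exact le_rfl

theorem le_at₂_comp {A B K L : C} {ρ : X.Pred (A ⨯ B)} {a : K ⟶ A} {b : K ⟶ B} (p : L ⟶ K)
    {θ : X.Pred L} : θ ≤ at₂ ρ (p ≫ a) (p ≫ b) ↔ θ ≤ X.reindex p (at₂ ρ a b) := by
  constructor
  · intro h
    refine h.trans (le_trans ?_ (X.reindex_comp_le p (prod.lift a b) ρ))
    rw [prod.comp_lift]
    exact le_rfl
  · exact fun h => le_at₂_of_le_reindex le_rfl p h

theorem le_of_at₂ {A B : C} {ρ σ : X.Pred (A ⨯ B)}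
    (h : ∀ {K : C} (a : K ⟶ A) (b : K ⟶ B), at₂ ρ a b ≤ at₂ σ a b) : ρ ≤ σ := by
  have := h (prod.fst : A ⨯ B ⟶ A) prod.snd
  simp only [at₂, prod.lift_fst_snd] at this
  exact (X.le_reindex_id ρ).trans (this.trans (X.reindex_id_le σ))

variable (X) in
/-- An object of `PER(X)`: an object of the base with a partial equivalence relation on it. The
judgments are stated for generalised elements `a b c : K ⟶ carrier`, which by substitution is the
same as stating them for the projections from `carrier × carrier (× carrier)`. -/
structure PER [X.HasFiniteMeets] where
  carrier : C
  rel : X.Pred (carrier ⨯ carrier)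
  symm : ∀ {K : C} (a b : K ⟶ carrier), at₂ rel a b ≤ at₂ rel b a
  trans : ∀ {K : C} (a b c : K ⟶ carrier), meet (at₂ rel a b) (at₂ rel b c) ≤ at₂ rel a c

/-- The predicate `φ` is a functional relation from `R` to `S`. -/
structure IsFunctionalRel [X.IsExistential] (R S : X.PER)
    (φ : X.Pred (R.carrier ⨯ S.carrier)) : Prop where
  strict : ∀ {K : C} (c : K ⟶ R.carrier) (d : K ⟶ S.carrier),
    at₂ φ c d ≤ meet (at₂ R.rel c c) (at₂ S.rel d d)
  cong : ∀ {K : C} (c c' : K ⟶ R.carrier) (d d' : K ⟶ S.carrier),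
    meet (at₂ φ c d) (meet (at₂ R.rel c c') (at₂ S.rel d d')) ≤ at₂ φ c' d'
  singval : ∀ {K : C} (c : K ⟶ R.carrier) (d d' : K ⟶ S.carrier),
    meet (at₂ φ c d) (at₂ φ c d') ≤ at₂ S.rel d d'
  tot : at₂ R.rel (𝟙 R.carrier) (𝟙 R.carrier) ≤ ex prod.fst φ

/-- The relational composition `∃ d, φ(c, d) ∧ γ(d, e)`. -/
noncomputable def relComp [X.IsExistential] {A B D : C} (φ : X.Pred (A ⨯ B))
    (γ : X.Pred (B ⨯ D)) : X.Pred (A ⨯ D) :=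
  ex (prod.lift (prod.fst ≫ prod.fst) prod.snd : (A ⨯ B) ⨯ D ⟶ A ⨯ D)
    (meet (X.reindex (prod.fst : (A ⨯ B) ⨯ D ⟶ A ⨯ B) φ)
      (X.reindex (prod.lift (prod.fst ≫ prod.snd) prod.snd : (A ⨯ B) ⨯ D ⟶ B ⨯ D) γ))

section

variable [X.IsExistential]

theorem le_at₂_relComp {A B D K : C} {φ : X.Pred (A ⨯ B)} {γ : X.Pred (B ⨯ D)} {θ : X.Pred K}
    {a : K ⟶ A} (b : K ⟶ B) {d : K ⟶ D} (h₁ : θ ≤ at₂ φ a b) (h₂ : θ ≤ at₂ γ b d) :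
    θ ≤ at₂ (relComp φ γ) a d := by
  refine le_reindex_ex _ _ (prod.lift (prod.lift a b) d) _ (by ext <;> simp) ?_
  refine le_reindex_meet _ (h₁.trans ?_) (h₂.trans ?_)
  · refine le_trans ?_ (X.reindex_comp_le _ _ _)
    rw [prod.lift_fst]
    exact le_rfl
  · refine le_trans ?_ (X.reindex_comp_le _ _ _)
    rw [show prod.lift (prod.lift a b) d ≫ prod.lift (prod.fst ≫ prod.snd) prod.snd =
      prod.lift b d by ext <;> simp]
    exact le_rfl

theorem le_of_le_at₂_relComp {A B D K : C} {φ : X.Pred (A ⨯ B)} {γ : X.Pred (B ⨯ D)}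
    {θ ξ : X.Pred K} {a : K ⟶ A} {d : K ⟶ D} (h : θ ≤ at₂ (relComp φ γ) a d)
    (H : ∀ {L : C} (p : L ⟶ K) (b : L ⟶ B) (θ' : X.Pred L), θ' ≤ X.reindex p θ →
      θ' ≤ at₂ φ (p ≫ a) b → θ' ≤ at₂ γ b (p ≫ d) → θ' ≤ X.reindex p ξ) : θ ≤ ξ := by
  refine le_of_le_reindex_ex _ _ _ h fun {L} p j θ' hj hθ hφ => ?_
  have e₁ : j ≫ prod.fst ≫ prod.fst = p ≫ a := by simpa using hj =≫ prod.fst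
  have e₂ : j ≫ prod.snd = p ≫ d := by simpa using hj =≫ prod.snd
  refine H p (j ≫ prod.fst ≫ prod.snd) θ' hθ ?_ ?_
  · refine (hφ.trans (X.reindex_mono j (meet_le_left _ _))).trans
      ((X.le_reindex_comp _ _ _).trans ?_)
    rw [← e₁, show j ≫ (prod.fst : (A ⨯ B) ⨯ D ⟶ A ⨯ B) = prod.lift (j ≫ prod.fst ≫ prod.fst)
      (j ≫ prod.fst ≫ prod.snd) by ext <;> simp]
    exact le_rfl
  · refine (hφ.trans (X.reindex_mono j (meet_le_right _ _))).trans
      ((X.le_reindex_comp _ _ _).trans ?_)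
    rw [← e₂, prod.comp_lift]
    exact le_rfl

theorem le_of_le_ex_fst {A B K : C} {φ : X.Pred (A ⨯ B)} {θ ξ : X.Pred K} {a : K ⟶ A}
    (h : θ ≤ X.reindex a (ex prod.fst φ))
    (H : ∀ {L : C} (p : L ⟶ K) (b : L ⟶ B) (θ' : X.Pred L), θ' ≤ X.reindex p θ →
      θ' ≤ at₂ φ (p ≫ a) b → θ' ≤ X.reindex p ξ) : θ ≤ ξ := by
  refine le_of_le_reindex_ex _ _ _ h fun {L} p j θ' hj hθ hφ => ?_
  refine H p (j ≫ prod.snd) θ' hθ (hφ.trans ?_)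
  rw [← hj, at₂, ← prod.comp_lift, prod.lift_fst_snd, Category.comp_id]

theorem PER.le_symm {R : X.PER} {K : C} {a b : K ⟶ R.carrier} {θ : X.Pred K}
    (h : θ ≤ at₂ R.rel a b) : θ ≤ at₂ R.rel b a :=
  h.trans (R.symm a b)

theorem PER.le_trans {R : X.PER} {K : C} {a b c : K ⟶ R.carrier} {θ : X.Pred K}
    (h : θ ≤ at₂ R.rel a b) (h' : θ ≤ at₂ R.rel b c) : θ ≤ at₂ R.rel a c :=
  (le_meet_iff.2 ⟨h, h'⟩).trans (R.trans a b c)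

namespace IsFunctionalRel

variable {R S T : X.PER} {φ : X.Pred (R.carrier ⨯ S.carrier)} {γ : X.Pred (S.carrier ⨯ T.carrier)}

theorem le_left (hφ : IsFunctionalRel R S φ) {K : C} {θ : X.Pred K} {c : K ⟶ R.carrier}
    {d : K ⟶ S.carrier} (h : θ ≤ at₂ φ c d) : θ ≤ at₂ R.rel c c :=
  h.trans ((hφ.strict c d).trans (meet_le_left _ _))

theorem le_right (hφ : IsFunctionalRel R S φ) {K : C} {θ : X.Pred K} {c : K ⟶ R.carrier}
    {d : K ⟶ S.carrier} (h : θ ≤ at₂ φ c d) : θ ≤ at₂ S.rel d d :=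
  h.trans ((hφ.strict c d).trans (meet_le_right _ _))

theorem le_cong (hφ : IsFunctionalRel R S φ) {K : C} {θ : X.Pred K} {c c' : K ⟶ R.carrier}
    {d d' : K ⟶ S.carrier} (h : θ ≤ at₂ φ c d) (h₁ : θ ≤ at₂ R.rel c c')
    (h₂ : θ ≤ at₂ S.rel d d') : θ ≤ at₂ φ c' d' :=
  (le_meet_iff.2 ⟨h, le_meet_iff.2 ⟨h₁, h₂⟩⟩).trans (hφ.cong c c' d d')

theorem le_singval (hφ : IsFunctionalRel R S φ) {K : C} {θ : X.Pred K} {c : K ⟶ R.carrier}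
    {d d' : K ⟶ S.carrier} (h : θ ≤ at₂ φ c d) (h' : θ ≤ at₂ φ c d') : θ ≤ at₂ S.rel d d' :=
  (le_meet_iff.2 ⟨h, h'⟩).trans (hφ.singval c d d')

theorem le_tot (hφ : IsFunctionalRel R S φ) {K : C} {θ : X.Pred K} {c : K ⟶ R.carrier}
    (h : θ ≤ at₂ R.rel c c) : θ ≤ X.reindex c (ex prod.fst φ) := by
  refine _root_.le_trans ?_ (X.reindex_mono c hφ.tot)
  rw [← le_at₂_comp]
  simpa using h

theorem id (R : X.PER) : IsFunctionalRel R R R.rel where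
  strict _ _ := le_meet_iff.2 ⟨PER.le_trans le_rfl (PER.le_symm le_rfl),
    PER.le_trans (PER.le_symm le_rfl) le_rfl⟩
  cong _ _ _ _ :=
    PER.le_trans (PER.le_symm ((meet_le_right _ _).trans (meet_le_left _ _)))
      (PER.le_trans (meet_le_left _ _) ((meet_le_right _ _).trans (meet_le_right _ _)))
  singval _ _ _ := PER.le_trans (PER.le_symm (meet_le_left _ _)) (meet_le_right _ _)
  tot := by
    refine _root_.le_trans ?_ (X.reindex_id_le _)
    exact le_reindex_ex _ _ (prod.lift (𝟙 _) (𝟙 _)) _ (by simp) le_rfl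

theorem comp (hφ : IsFunctionalRel R S φ) (hγ : IsFunctionalRel S T γ) :
    IsFunctionalRel R T (relComp φ γ) where
  strict c d := by
    refine le_of_le_at₂_relComp le_rfl fun p b θ' _ h₁ h₂ => ?_
    exact le_reindex_meet _ ((le_at₂_comp p).1 (hφ.le_left h₁))
      ((le_at₂_comp p).1 (hγ.le_right h₂))
  cong c c' d d' := by
    refine le_of_le_at₂_relComp (meet_le_left _ _) fun p b θ' h h₁ h₂ => ?_
    rw [← le_at₂_comp]
    have h₃ := le_at₂_of_le_reindex ((meet_le_right _ _).trans (meet_le_left _ _)) p h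
    have h₄ := le_at₂_of_le_reindex ((meet_le_right _ _).trans (meet_le_right _ _)) p h
    exact le_at₂_relComp b (hφ.le_cong h₁ h₃ (hφ.le_right h₁))
      (hγ.le_cong h₂ (hγ.le_left h₂) h₄)
  singval c d d' := by
    refine le_of_le_at₂_relComp (meet_le_left _ _) fun p b θ' h h₁ h₂ => ?_
    have h₃ := le_at₂_of_le_reindex (meet_le_right _ _) p h
    rw [← le_at₂_comp]
    refine le_of_le_at₂_relComp h₃ fun q b' θ'' h' h₄ h₅ => ?_
    rw [← le_at₂_comp]
    have h₆ := le_at₂_of_le_reindex h₁ q h'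
    have h₇ := le_at₂_of_le_reindex h₂ q h'
    have h₈ := hφ.le_singval h₆ h₄
    exact hγ.le_singval (hγ.le_cong h₇ h₈ (hγ.le_right h₇)) h₅
  tot := by
    refine le_of_le_ex_fst (hφ.le_tot le_rfl) fun p b θ' h h₁ => ?_
    refine le_of_le_ex_fst (hγ.le_tot (hφ.le_right h₁)) fun q d θ'' h' h₂ => ?_
    refine _root_.le_trans ?_ (X.reindex_comp_le _ _ _)
    have h₃ := le_at₂_of_le_reindex h₁ q h'
    exact le_reindex_ex _ _ (prod.lift (q ≫ p) d) _ (by simp)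
      (le_at₂_relComp (q ≫ b) (by simpa using h₃) h₂)

end IsFunctionalRel

/-- The objects of the base with a partial equivalence relation, and functional relations up to
logical equivalence as morphisms. -/
noncomputable instance PER.category : Category X.PER where
  Hom R S := Antisymmetrization
    {φ : X.Pred (R.carrier ⨯ S.carrier) // IsFunctionalRel R S φ} (· ≤ ·)
  id R := toAntisymmetrization _ ⟨R.rel, IsFunctionalRel.id R⟩
  comp := Quotient.map₂ (fun φ γ => ⟨relComp φ.1 γ.1, φ.2.comp γ.2⟩) (by
    have key : ∀ {A B D : C} {φ φ' : X.Pred (A ⨯ B)} {γ γ' : X.Pred (B ⨯ D)}, φ ≤ φ' →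
        γ ≤ γ' → relComp φ γ ≤ relComp φ' γ' := fun h h' =>
      le_of_at₂ fun a b => le_of_le_at₂_relComp le_rfl fun p d θ' _ h₁ h₂ =>
        (le_at₂_comp p).1 (le_at₂_relComp d (h₁.trans (X.reindex_mono _ h))
          (h₂.trans (X.reindex_mono _ h')))
    exact fun φ φ' h γ γ' h' => ⟨key h.1 h'.1, key h.2 h'.2⟩)
  id_comp := by
    rintro R S ⟨φ, hφ⟩
    refine Quotient.sound ⟨le_of_at₂ fun a b => ?_, le_of_at₂ fun a b => ?_⟩
    · refine le_of_le_at₂_relComp le_rfl fun p d θ' _ h₁ h₂ => (le_at₂_comp p).1 ?_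
      exact hφ.le_cong h₂ (PER.le_symm h₁) (hφ.le_right h₂)
    · exact le_at₂_relComp a (hφ.le_left le_rfl) le_rfl
  comp_id := by
    rintro R S ⟨φ, hφ⟩
    refine Quotient.sound ⟨le_of_at₂ fun a b => ?_, le_of_at₂ fun a b => ?_⟩
    · refine le_of_le_at₂_relComp le_rfl fun p d θ' _ h₁ h₂ => (le_at₂_comp p).1 ?_
      exact hφ.le_cong h₁ (hφ.le_left h₁) h₂
    · exact le_at₂_relComp b le_rfl (hφ.le_right le_rfl)
  assoc := by
    rintro R S T U ⟨φ, hφ⟩ ⟨γ, hγ⟩ ⟨δ, hδ⟩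
    refine Quotient.sound ⟨le_of_at₂ fun a b => ?_, le_of_at₂ fun a b => ?_⟩
    · refine le_of_le_at₂_relComp le_rfl fun p d θ' _ h₁ h₂ => (le_at₂_comp p).1 ?_
      refine le_of_le_at₂_relComp h₁ fun q c θ'' h' h₃ h₄ => (le_at₂_comp q).1 ?_
      exact le_at₂_relComp c h₃ (le_at₂_relComp (q ≫ d) h₄ (le_at₂_of_le_reindex h₂ q h'))
    · refine le_of_le_at₂_relComp le_rfl fun p d θ' _ h₁ h₂ => (le_at₂_comp p).1 ?_
      refine le_of_le_at₂_relComp h₂ fun q c θ'' h' h₃ h₄ => (le_at₂_comp q).1 ?_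
      exact le_at₂_relComp c (le_at₂_relComp (q ≫ d) (le_at₂_of_le_reindex h₁ q h') h₃) h₄

end

end

end FiberedPreorder

namespace FiberedPreorder

/-! ### Auxiliary facts for the constructions below -/

section

variable {C : Type u} [Category.{v} C]

theorem isExistential_of_adj (X : FiberedPreorder.{w} C)
    (ex : ∀ {J I : C}, (J ⟶ I) → X.Pred J → X.Pred I)
    (gc : ∀ {J I : C} (u : J ⟶ I) (φ : X.Pred J), X.IsEx u φ (ex u φ))
    (top : ∀ I : C, X.Pred I) (htop : ∀ I, IsTop (top I))
    (meet : ∀ {I : C}, X.Pred I → X.Pred I → X.Pred I)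
    (hmeet : ∀ {I : C} (φ ψ : X.Pred I), IsMeet φ ψ (meet φ ψ))
    (bc : ∀ {P J K I : C} {v' : P ⟶ J} {u' : P ⟶ K} {u : J ⟶ I} {v : K ⟶ I},
      IsPullback v' u' u v → ∀ φ : X.Pred J,
        X.reindex v (ex u φ) ≤ ex u' (X.reindex v' φ))
    (frob : ∀ {J I : C} (u : J ⟶ I) (φ : X.Pred J) (θ : X.Pred I),
      meet θ (ex u φ) ≤ ex u (meet (X.reindex u θ) φ)) : X.IsExistential where
  exists_top I := ⟨top I, htop I⟩
  reindex_top u t ht φ := (gc u φ t).1 (ht _)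
  exists_meet φ ψ := ⟨_, hmeet φ ψ⟩
  reindex_meet u φ ψ χ h θ := by
    rw [← gc u θ χ, ← gc u θ φ, ← gc u θ ψ]
    exact h _
  exists_ex u φ := ⟨_, gc u φ⟩
  beckChevalley {P J K I v' u' u v} sq φ ψ h θ := by
    constructor
    · intro hθ
      refine (X.reindex_mono v' ((h ψ).1 le_rfl)).trans ?_
      refine (X.le_reindex_comp v' u ψ).trans (sq.w ▸ ?_)
      exact (X.reindex_comp_le u' v ψ).trans (X.reindex_mono u' hθ)
    · intro hθ
      exact (X.reindex_mono v ((h _).2 ((gc u φ _).1 le_rfl))).trans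
        ((bc sq φ).trans ((gc u' _ θ).2 hθ))
  frobenius u φ ψ θ μ ν h hμ hν ξ := by
    constructor
    · intro hξ
      refine le_trans ?_ (X.reindex_mono u hξ)
      refine (gc u ν μ).1 ((hμ _).2 ⟨(gc u ν θ).2 ((hν ν).1 le_rfl).1, ?_⟩)
      exact (gc u ν ψ).2 ((((hν ν).1 le_rfl).2).trans ((h ψ).1 le_rfl))
    · intro hξ
      refine le_trans ?_ ((gc u ν ξ).2 hξ)
      have h₁ : μ ≤ meet θ (ex u φ) := (hmeet _ _ _).2 ⟨((hμ μ).1 le_rfl).1,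
        ((hμ μ).1 le_rfl).2.trans ((h _).2 ((gc u φ _).1 le_rfl))⟩
      refine h₁.trans ((frob u φ θ).trans ((gc u _ _).2 ?_))
      exact ((hν _).2 ((hmeet _ _ _).1 le_rfl)).trans ((gc u ν _).1 le_rfl)

variable {X : FiberedPreorder.{w} C}

theorem reindex_le_of_eq {K J I : C} {k : K ⟶ J} {u : J ⟶ I} {m : K ⟶ I} (h : k ≫ u = m)
    (φ : X.Pred I) : X.reindex m φ ≤ X.reindex k (X.reindex u φ) :=
  h ▸ X.reindex_comp_le k u φ

theorem le_reindex_of_eq {K J I : C} {k : K ⟶ J} {u : J ⟶ I} {m : K ⟶ I} (h : k ≫ u = m)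
    (φ : X.Pred I) : X.reindex k (X.reindex u φ) ≤ X.reindex m φ :=
  h ▸ X.le_reindex_comp k u φ

theorem exists_pullback_lift [HasPullbacks C] {L M N J I : C} (e : L ⟶ M) (a : M ⟶ J) (u : J ⟶ I)
    (b : N ⟶ I) (f : L ⟶ N) (h : e ≫ a ≫ u = f ≫ b) :
    ∃ t : L ⟶ pullback b u, e ≫ a = t ≫ pullback.snd b u ∧ t ≫ pullback.fst b u = f := by
  have h' : f ≫ b = (e ≫ a) ≫ u := by rw [← h, Category.assoc]
  exact ⟨pullback.lift f (e ≫ a) h', (pullback.lift_snd _ _ _).symm, pullback.lift_fst _ _ _⟩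

theorem comp_comp_eq [HasPullbacks C] {L M N J I : C} (e : L ⟶ M) (a : M ⟶ J) (u : J ⟶ I)
    (b : N ⟶ I) (t : L ⟶ pullback b u) (h : e ≫ a = t ≫ pullback.snd b u) :
    e ≫ a ≫ u = (t ≫ pullback.fst b u) ≫ b := by
  rw [Category.assoc, pullback.condition, ← Category.assoc, h, Category.assoc]

theorem exists_frobenius_lift [HasPullbacks C] {M N J I : C} (a : M ⟶ J) (u : J ⟶ I)
    (b : N ⟶ I) : ∃ t : pullback b (a ≫ u) ⟶ pullback (pullback.snd b u) a,
      t ≫ pullback.fst (pullback.snd b u) a ≫ pullback.fst b u = pullback.fst b (a ≫ u) ∧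
      t ≫ pullback.snd (pullback.snd b u) a = pullback.snd b (a ≫ u) ∧
      t ≫ (pullback.fst (pullback.snd b u) a ≫ pullback.snd b u) ≫ u =
        pullback.fst b (a ≫ u) ≫ b := by
  have hw : pullback.fst b (a ≫ u) ≫ b = (pullback.snd b (a ≫ u) ≫ a) ≫ u := by
    rw [Category.assoc]
    exact pullback.condition
  refine ⟨pullback.lift (pullback.lift _ _ hw) (pullback.snd b (a ≫ u))
    (pullback.lift_snd _ _ _), ?_, ?_, ?_⟩
  · rw [pullback.lift_fst_assoc, pullback.lift_fst]
  · rw [pullback.lift_snd]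
  · rw [Category.assoc, pullback.lift_fst_assoc, pullback.lift_snd_assoc, hw]

theorem _root_.CategoryTheory.Regular.isRegularEpi_comp [Regular C] {A B D : C} (f : A ⟶ B)
    (g : B ⟶ D) [IsRegularEpi f] [IsRegularEpi g] : IsRegularEpi (f ≫ g) := by
  have : ExtremalEpi (f ≫ g) := inferInstance
  infer_instance

end

/-! ### Completion under existential quantification -/

section

variable {C : Type u} [Category.{v} C] (A : FiberedPreorder.{w} C)

/-- A predicate of `D A` on `I`: a map `map : dom ⟶ I` and a predicate of `A` on `dom`. -/
structure DPred (I : C) where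
  dom : C
  map : dom ⟶ I
  pred : A.Pred dom

variable {A} in
/-- The order of `D A`: `(u, φ) ≤ (v, ψ)` if there is a span `e, f` with `e` a regular epimorphism,
`u ∘ e = v ∘ f` and `e^* φ ≤ f^* ψ`. -/
def DPred.LE {I : C} (p q : A.DPred I) : Prop :=
  ∃ (L : C) (e : L ⟶ p.dom) (f : L ⟶ q.dom), IsRegularEpi e ∧ e ≫ p.map = f ≫ q.map ∧
    A.reindex e p.pred ≤ A.reindex f q.pred

variable [Regular C]

theorem DPred.transLE {I : C} {p q r : A.DPred I} : p.LE q → q.LE r → p.LE r := by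
  rintro ⟨L, e, f, he, h, hl⟩ ⟨L', e', f', he', h', hl'⟩
  refine ⟨pullback f e', pullback.fst f e' ≫ e, pullback.snd f e' ≫ f',
    Regular.isRegularEpi_comp _ _, ?_, ?_⟩
  · rw [Category.assoc, Category.assoc, h, ← h', pullback.condition_assoc]
  · refine (A.reindex_comp_le _ _ _).trans ((A.reindex_mono _ hl).trans ?_)
    refine (reindex_le_reindex _ _ _ _ pullback.condition _).trans ?_
    exact (A.reindex_mono _ hl').trans (A.le_reindex_comp _ _ _)

instance DPred.preorder (I : C) : Preorder (A.DPred I) where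
  le p q := p.LE q
  le_refl p := ⟨p.dom, 𝟙 _, 𝟙 _, inferInstance, rfl, le_rfl⟩
  le_trans _ _ _ := DPred.transLE A

variable {A} in
/-- Existential quantification in `D A` is composition. -/
def DPred.ex {J I : C} (u : J ⟶ I) (p : A.DPred J) : A.DPred I :=
  ⟨p.dom, p.map ≫ u, p.pred⟩

variable {A} in
/-- Reindexing in `D A` is pullback. -/
noncomputable def DPred.reindex {J I : C} (u : J ⟶ I) (p : A.DPred I) : A.DPred J :=
  ⟨pullback p.map u, pullback.snd p.map u, A.reindex (pullback.fst p.map u) p.pred⟩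

variable {A} in
theorem DPred.adj {J I : C} (u : J ⟶ I) (p : A.DPred J) (q : A.DPred I) :
    p.ex u ≤ q ↔ p ≤ q.reindex u := by
  obtain ⟨M, a, φ⟩ := p
  obtain ⟨N, b, ψ⟩ := q
  constructor
  · rintro ⟨L, e, f, he, h, hl⟩
    obtain ⟨t, h₁, h₂⟩ := exists_pullback_lift e a u b f h
    exact ⟨L, e, t, he, h₁, hl.trans (reindex_le_of_eq h₂ _)⟩
  · rintro ⟨L, e, f, he, h, hl⟩
    exact ⟨L, e, f ≫ pullback.fst b u, he, comp_comp_eq e a u b f h,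
      hl.trans (A.le_reindex_comp _ _ _)⟩

variable {A} in
theorem DPred.le_of_hom {I : C} {p q : A.DPred I} (f : p.dom ⟶ q.dom) (h : f ≫ q.map = p.map)
    (hl : p.pred ≤ A.reindex f q.pred) : p ≤ q :=
  ⟨p.dom, 𝟙 _, f, inferInstance, by rw [h, Category.id_comp], (A.reindex_id_le _).trans hl⟩

variable {A} in
theorem DPred.ex_mono {J I : C} (u : J ⟶ I) {p q : A.DPred J} (h : p ≤ q) : p.ex u ≤ q.ex u := by
  obtain ⟨M, a, φ⟩ := p
  obtain ⟨N, b, ψ⟩ := q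
  obtain ⟨L, e, f, he, h : e ≫ a = f ≫ b, hl⟩ := h
  refine ⟨L, e, f, he, ?_, hl⟩
  change e ≫ a ≫ u = f ≫ b ≫ u
  rw [← Category.assoc, h, Category.assoc]

variable {A} in
theorem DPred.le_ex_id {I : C} (p : A.DPred I) : p ≤ p.ex (𝟙 I) :=
  DPred.le_of_hom (𝟙 p.dom) ((Category.id_comp _).trans (Category.comp_id _)) (A.le_reindex_id _)

variable {A} in
theorem DPred.ex_id_le {I : C} (p : A.DPred I) : p.ex (𝟙 I) ≤ p :=
  DPred.le_of_hom (𝟙 p.dom) ((Category.id_comp _).trans (Category.comp_id _).symm)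
    (A.le_reindex_id _)

variable {A} in
theorem DPred.ex_comp_le {K J I : C} (v : K ⟶ J) (u : J ⟶ I) (p : A.DPred K) :
    p.ex (v ≫ u) ≤ (p.ex v).ex u :=
  DPred.le_of_hom (𝟙 p.dom) ((Category.id_comp _).trans (Category.assoc _ _ _))
    (A.le_reindex_id _)

variable {A} in
theorem DPred.le_ex_comp {K J I : C} (v : K ⟶ J) (u : J ⟶ I) (p : A.DPred K) :
    (p.ex v).ex u ≤ p.ex (v ≫ u) :=
  DPred.le_of_hom (𝟙 p.dom) ((Category.id_comp _).trans (Category.assoc _ _ _).symm)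
    (A.le_reindex_id _)

variable {A} in
/-- Meets in `D A` are given by pullback. -/
noncomputable def DPred.meet [A.HasFiniteMeets] {I : C} (p q : A.DPred I) : A.DPred I :=
  ⟨pullback p.map q.map, pullback.fst p.map q.map ≫ p.map,
    FiberedPreorder.meet (A.reindex (pullback.fst p.map q.map) p.pred)
      (A.reindex (pullback.snd p.map q.map) q.pred)⟩

variable {A} in
theorem DPred.le_meet [A.HasFiniteMeets] {I : C} (p q r : A.DPred I) :
    r ≤ p.meet q ↔ r ≤ p ∧ r ≤ q := by
  constructor
  · intro h
    exact ⟨h.trans (DPred.le_of_hom (pullback.fst p.map q.map) rfl (meet_le_left _ _)),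
      h.trans (DPred.le_of_hom (pullback.snd p.map q.map) pullback.condition.symm
        (meet_le_right _ _))⟩
  · obtain ⟨M, a, φ⟩ := p
    obtain ⟨N, b, ψ⟩ := q
    obtain ⟨R, c, χ⟩ := r
    rintro ⟨⟨L, e, f, he, h : e ≫ c = f ≫ a, hl⟩, ⟨L', e', f', he', h' : e' ≫ c = f' ≫ b, hl'⟩⟩
    have hw : (pullback.fst e e' ≫ f) ≫ a = (pullback.snd e e' ≫ f') ≫ b := by
      rw [Category.assoc, Category.assoc, ← h, ← h', pullback.condition_assoc]
    refine ⟨pullback e e', pullback.fst e e' ≫ e, pullback.lift _ _ hw,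
      Regular.isRegularEpi_comp _ _, ?_, ?_⟩
    · change (pullback.fst e e' ≫ e) ≫ c = pullback.lift _ _ hw ≫ pullback.fst a b ≫ a
      rw [pullback.lift_fst_assoc, Category.assoc, Category.assoc, h]
    · apply le_reindex_meet
      · refine le_trans ?_ (reindex_le_of_eq (pullback.lift_fst _ _ hw) _)
        exact (A.reindex_comp_le _ _ _).trans ((A.reindex_mono _ hl).trans
          (A.le_reindex_comp _ _ _))
      · refine le_trans ?_ (reindex_le_of_eq (pullback.lift_snd _ _ hw) _)
        rw [pullback.condition]
        exact (A.reindex_comp_le _ _ _).trans ((A.reindex_mono _ hl').trans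
          (A.le_reindex_comp _ _ _))

variable {A} in
theorem DPred.beckChevalley {P J K I : C} {v' : P ⟶ J} {u' : P ⟶ K} {u : J ⟶ I} {v : K ⟶ I}
    (sq : IsPullback v' u' u v) (p : A.DPred J) :
    (p.ex u).reindex v ≤ (p.reindex v').ex u' := by
  obtain ⟨M, a, φ⟩ := p
  have hw : (pullback.fst (a ≫ u) v ≫ a) ≫ u = pullback.snd (a ≫ u) v ≫ v := by
    rw [Category.assoc]
    exact pullback.condition
  refine DPred.le_of_hom
    (pullback.lift (pullback.fst (a ≫ u) v) (sq.lift _ _ hw) (sq.lift_fst _ _ _).symm) ?_ ?_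
  · refine (pullback.lift_snd_assoc _ _ _ _).trans ?_
    exact sq.lift_snd _ _ _
  · exact reindex_le_of_eq (pullback.lift_fst _ _ _) _

variable {A} in
theorem DPred.frobenius [A.HasFiniteMeets] {J I : C} (u : J ⟶ I) (p : A.DPred J)
    (q : A.DPred I) : q.meet (p.ex u) ≤ ((q.reindex u).meet p).ex u := by
  obtain ⟨M, a, φ⟩ := p
  obtain ⟨N, b, ψ⟩ := q
  obtain ⟨t, h₁, h₂, h₃⟩ := exists_frobenius_lift a u b
  refine DPred.le_of_hom t h₃ (le_reindex_meet _ ?_ ?_)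
  · exact (meet_le_left _ _).trans ((reindex_le_of_eq h₁ _).trans
      (A.reindex_mono _ (A.reindex_comp_le _ _ _)))
  · exact (meet_le_right _ _).trans (reindex_le_of_eq h₂ _)

/-- The fibered preorder `D A`. -/
noncomputable def D : FiberedPreorder.{max u v w} C where
  Pred := A.DPred
  preorder := DPred.preorder A
  reindex := DPred.reindex
  reindex_mono u _ _ h := (DPred.adj _ _ _).1 (((DPred.adj u _ _).2 le_rfl).trans h)
  reindex_id_le p := (DPred.le_ex_id _).trans ((DPred.adj (𝟙 _) _ p).2 le_rfl)
  le_reindex_id p := (DPred.adj _ _ _).1 (DPred.ex_id_le p)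
  reindex_comp_le v u p := by
    rw [← DPred.adj, ← DPred.adj]
    exact (DPred.le_ex_comp _ _ _).trans ((DPred.adj (v ≫ u) _ p).2 le_rfl)
  le_reindex_comp v u p := by
    rw [← DPred.adj]
    exact (DPred.ex_comp_le _ _ _).trans ((DPred.ex_mono u ((DPred.adj v _ (p.reindex u)).2
      le_rfl)).trans ((DPred.adj u _ p).2 le_rfl))

/-- For a fibered meet-semilattice `A`, `D A` is an existential fibration. -/
instance D.isExistential [A.HasFiniteMeets] : A.D.IsExistential :=
  isExistential_of_adj A.D DPred.ex DPred.adj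
    (fun I => ⟨I, 𝟙 I, A.top I⟩)
    (fun _ p => DPred.le_of_hom (DPred.map p) (Category.comp_id _)
      ((HasFiniteMeets.reindex_top (DPred.map p) _ (fun φ => le_top φ)) _))
    DPred.meet (fun p q r => DPred.le_meet p q r) DPred.beckChevalley DPred.frobenius

end

/-! ### The total category -/

section

variable {C : Type u} [Category.{v} C] (A : FiberedPreorder.{w} C)

/-- The total category `|A|` of a fibered preorder (the Grothendieck construction). -/
structure Total where
  base : C
  pred : A.Pred base

variable {A}

/-- A morphism of `|A|` over `base`: the predicate on the domain entails the reindexing of the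
predicate on the codomain. -/
@[ext]
structure Total.Hom (x y : A.Total) where
  base : x.base ⟶ y.base
  le : x.pred ≤ A.reindex base y.pred

instance Total.category : Category A.Total where
  Hom := Total.Hom
  id x := ⟨𝟙 x.base, A.le_reindex_id _⟩
  comp f g := ⟨f.base ≫ g.base, f.le.trans ((A.reindex_mono _ g.le).trans (A.le_reindex_comp _ _ _))⟩
  id_comp _ := Total.Hom.ext (Category.id_comp _)
  comp_id _ := Total.Hom.ext (Category.comp_id _)
  assoc _ _ _ := Total.Hom.ext (Category.assoc _ _ _)

theorem Total.hom_ext {x y : A.Total} {f g : x ⟶ y} (h : f.base = g.base) : f = g :=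
  Total.Hom.ext h

theorem Total.comp_base {x y z : A.Total} (f : x ⟶ y) (g : y ⟶ z) :
    (f ≫ g).base = f.base ≫ g.base := rfl

/-- A morphism `f : x ⟶ y` of `|A|` over `u` is cover-cartesian if it is cartesian, i.e. the
predicate of `x` is isomorphic to the reindexing along `u` of the predicate of `y`, and `u` is a
regular epimorphism. -/
def Total.CoverCartesian {x y : A.Total} (f : x ⟶ y) : Prop :=
  IsRegularEpi f.base ∧ A.reindex f.base y.pred ≤ x.pred

section

variable [HasFiniteLimits C] [A.HasFiniteMeets]

theorem Total.hasPullback {x y z : A.Total} (f : x ⟶ z) (g : y ⟶ z) :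
    ∃ (p : A.Total) (a : p ⟶ x) (b : p ⟶ y), IsPullback a b f g ∧
      IsPullback a.base b.base f.base g.base ∧
      IsMeet (A.reindex a.base x.pred) (A.reindex b.base y.pred) p.pred := by
  let p : A.Total := ⟨pullback f.base g.base,
    meet (A.reindex (pullback.fst f.base g.base) x.pred)
      (A.reindex (pullback.snd f.base g.base) y.pred)⟩
  let a : p ⟶ x := ⟨pullback.fst f.base g.base, meet_le_left _ _⟩
  let b : p ⟶ y := ⟨pullback.snd f.base g.base, meet_le_right _ _⟩
  refine ⟨p, a, b, ?_, IsPullback.of_hasPullback _ _, isMeet_meet _ _⟩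
  refine IsPullback.of_isLimit' ⟨Total.hom_ext pullback.condition⟩
    (PullbackCone.IsLimit.mk _ (fun s => ⟨pullback.lift s.fst.base s.snd.base
      (congrArg Total.Hom.base s.condition), ?_⟩) ?_ ?_ ?_)
  · exact le_reindex_meet _ ((Total.Hom.le s.fst).trans (reindex_le_of_eq (pullback.lift_fst _ _ _) _))
      ((Total.Hom.le s.snd).trans (reindex_le_of_eq (pullback.lift_snd _ _ _) _))
  · intro s
    exact Total.hom_ext (pullback.lift_fst _ _ _)
  · intro s
    exact Total.hom_ext (pullback.lift_snd _ _ _)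
  · intro s m hm hm'
    apply Total.hom_ext
    refine pullback.hom_ext ?_ ?_
    · exact (congrArg Total.Hom.base hm).trans (pullback.lift_fst _ _ _).symm
    · exact (congrArg Total.Hom.base hm').trans (pullback.lift_snd _ _ _).symm

instance Total.hasFiniteLimits : HasFiniteLimits A.Total := by
  have : HasTerminal A.Total := by
    let t : A.Total := ⟨⊤_ C, A.top _⟩
    have : ∀ x : A.Total, Unique (x ⟶ t) := fun x =>
      ⟨⟨⟨terminal.from _, HasFiniteMeets.reindex_top _ _ (fun φ => le_top φ) _⟩⟩,
        fun f => Total.hom_ext (Subsingleton.elim _ _)⟩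
    exact hasTerminal_of_unique t
  have : HasPullbacks A.Total := by
    have : ∀ {x y z : A.Total} (f : x ⟶ z) (g : y ⟶ z), HasPullback f g := by
      intro x y z f g
      obtain ⟨p, a, b, h, -⟩ := Total.hasPullback f g
      exact h.hasPullback
    exact hasPullbacks_of_hasLimit_cospan _
  exact hasFiniteLimits_of_hasTerminal_and_pullbacks

end

theorem Total.CoverCartesian.id (x : A.Total) : Total.CoverCartesian (𝟙 x) :=
  ⟨inferInstanceAs (IsRegularEpi (𝟙 x.base)), A.reindex_id_le _⟩

variable [Regular C]

theorem Total.CoverCartesian.comp {x y z : A.Total} {f : x ⟶ y} {g : y ⟶ z}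
    (hf : Total.CoverCartesian f) (hg : Total.CoverCartesian g) :
    Total.CoverCartesian (f ≫ g) := by
  have := hf.1
  have := hg.1
  exact ⟨Regular.isRegularEpi_comp f.base g.base,
    (A.reindex_comp_le _ _ _).trans ((A.reindex_mono _ hg.2).trans hf.2)⟩

theorem Total.CoverCartesian.exists_pullback [A.HasFiniteMeets] {x y z : A.Total} {e : x ⟶ z}
    (he : Total.CoverCartesian e) (g : y ⟶ z) :
    ∃ (p : A.Total) (a : p ⟶ x) (b : p ⟶ y), Total.CoverCartesian b ∧ a ≫ e = b ≫ g := by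
  obtain ⟨p, a, b, h, h', hm⟩ := Total.hasPullback e g
  refine ⟨p, a, b, ⟨Regular.regularEpiIsStableUnderBaseChange.of_isPullback h' he.1, ?_⟩, h.w⟩
  refine (hm _).2 ⟨?_, le_rfl⟩
  refine (A.reindex_mono _ (Total.Hom.le g)).trans (((A.le_reindex_comp _ _ _)).trans ?_)
  rw [← h'.w]
  exact (A.reindex_comp_le _ _ _).trans (A.reindex_mono _ he.2)

end

/-! ### The fibration of sieves -/

section

variable {C : Type u} [Category.{v} C] (A : FiberedPreorder.{w} C)

variable {A} in
/-- A predicate of `siev A` on `x`: a morphism of `|A|` with codomain `x`. -/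
structure SievPred (x : A.Total) where
  dom : A.Total
  map : dom ⟶ x

variable {A} in
/-- The order of `siev A`: `f ≤ g` if `f ∘ e = g ∘ k` for some `k` and a cover-cartesian `e`. -/
def SievPred.LE {x : A.Total} (f g : SievPred x) : Prop :=
  ∃ (y : A.Total) (e : y ⟶ f.dom) (k : y ⟶ g.dom), Total.CoverCartesian e ∧
    e ≫ f.map = k ≫ g.map

variable [Regular C] [A.HasFiniteMeets]

instance SievPred.preorder (x : A.Total) : Preorder (SievPred x) where
  le f g := f.LE g
  le_refl f := ⟨f.dom, 𝟙 _, 𝟙 _, Total.CoverCartesian.id _, rfl⟩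
  le_trans := by
    rintro f g h ⟨y, e, k, he, hk⟩ ⟨y', e', k', he', hk'⟩
    obtain ⟨p, a, b, hb, hab⟩ := he'.exists_pullback k
    refine ⟨p, b ≫ e, a ≫ k', hb.comp he, ?_⟩
    rw [Category.assoc, hk, ← Category.assoc, ← hab, Category.assoc, hk', Category.assoc]

variable {A}

/-- Existential quantification in `siev A` is composition. -/
def SievPred.ex {x y : A.Total} (u : x ⟶ y) (f : SievPred x) : SievPred y :=
  ⟨f.dom, f.map ≫ u⟩

/-- Reindexing in `siev A` is pullback. -/
noncomputable def SievPred.reindex {x y : A.Total} (u : x ⟶ y) (f : SievPred y) : SievPred x :=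
  ⟨pullback f.map u, pullback.snd f.map u⟩

/-- Meets in `siev A` are given by pullback. -/
noncomputable def SievPred.meet {x : A.Total} (f g : SievPred x) : SievPred x :=
  ⟨pullback f.map g.map, pullback.fst f.map g.map ≫ f.map⟩

theorem SievPred.adj {x y : A.Total} (u : x ⟶ y) (f : SievPred x) (g : SievPred y) :
    f.ex u ≤ g ↔ f ≤ g.reindex u := by
  obtain ⟨m, a⟩ := f
  obtain ⟨n, b⟩ := g
  constructor
  · rintro ⟨l, e, k, he, h⟩
    obtain ⟨t, h', -⟩ := exists_pullback_lift e a u b k h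
    exact ⟨l, e, t, he, h'⟩
  · rintro ⟨l, e, k, he, h⟩
    exact ⟨l, e, k ≫ pullback.fst b u, he, comp_comp_eq e a u b k h⟩

theorem SievPred.le_of_hom {x : A.Total} {f g : SievPred x} (k : f.dom ⟶ g.dom)
    (h : k ≫ g.map = f.map) : f ≤ g :=
  ⟨f.dom, 𝟙 _, k, Total.CoverCartesian.id _, by rw [h, Category.id_comp]⟩

theorem SievPred.ex_mono {x y : A.Total} (u : x ⟶ y) {f g : SievPred x} (h : f ≤ g) :
    f.ex u ≤ g.ex u := by
  obtain ⟨m, a⟩ := f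
  obtain ⟨n, b⟩ := g
  obtain ⟨l, e, k, he, h : e ≫ a = k ≫ b⟩ := h
  refine ⟨l, e, k, he, ?_⟩
  change e ≫ a ≫ u = k ≫ b ≫ u
  rw [← Category.assoc, h, Category.assoc]

theorem SievPred.le_ex_id {x : A.Total} (f : SievPred x) : f ≤ f.ex (𝟙 x) :=
  SievPred.le_of_hom (𝟙 f.dom) ((Category.id_comp _).trans (Category.comp_id _))

theorem SievPred.ex_id_le {x : A.Total} (f : SievPred x) : f.ex (𝟙 x) ≤ f :=
  SievPred.le_of_hom (𝟙 f.dom) ((Category.id_comp _).trans (Category.comp_id _).symm)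

theorem SievPred.ex_comp_le {x y z : A.Total} (v : x ⟶ y) (u : y ⟶ z) (f : SievPred x) :
    f.ex (v ≫ u) ≤ (f.ex v).ex u :=
  SievPred.le_of_hom (𝟙 f.dom) ((Category.id_comp _).trans (Category.assoc _ _ _))

theorem SievPred.le_ex_comp {x y z : A.Total} (v : x ⟶ y) (u : y ⟶ z) (f : SievPred x) :
    (f.ex v).ex u ≤ f.ex (v ≫ u) :=
  SievPred.le_of_hom (𝟙 f.dom) ((Category.id_comp _).trans (Category.assoc _ _ _).symm)

theorem SievPred.le_meet {x : A.Total} (f g h : SievPred x) :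
    h ≤ f.meet g ↔ h ≤ f ∧ h ≤ g := by
  constructor
  · intro H
    exact ⟨H.trans (SievPred.le_of_hom (pullback.fst f.map g.map) rfl),
      H.trans (SievPred.le_of_hom (pullback.snd f.map g.map) pullback.condition.symm)⟩
  · obtain ⟨m, a⟩ := f
    obtain ⟨n, b⟩ := g
    obtain ⟨r, c⟩ := h
    rintro ⟨⟨l, e, k, he, h : e ≫ c = k ≫ a⟩, ⟨l', e', k', he', h' : e' ≫ c = k' ≫ b⟩⟩
    obtain ⟨p, s, t, ht, hst⟩ := he.exists_pullback e'
    have hw : (s ≫ k) ≫ a = (t ≫ k') ≫ b := by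
      rw [Category.assoc, Category.assoc, ← h, ← h', ← Category.assoc, hst, Category.assoc]
    refine ⟨p, t ≫ e', pullback.lift _ _ hw, ht.comp he', ?_⟩
    change (t ≫ e') ≫ c = pullback.lift _ _ hw ≫ pullback.fst a b ≫ a
    rw [pullback.lift_fst_assoc, Category.assoc, hw, Category.assoc, h']

theorem SievPred.beckChevalley {p x y z : A.Total} {v' : p ⟶ x} {u' : p ⟶ y} {u : x ⟶ z}
    {v : y ⟶ z} (sq : IsPullback v' u' u v) (f : SievPred x) :
    (f.ex u).reindex v ≤ (f.reindex v').ex u' := by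
  obtain ⟨m, a⟩ := f
  have hw : (pullback.fst (a ≫ u) v ≫ a) ≫ u = pullback.snd (a ≫ u) v ≫ v := by
    rw [Category.assoc]
    exact pullback.condition
  refine SievPred.le_of_hom
    (pullback.lift (pullback.fst (a ≫ u) v) (sq.lift _ _ hw) (sq.lift_fst _ _ _).symm) ?_
  refine (pullback.lift_snd_assoc _ _ _ _).trans ?_
  exact sq.lift_snd _ _ _

theorem SievPred.frobenius {x y : A.Total} (u : x ⟶ y) (f : SievPred x) (g : SievPred y) :
    g.meet (f.ex u) ≤ ((g.reindex u).meet f).ex u := by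
  obtain ⟨m, a⟩ := f
  obtain ⟨n, b⟩ := g
  obtain ⟨t, -, -, h⟩ := exists_frobenius_lift a u b
  exact SievPred.le_of_hom t h

variable (A)

/-- The fibration of sieves, a fibered preorder on the total category `|A|`. -/
noncomputable def siev : FiberedPreorder.{max u v w} A.Total where
  Pred x := SievPred x
  preorder := SievPred.preorder A
  reindex := SievPred.reindex
  reindex_mono u _ _ h := (SievPred.adj _ _ _).1 (((SievPred.adj u _ _).2 le_rfl).trans h)
  reindex_id_le p := (SievPred.le_ex_id _).trans ((SievPred.adj (𝟙 _) _ p).2 le_rfl)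
  le_reindex_id p := (SievPred.adj _ _ _).1 (SievPred.ex_id_le p)
  reindex_comp_le v u p := by
    rw [← SievPred.adj, ← SievPred.adj]
    exact (SievPred.le_ex_comp _ _ _).trans ((SievPred.adj (v ≫ u) _ p).2 le_rfl)
  le_reindex_comp v u p := by
    rw [← SievPred.adj]
    exact (SievPred.ex_comp_le _ _ _).trans ((SievPred.ex_mono u
      ((SievPred.adj v _ (p.reindex u)).2 le_rfl)).trans ((SievPred.adj u _ p).2 le_rfl))

instance siev.isExistential : A.siev.IsExistential :=
  isExistential_of_adj A.siev SievPred.ex SievPred.adj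
    (fun x => ⟨x, 𝟙 x⟩) (fun _ f => SievPred.le_of_hom (SievPred.map f) (Category.comp_id _))
    SievPred.meet (fun p q r => SievPred.le_meet p q r) SievPred.beckChevalley
    SievPred.frobenius

end

/-! ### The categories `E[X]` and `E{A}` -/

section

variable {C : Type u} [Category.{v} C]

/-- `C[X]`, for a fibered frame `X` on `C`: the category of partial equivalence relations and
functional relations in `X`. -/
abbrev SheafCat [HasFiniteLimits C] (X : FiberedPreorder.{w} C) [X.IsExistential] := X.PER

variable [Regular C] (A : FiberedPreorder.{w} C) [A.HasFiniteMeets]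

/-- A partial equivalence relation is total if it is reflexive. -/
def PER.IsTotal {C : Type u} [Category.{v} C] [HasFiniteLimits C] {X : FiberedPreorder.{w} C}
    [X.IsExistential] : ObjectProperty X.PER :=
  fun R => IsTop (at₂ R.rel (𝟙 R.carrier) (𝟙 R.carrier))

/-- `C{A}`, for a pre-stack `A` of meet-semilattices on `C`: the category of (total) equivalence
relations and functional relations in the fibration of sieves on `A`. -/
abbrev PresheafCat := (PER.IsTotal (X := A.siev)).FullSubcategory

end

end FiberedPreorder

set_option linter.unusedSectionVars false

/-! ### Local cartesian closure -/

section

universe v₁ u₁ v₂ u₂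

/-! Both categories of relations are equivalent to one category of sheaves, and for that category
local cartesian closure can be compared directly with the logic of `D A`.

Give |A| the coverage by single cover-cartesian maps. A partial equivalence relation R determines a
sheaf on |A| (`Stages.toPsh`): an element at s is an equivalence class of elements of the carrier
that exist on a cover of s. `Stages` isolates what makes this functor full and faithful: every
predicate is the existential image of a stage, existential quantifiers are witnessed on covers,
predicates are local for covers, and the maps of stages are exactly the maps of the base that
respect the predicates. Fullness is `Stages.IsPresentation.exists_graph`: a map of sheaves is
determined by its effect on one generic element, so its graph is again a predicate. Both `D A`
(through the pre-stack condition) and the fibration of sieves have |A| as their site of stages. The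
images are the same: the sheaves F in `IsPresented`, whose elements have local names in some object
I of E, such that "c and d name the same element" is a predicate of `D A`. This gives
`nonempty_sheafCat_equivalence` and `nonempty_presheafCat_equivalence`. It remains to show that the
presented sheaves are locally cartesian closed iff `D A` has implication and universal
quantification.

If `D A` has these connectives, presented sheaves are closed under the terminal object, pullbacks
and local exponentials of presheaves. Exponentials are the hard case (`isPresented_exp`). For Y and
Z over X, take a generic element y of Y, living at a stage x. An element of the exponential is
determined by its values on the restrictions of y, hence by a relation between x.base and the names
of Z. Such relations are parametrised by a power object Q of E, so that names live in I ⨯ Q. That a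
relation is total, and that two relations agree with each other, are statements built from ∀ and →,
which is where the connectives are used.

Conversely, given u : I' ⟶ I and predicates p, q on I', regard p as a sheaf over the sheaf of
elements of I, and p ∧ q as a subsheaf of p. The dependent product of this inclusion along u has an
image in I that is a predicate of `D A`, and this predicate is ∀_u (p → q)
(`exists_forces_iff_allImp`). The special cases p = ⊤ and u = 𝟙 give universal quantification and
implication. -/

theorem IsCartesianClosed.of_equivalence {C : Type u₁} [Category.{v₁} C] {D : Type u₂}
    [Category.{v₂} D] (e : C ≌ D) (h : IsCartesianClosed C) : IsCartesianClosed D := by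
  obtain ⟨_, ⟨_⟩⟩ := h
  have : HasFiniteProducts D := ⟨fun n =>
    Adjunction.hasLimitsOfShape_of_equivalence e.inverse⟩
  let : CartesianMonoidalCategory D := .ofHasFiniteProducts
  exact ⟨inferInstance, ⟨cartesianClosedOfEquiv e⟩⟩

theorem IsLocallyCartesianClosed.of_equivalence {C : Type u₁} [Category.{v₁} C] {D : Type u₂}
    [Category.{v₂} D] (e : C ≌ D) (h : IsLocallyCartesianClosed C) :
    IsLocallyCartesianClosed D := by
  obtain ⟨_, h⟩ := h
  refine ⟨⟨fun J _ _ => Adjunction.hasLimitsOfShape_of_equivalence e.inverse⟩, fun X => ?_⟩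
  exact (h (e.inverse.obj X)).of_equivalence (Over.postEquiv X e.symm).symm

/-- A category with finite products is cartesian closed if all evaluation maps exist. -/
theorem isCartesianClosed_of_exists_eval (C : Type u₁) [Category.{v₁} C]
    [CartesianMonoidalCategory C]
    (h : ∀ Y Z : C, ∃ (W : C) (ev : MonoidalCategory.tensorObj Y W ⟶ Z), ∀ (T : C)
      (f : MonoidalCategory.tensorObj Y T ⟶ Z), ∃! k : T ⟶ W,
        MonoidalCategory.whiskerLeft Y k ≫ ev = f) : IsCartesianClosed C := by
  refine ⟨inferInstance, ⟨⟨fun Y => ?_⟩⟩⟩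
  have : (MonoidalCategory.tensorLeft Y).IsLeftAdjoint := by
    have : ∀ Z, HasTerminal (CostructuredArrow (MonoidalCategory.tensorLeft Y) Z) := by
      intro Z
      obtain ⟨W, ev, H⟩ := h Y Z
      have : ∀ T : CostructuredArrow (MonoidalCategory.tensorLeft Y) Z,
          Nonempty (Unique (T ⟶ CostructuredArrow.mk (S := MonoidalCategory.tensorLeft Y)
            (Y := W) ev)) := by
        intro T
        obtain ⟨k, hk, hk'⟩ := H T.left T.hom
        exact ⟨⟨⟨CostructuredArrow.homMk k hk⟩, fun g =>
          CostructuredArrow.hom_ext _ _ (hk' _ (CostructuredArrow.w g))⟩⟩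
      have := fun T => (this T).some
      exact hasTerminal_of_unique (CostructuredArrow.mk
        (S := MonoidalCategory.tensorLeft Y) (Y := W) ev)
    exact isLeftAdjoint_of_costructuredArrowTerminals _
  exact { rightAdj := (MonoidalCategory.tensorLeft Y).rightAdjoint
          adj := Adjunction.ofIsLeftAdjoint _ }

/-- A category with finite limits is locally cartesian closed if its slices have evaluation
maps. -/
theorem isLocallyCartesianClosed_of_exists_eval (C : Type u₁) [Category.{v₁} C]
    [HasFiniteLimits C]
    (h : ∀ {X Y Z : C} (f : Y ⟶ X) (g : Z ⟶ X), ∃ (W : C) (w : W ⟶ X) (ev : pullback f w ⟶ Z),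
      ev ≫ g = pullback.fst f w ≫ f ∧ ∀ (T : C) (t : T ⟶ X) (a : pullback f t ⟶ Z),
        a ≫ g = pullback.fst f t ≫ f → ∃! k : T ⟶ W, k ≫ w = t ∧
          ∀ m : pullback f t ⟶ pullback f w, m ≫ pullback.fst f w = pullback.fst f t →
            m ≫ pullback.snd f w = pullback.snd f t ≫ k → m ≫ ev = a) :
    IsLocallyCartesianClosed C := by
  refine ⟨inferInstance, fun X => ?_⟩
  let := Over.cartesianMonoidalCategory X
  refine isCartesianClosed_of_exists_eval _ fun Y Z => ?_
  obtain ⟨W, w, ev, hev, H⟩ := h Y.hom Z.hom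
  refine ⟨Over.mk w, Over.homMk ev hev, fun T a => ?_⟩
  obtain ⟨k, ⟨hk, hk'⟩, hu⟩ := H T.left T.hom a.left (Over.w a)
  have key : ∀ k : T ⟶ Over.mk w, MonoidalCategory.whiskerLeft Y k ≫
      (Over.homMk ev hev : MonoidalCategory.tensorObj Y (Over.mk w) ⟶ Z) = a ↔
      ∀ m : pullback Y.hom T.hom ⟶ pullback Y.hom w,
        m ≫ pullback.fst Y.hom w = pullback.fst Y.hom T.hom →
        m ≫ pullback.snd Y.hom w = pullback.snd Y.hom T.hom ≫ k.left → m ≫ ev = a.left := by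
    intro k
    have h₁ : (MonoidalCategory.whiskerLeft Y k).left ≫ pullback.fst Y.hom w =
        pullback.fst Y.hom T.hom :=
      congrArg CommaMorphism.left (CartesianMonoidalCategory.whiskerLeft_fst Y k)
    have h₂ : (MonoidalCategory.whiskerLeft Y k).left ≫ pullback.snd Y.hom w =
        pullback.snd Y.hom T.hom ≫ k.left :=
      congrArg CommaMorphism.left (CartesianMonoidalCategory.whiskerLeft_snd Y k)
    constructor
    · rintro rfl m h h'
      have : m = (MonoidalCategory.whiskerLeft Y k).left :=
        pullback.hom_ext (h.trans h₁.symm) (h'.trans h₂.symm)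
      rw [this]
      rfl
    · intro h
      exact Over.OverMorphism.ext (h _ h₁ h₂)
  exact ⟨Over.homMk k hk, (key _).2 hk', fun k' e => Over.OverMorphism.ext
    (hu _ ⟨Over.w k', (key _).1 e⟩)⟩

/-- In a locally cartesian closed category, a generic `t : T ⟶ X` whose pullback to `Y` factors
through `b : B ⟶ Y`. -/
theorem IsLocallyCartesianClosed.exists_forall {C : Type u₁} [Category.{v₁} C]
    (hC : IsLocallyCartesianClosed C) {X Y B : C} (f : Y ⟶ X) (b : B ⟶ Y) :
    ∃ (T : C) (t : T ⟶ X),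
      (∀ {V : C} (y : V ⟶ Y) (k : V ⟶ T), y ≫ f = k ≫ t → ∃ z : V ⟶ B, z ≫ b = y) ∧
      ∀ {S P : C} (s : S ⟶ X) (p : P ⟶ Y) (q : P ⟶ S), IsPullback p q f s →
        (∃ z : P ⟶ B, z ≫ b = p) → ∃ k : S ⟶ T, k ≫ t = s := by
  obtain ⟨_, hC⟩ := hC
  obtain ⟨_, ⟨_⟩⟩ := hC X
  let Y' : Over X := Over.mk f
  let B' : Over X := Over.mk (b ≫ f)
  let b' : B' ⟶ Y' := Over.homMk b
  -- The dependent product of b along f: the part of the exponential of B' by Y' in the slice whose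
  -- image under b' is the identity of Y'. Maps S ⟶ T are thus lifts of the projection Y' × S ⟶ Y'
  -- through b'.
  let T := pullback ((ihom Y').map b') (MonoidalClosed.curry (A := Y')
    (CartesianMonoidalCategory.fst Y' (MonoidalCategoryStruct.tensorUnit (Over X))))
  have hT : ∀ S : Over X, Nonempty (S ⟶ T) ↔
      ∃ z : MonoidalCategory.tensorObj Y' S ⟶ B',
        z ≫ b' = CartesianMonoidalCategory.fst Y' S := by
    intro S
    have h₁ : ∀ s : S ⟶ MonoidalCategoryStruct.tensorUnit (Over X),
        MonoidalClosed.uncurry (s ≫ MonoidalClosed.curry (A := Y')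
          (CartesianMonoidalCategory.fst Y' (MonoidalCategoryStruct.tensorUnit (Over X)))) =
          CartesianMonoidalCategory.fst Y' S := by
      intro s
      rw [MonoidalClosed.uncurry_natural_left, MonoidalClosed.uncurry_curry,
        CartesianMonoidalCategory.whiskerLeft_fst]
    constructor
    · rintro ⟨k⟩
      refine ⟨MonoidalClosed.uncurry (k ≫ pullback.fst _ _), ?_⟩
      rw [← MonoidalClosed.uncurry_natural_right, Category.assoc, pullback.condition,
        ← Category.assoc, h₁]
    · rintro ⟨z, hz⟩
      refine ⟨pullback.lift (MonoidalClosed.curry z) (CartesianMonoidalCategory.toUnit S) ?_⟩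
      apply MonoidalClosed.uncurry_injective
      rw [h₁, MonoidalClosed.uncurry_natural_right, MonoidalClosed.uncurry_curry, hz]
  refine ⟨T.left, T.hom, ?_, ?_⟩
  · intro V y k h
    obtain ⟨z, hz⟩ := (hT T).1 ⟨𝟙 T⟩
    let y' : Over.mk (y ≫ f) ⟶ Y' := Over.homMk y
    let k' : Over.mk (y ≫ f) ⟶ T := Over.homMk k h.symm
    refine ⟨(CartesianMonoidalCategory.lift y' k' ≫ z).left, ?_⟩
    have : (CartesianMonoidalCategory.lift y' k' ≫ z) ≫ b' = y' := by
      rw [Category.assoc, hz, CartesianMonoidalCategory.lift_fst]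
    exact congrArg CommaMorphism.left this
  · rintro S P s p q sq ⟨z, hz⟩
    let S' : Over X := Over.mk s
    have e₁ := Over.w (CartesianMonoidalCategory.fst Y' S')
    have e₂ := Over.w (CartesianMonoidalCategory.snd Y' S')
    -- The product in the slice is an arbitrary one, known only by its projections, so it is
    -- compared with P by the universal property of the given square.
    let l := sq.lift (CartesianMonoidalCategory.fst Y' S').left
      (CartesianMonoidalCategory.snd Y' S').left (e₁.trans e₂.symm)
    have hl : l ≫ p = _ := sq.lift_fst _ _ _
    obtain ⟨k⟩ := (hT S').2 ⟨Over.homMk (l ≫ z) (by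
      change (l ≫ z) ≫ b ≫ f = _
      rw [Category.assoc, reassoc_of% hz, reassoc_of% hl]
      exact e₁), Over.OverMorphism.ext (by
        change (l ≫ z) ≫ b = _
        rw [Category.assoc, hz, hl])⟩
    exact ⟨k.left, Over.w k⟩

end

/-! ### Presheaves and sheaves for a coverage by single maps -/

section

universe w' v₁ u₁

/-- A presheaf of sets on `S`. -/
structure Psh (S : Type u₁) [Category.{v₁} S] where
  obj : S → Type w'
  res : ∀ {t s : S}, (t ⟶ s) → obj s → obj t
  res_id : ∀ {s : S} (x : obj s), res (𝟙 s) x = x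
  res_res : ∀ {r t s : S} (l : r ⟶ t) (k : t ⟶ s) (x : obj s), res l (res k x) = res (l ≫ k) x

variable {S : Type u₁} [Category.{v₁} S]

namespace Psh

attribute [simp] Psh.res_id

/-- A map of presheaves. -/
@[ext]
structure Hom (F G : Psh.{w'} S) where
  app : ∀ {s : S}, F.obj s → G.obj s
  app_res : ∀ {t s : S} (k : t ⟶ s) (x : F.obj s), app (F.res k x) = G.res k (app x)

instance category : Category (Psh.{w'} S) where
  Hom := Hom
  id _ := ⟨fun x => x, fun _ _ => rfl⟩
  comp f g := ⟨fun x => g.app (f.app x), fun k x => by rw [f.app_res, g.app_res]⟩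

@[ext]
theorem hom_ext {F G : Psh.{w'} S} {f g : F ⟶ G}
    (h : ∀ (s : S) (x : F.obj s), Hom.app f x = Hom.app g x) : f = g :=
  Hom.ext (funext fun s => funext fun x => h s x)

theorem app_res {F G : Psh.{w'} S} (f : F ⟶ G) {t s : S} (k : t ⟶ s) (x : F.obj s) :
    Hom.app f (F.res k x) = G.res k (Hom.app f x) :=
  Hom.app_res f k x

theorem app_res_res {F G : Psh.{w'} S} (f : F ⟶ G) {r t s : S} (l : r ⟶ t) (k : t ⟶ s)
    (x : F.obj s) : Hom.app f (F.res l (F.res k x)) = G.res (l ≫ k) (Hom.app f x) := by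
  rw [app_res, app_res, G.res_res]

theorem congr_app {F G : Psh.{w'} S} {f g : F ⟶ G} (h : f = g) {s : S} (x : F.obj s) :
    Hom.app f x = Hom.app g x := by rw [h]

theorem exists_iso {F G : Psh.{w'} S} (f : F ⟶ G)
    (h : ∀ s, Function.Bijective (Hom.app f (s := s))) : Nonempty (F ≅ G) := by
  choose g hg hg' using fun s => Function.bijective_iff_has_inverse.1 (h s)
  exact ⟨⟨f, ⟨fun {s} x => g s x, fun k x => (h _).1 (by
    rw [hg' _, app_res, hg' _])⟩, hom_ext fun s x => hg s x, hom_ext fun s x => hg' s x⟩⟩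

end Psh

/-- A coverage whose covering families are single maps. -/
structure SingletonCoverage (S : Type u₁) [Category.{v₁} S] where
  Cov : ∀ ⦃t s : S⦄, (t ⟶ s) → Prop
  id : ∀ s : S, Cov (𝟙 s)
  comp : ∀ {r t s : S} {f : r ⟶ t} {g : t ⟶ s}, Cov f → Cov g → Cov (f ≫ g)
  exists_pullback : ∀ {x y z : S} {e : x ⟶ z}, Cov e → ∀ g : y ⟶ z,
    ∃ (p : S) (a : p ⟶ x) (b : p ⟶ y), Cov b ∧ a ≫ e = b ≫ g

variable {J : SingletonCoverage S}

/-- The sheaf condition. -/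
structure Psh.IsSheaf (J : SingletonCoverage S) (F : Psh.{w'} S) : Prop where
  sep : ∀ {t s : S} {e : t ⟶ s}, J.Cov e → ∀ {x y : F.obj s}, F.res e x = F.res e y → x = y
  glue : ∀ {t s : S} {e : t ⟶ s}, J.Cov e → ∀ z : F.obj t,
    (∀ {r : S} (a b : r ⟶ t), a ≫ e = b ≫ e → F.res a z = F.res b z) → ∃ x, F.res e x = z

/-- The matching family is a relation rather than a function, so that it can be described by names
without choosing any. A value on one cover suffices: any other value is compared with it on a
pullback of that cover. -/
theorem Psh.IsSheaf.exists_amalgamation {F : Psh.{w'} S} (hF : F.IsSheaf J) {s : S}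
    (R : ∀ {t : S}, (t ⟶ s) → F.obj t → Prop)
    (hR : ∀ {r t : S} (l : r ⟶ t) {k : t ⟶ s} {x : F.obj t}, R k x → R (l ≫ k) (F.res l x))
    (hR' : ∀ {t : S} {k : t ⟶ s} {x y : F.obj t}, R k x → R k y → x = y)
    (h : ∃ (t : S) (e : t ⟶ s) (x : F.obj t), J.Cov e ∧ R e x) :
    ∃ y : F.obj s, ∀ {t : S} (k : t ⟶ s) (x : F.obj t), R k x → F.res k y = x := by
  obtain ⟨t, e, x, he, hx⟩ := h
  obtain ⟨y, hy⟩ := hF.glue he x fun a b hab => hR' (hR a hx) (hab ▸ hR b hx)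
  refine ⟨y, fun {r} k x' hx' => ?_⟩
  obtain ⟨p, a, b, hb, hab⟩ := J.exists_pullback he k
  refine hF.sep hb ?_
  rw [F.res_res, ← hab, ← F.res_res, hy]
  exact hR' (hR a hx) (hab ▸ hR b hx')

end

/-! ### Forcing semantics of an existential fibration over a site of stages -/

namespace FiberedPreorder

section

universe w' v₁ u₁

variable {C : Type u} [Category.{v} C] [HasFiniteLimits C] {S : Type u₁} [Category.{v₁} S]

/-- A site of stages for the existential fibration `X`: a system of predicates `pred s` such that
every predicate is an existential quantification of one of these, and for which existential
quantifiers can be witnessed after passing to a cover. -/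
structure Stages (X : FiberedPreorder.{w} C) [X.IsExistential] (J : SingletonCoverage S) where
  K : S ⥤ C
  pred : ∀ s, X.Pred (K.obj s)
  pred_le : ∀ {t s : S} (k : t ⟶ s), pred t ≤ X.reindex (K.map k) (pred s)
  exists_map : ∀ {t s : S} (c : K.obj t ⟶ K.obj s), pred t ≤ X.reindex c (pred s) →
    ∃ k : t ⟶ s, K.map k = c
  le_of_cov : ∀ {t s : S} {e : t ⟶ s}, J.Cov e → ∀ {p : X.Pred (K.obj s)},
    pred t ≤ X.reindex (K.map e) p → pred s ≤ p
  exists_of_le_ex : ∀ {s : S} {I' I : C} (u : I' ⟶ I) (p : X.Pred I') (a : K.obj s ⟶ I),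
    pred s ≤ X.reindex a (ex u p) → ∃ (t : S) (e : t ⟶ s) (b : K.obj t ⟶ I'),
      J.Cov e ∧ b ≫ u = K.map e ≫ a ∧ pred t ≤ X.reindex b p
  exists_isEx : ∀ {I : C} (p : X.Pred I), ∃ (s : S) (a : K.obj s ⟶ I), X.IsEx a (pred s) p

namespace Stages

variable {X : FiberedPreorder.{w} C} [X.IsExistential] {J : SingletonCoverage S}
  (T : Stages X J)

/-- The predicate `p(a)` holds at the stage `s`. -/
def Forces {s : S} {I : C} (p : X.Pred I) (a : T.K.obj s ⟶ I) : Prop :=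
  T.pred s ≤ X.reindex a p

/-- The predicate `ρ(a, b)` holds at the stage `s`. -/
def Rel {s : S} {A B : C} (ρ : X.Pred (A ⨯ B)) (a : T.K.obj s ⟶ A) (b : T.K.obj s ⟶ B) : Prop :=
  T.pred s ≤ at₂ ρ a b

variable {T} {s t : S} {I I' A B D : C}

theorem Forces.mono {p q : X.Pred I} (h : p ≤ q) {a : T.K.obj s ⟶ I} (ha : T.Forces p a) :
    T.Forces q a :=
  le_trans ha (X.reindex_mono a h)

theorem forces_reindex {u : I' ⟶ I} {p : X.Pred I} {a : T.K.obj s ⟶ I'} :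
    T.Forces (X.reindex u p) a ↔ T.Forces p (a ≫ u) :=
  ⟨fun h => le_trans h (X.le_reindex_comp _ _ _), fun h => le_trans h (X.reindex_comp_le _ _ _)⟩

theorem Forces.res {p : X.Pred I} {a : T.K.obj s ⟶ I} (ha : T.Forces p a) (k : t ⟶ s) :
    T.Forces p (T.K.map k ≫ a) :=
  le_trans (T.pred_le k) (le_trans (X.reindex_mono _ ha) (X.le_reindex_comp _ _ _))

theorem Forces.of_cov {p : X.Pred I} {a : T.K.obj s ⟶ I} {e : t ⟶ s} (he : J.Cov e)
    (h : T.Forces p (T.K.map e ≫ a)) : T.Forces p a :=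
  T.le_of_cov he (le_trans h (X.reindex_comp_le _ _ _))

theorem forces_meet {p q : X.Pred I} {a : T.K.obj s ⟶ I} :
    T.Forces (meet p q) a ↔ T.Forces p a ∧ T.Forces q a :=
  ⟨fun h => ⟨h.mono (meet_le_left _ _), h.mono (meet_le_right _ _)⟩,
    fun h => le_reindex_meet a h.1 h.2⟩

/-- The Kripke–Joyal clause for ∃; the converse direction uses that forcing is local. -/
theorem forces_ex {u : I' ⟶ I} {p : X.Pred I'} {a : T.K.obj s ⟶ I} :
    T.Forces (ex u p) a ↔ ∃ (t : S) (e : t ⟶ s) (b : T.K.obj t ⟶ I'),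
      J.Cov e ∧ b ≫ u = T.K.map e ≫ a ∧ T.Forces p b := by
  constructor
  · exact T.exists_of_le_ex u p a
  · rintro ⟨t, e, b, he, h, hb⟩
    exact Forces.of_cov he (le_reindex_ex u p b _ h hb)

/-- When p is the existential image of a stage, its elements are those that factor locally through
that stage; `exists_map` turns the factorisation in the base into a map of stages. -/
theorem IsEx.forces_iff {s : S} {a : T.K.obj s ⟶ I} {p : X.Pred I} (h : X.IsEx a (T.pred s) p)
    {b : T.K.obj t ⟶ I} : T.Forces p b ↔
      ∃ (r : S) (e : r ⟶ t) (l : r ⟶ s), J.Cov e ∧ T.K.map l ≫ a = T.K.map e ≫ b := by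
  have hp : p ≤ ex a (T.pred s) := (h _).2 ((isEx_ex a _ _).1 le_rfl)
  have hp' : ex a (T.pred s) ≤ p := (isEx_ex a _ _).2 ((h _).1 le_rfl)
  constructor
  · intro hb
    obtain ⟨r, e, c, he, hc, hcs⟩ := forces_ex.1 (hb.mono hp)
    obtain ⟨l, rfl⟩ := T.exists_map c hcs
    exact ⟨r, e, l, he, hc⟩
  · rintro ⟨r, e, l, he, hl⟩
    exact Forces.mono hp' (forces_ex.2 ⟨r, e, T.K.map l, he, hl, T.pred_le l⟩)

variable (T) in
-- Each predicate is the existential image of a stage, so an inequality needs testing only at the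
-- generic element there. Entailments can henceforth be proved by elements.
theorem le_of_forces {p q : X.Pred I}
    (h : ∀ {s : S} (a : T.K.obj s ⟶ I), T.Forces p a → T.Forces q a) : p ≤ q := by
  obtain ⟨s, a, hp⟩ := T.exists_isEx p
  exact (hp q).2 (h a ((hp p).1 le_rfl))

theorem forces_at₂ {ρ : X.Pred (A ⨯ B)} {a : I ⟶ A} {b : I ⟶ B} {c : T.K.obj s ⟶ I} :
    T.Forces (at₂ ρ a b) c ↔ T.Rel ρ (c ≫ a) (c ≫ b) :=
  (le_at₂_comp c).symm

theorem rel_iff {ρ : X.Pred (A ⨯ B)} {a : T.K.obj s ⟶ A} {b : T.K.obj s ⟶ B} :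
    T.Rel ρ a b ↔ T.Forces ρ (prod.lift a b) := Iff.rfl

theorem forces_iff_rel {ρ : X.Pred (A ⨯ B)} {c : T.K.obj s ⟶ A ⨯ B} :
    T.Forces ρ c ↔ T.Rel ρ (c ≫ prod.fst) (c ≫ prod.snd) := by
  rw [rel_iff, ← prod.comp_lift, prod.lift_fst_snd, Category.comp_id]

theorem Rel.res {ρ : X.Pred (A ⨯ B)} {a : T.K.obj s ⟶ A} {b : T.K.obj s ⟶ B} (h : T.Rel ρ a b)
    (k : t ⟶ s) : T.Rel ρ (T.K.map k ≫ a) (T.K.map k ≫ b) := by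
  rw [rel_iff, ← prod.comp_lift]
  exact Forces.res h k

theorem Rel.of_cov {ρ : X.Pred (A ⨯ B)} {a : T.K.obj s ⟶ A} {b : T.K.obj s ⟶ B} {e : t ⟶ s}
    (he : J.Cov e) (h : T.Rel ρ (T.K.map e ≫ a) (T.K.map e ≫ b)) : T.Rel ρ a b := by
  rw [rel_iff, ← prod.comp_lift] at h
  exact Forces.of_cov he h

theorem Rel.symm {R : X.PER} {a b : T.K.obj s ⟶ R.carrier} (h : T.Rel R.rel a b) :
    T.Rel R.rel b a :=
  PER.le_symm h

theorem Rel.trans {R : X.PER} {a b c : T.K.obj s ⟶ R.carrier} (h : T.Rel R.rel a b)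
    (h' : T.Rel R.rel b c) : T.Rel R.rel a c :=
  PER.le_trans h h'

theorem Rel.exists_of_isFunctionalRel {R R' : X.PER} {φ : X.Pred (R.carrier ⨯ R'.carrier)}
    (hφ : IsFunctionalRel R R' φ) {c : T.K.obj s ⟶ R.carrier} (h : T.Rel R.rel c c) :
    ∃ (t : S) (e : t ⟶ s) (d : T.K.obj t ⟶ R'.carrier), J.Cov e ∧ T.Rel φ (T.K.map e ≫ c) d := by
  obtain ⟨t, e, b, he, hb, hb'⟩ := T.exists_of_le_ex _ _ _ (hφ.le_tot h)
  refine ⟨t, e, b ≫ prod.snd, he, ?_⟩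
  rw [← hb]
  exact forces_iff_rel.1 hb'

theorem rel_relComp {φ : X.Pred (A ⨯ B)} {γ : X.Pred (B ⨯ D)} {a : T.K.obj s ⟶ A}
    {d : T.K.obj s ⟶ D} : T.Rel (relComp φ γ) a d ↔ ∃ (t : S) (e : t ⟶ s) (b : T.K.obj t ⟶ B),
      J.Cov e ∧ T.Rel φ (T.K.map e ≫ a) b ∧ T.Rel γ b (T.K.map e ≫ d) := by
  constructor
  · intro h
    obtain ⟨t, e, b, he, hb, hb'⟩ := forces_ex.1 h
    obtain ⟨h₁, h₂⟩ := forces_meet.1 hb'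
    have e₁ : b ≫ prod.fst ≫ prod.fst = T.K.map e ≫ a := by simpa using hb =≫ prod.fst
    have e₂ : b ≫ prod.snd = T.K.map e ≫ d := by simpa using hb =≫ prod.snd
    rw [forces_reindex, forces_iff_rel] at h₁ h₂
    simp only [Category.assoc, lift_fst, lift_snd] at h₁ h₂
    rw [e₁] at h₁
    rw [e₂] at h₂
    exact ⟨t, e, _, he, h₁, h₂⟩
  · rintro ⟨t, e, b, he, h₁, h₂⟩
    exact Rel.of_cov he (le_at₂_relComp b h₁ h₂)

variable (T) in
theorem isFunctionalRel_of_rel {R R' : X.PER} {φ : X.Pred (R.carrier ⨯ R'.carrier)}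
    (hl : ∀ {s : S} {c : T.K.obj s ⟶ R.carrier} {d : T.K.obj s ⟶ R'.carrier}, T.Rel φ c d →
      T.Rel R.rel c c ∧ T.Rel R'.rel d d)
    (hc : ∀ {s : S} {c c' : T.K.obj s ⟶ R.carrier} {d d' : T.K.obj s ⟶ R'.carrier},
      T.Rel φ c d → T.Rel R.rel c c' → T.Rel R'.rel d d' → T.Rel φ c' d')
    (hs : ∀ {s : S} {c : T.K.obj s ⟶ R.carrier} {d d' : T.K.obj s ⟶ R'.carrier},
      T.Rel φ c d → T.Rel φ c d' → T.Rel R'.rel d d')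
    (ht : ∀ {s : S} {c : T.K.obj s ⟶ R.carrier}, T.Rel R.rel c c → ∃ (t : S) (e : t ⟶ s)
      (d : T.K.obj t ⟶ R'.carrier), J.Cov e ∧ T.Rel φ (T.K.map e ≫ c) d) :
    IsFunctionalRel R R' φ where
  strict c d := T.le_of_forces fun a h => by
    rw [forces_at₂] at h
    rw [forces_meet, forces_at₂, forces_at₂]
    exact hl h
  cong c c' d d' := T.le_of_forces fun a h => by
    simp only [forces_meet, forces_at₂] at h ⊢
    exact hc h.1 h.2.1 h.2.2
  singval c d d' := T.le_of_forces fun a h => by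
    simp only [forces_meet, forces_at₂] at h ⊢
    exact hs h.1 h.2
  tot := T.le_of_forces fun a h => by
    rw [forces_at₂, Category.comp_id] at h
    obtain ⟨t, e, d, he, hd⟩ := ht h
    exact forces_ex.2 ⟨t, e, prod.lift (T.K.map e ≫ a) d, he, by simp, hd⟩

end Stages

end

end FiberedPreorder

/-! ### Partial equivalence relations as sheaves on the stages -/

namespace FiberedPreorder

section

universe w' v₁ u₁

variable {C : Type u} [Category.{v} C] [HasFiniteLimits C] {S : Type u₁} [Category.{v₁} S]

namespace Stages

variable {X : FiberedPreorder.{w} C} [X.IsExistential] {J : SingletonCoverage S}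
  (T : Stages X J)

/-- The relation at stages given by a morphism of `PER(X)`. -/
def HomRel {R R' : X.PER} (f : R ⟶ R') {s : S} (c : T.K.obj s ⟶ R.carrier)
    (d : T.K.obj s ⟶ R'.carrier) : Prop :=
  ∃ (φ : X.Pred (R.carrier ⨯ R'.carrier)) (h : IsFunctionalRel R R' φ),
    f = toAntisymmetrization (α := {φ // IsFunctionalRel R R' φ}) (· ≤ ·) ⟨φ, h⟩ ∧ T.Rel φ c d

variable {T} {s t : S} {R R' R'' : X.PER}

/-- Equivalent functional relations are forced at the same elements, so the representative chosen in
`HomRel` does not matter. -/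
theorem homRel_mk {φ : X.Pred (R.carrier ⨯ R'.carrier)} (h : IsFunctionalRel R R' φ)
    {c : T.K.obj s ⟶ R.carrier} {d : T.K.obj s ⟶ R'.carrier} :
    T.HomRel (toAntisymmetrization (α := {φ // IsFunctionalRel R R' φ}) (· ≤ ·) ⟨φ, h⟩ : R ⟶ R')
      c d ↔ T.Rel φ c d := by
  constructor
  · rintro ⟨ψ, hψ, e, hcd⟩
    exact Forces.mono (Quotient.exact e).2 hcd
  · exact fun hcd => ⟨φ, h, rfl, hcd⟩

namespace HomRel

variable {f : R ⟶ R'} {c c' : T.K.obj s ⟶ R.carrier} {d d' : T.K.obj s ⟶ R'.carrier}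

theorem left (h : T.HomRel f c d) : T.Rel R.rel c c := by
  obtain ⟨φ, hφ, -, h⟩ := h
  exact hφ.le_left h

theorem right (h : T.HomRel f c d) : T.Rel R'.rel d d := by
  obtain ⟨φ, hφ, -, h⟩ := h
  exact hφ.le_right h

theorem cong (h : T.HomRel f c d) (hc : T.Rel R.rel c c') (hd : T.Rel R'.rel d d') :
    T.HomRel f c' d' := by
  obtain ⟨φ, hφ, hf, h⟩ := h
  exact ⟨φ, hφ, hf, hφ.le_cong h hc hd⟩

theorem singval (h : T.HomRel f c d) (h' : T.HomRel f c d') : T.Rel R'.rel d d' := by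
  obtain ⟨φ, hφ, rfl, h⟩ := h
  exact hφ.le_singval h ((homRel_mk hφ).1 h')

theorem res (h : T.HomRel f c d) (k : t ⟶ s) : T.HomRel f (T.K.map k ≫ c) (T.K.map k ≫ d) := by
  obtain ⟨φ, hφ, hf, h⟩ := h
  exact ⟨φ, hφ, hf, h.res k⟩

theorem of_cov {e : t ⟶ s} (he : J.Cov e) (h : T.HomRel f (T.K.map e ≫ c) (T.K.map e ≫ d)) :
    T.HomRel f c d := by
  obtain ⟨φ, hφ, hf, h⟩ := h
  exact ⟨φ, hφ, hf, h.of_cov he⟩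

variable (f) in
theorem exists_of_rel (h : T.Rel R.rel c c) : ∃ (t : S) (e : t ⟶ s)
    (d : T.K.obj t ⟶ R'.carrier), J.Cov e ∧ T.HomRel f (T.K.map e ≫ c) d := by
  obtain ⟨φ, rfl⟩ := Quotient.exists_rep f
  obtain ⟨t, e, d, he, hd⟩ := h.exists_of_isFunctionalRel φ.2
  exact ⟨t, e, d, he, φ.1, φ.2, rfl, hd⟩

end HomRel

theorem homRel_id {c d : T.K.obj s ⟶ R.carrier} : T.HomRel (𝟙 R) c d ↔ T.Rel R.rel c d :=
  homRel_mk (IsFunctionalRel.id R)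

theorem homRel_comp {f : R ⟶ R'} {g : R' ⟶ R''} {c : T.K.obj s ⟶ R.carrier}
    {d : T.K.obj s ⟶ R''.carrier} : T.HomRel (f ≫ g) c d ↔ ∃ (t : S) (e : t ⟶ s)
      (b : T.K.obj t ⟶ R'.carrier), J.Cov e ∧ T.HomRel f (T.K.map e ≫ c) b ∧
        T.HomRel g b (T.K.map e ≫ d) := by
  obtain ⟨φ, rfl⟩ := Quotient.exists_rep f
  obtain ⟨γ, rfl⟩ := Quotient.exists_rep g
  refine (homRel_mk (φ.2.comp γ.2)).trans (rel_relComp.trans ?_)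
  exact exists_congr fun t => exists_congr fun e => exists_congr fun b =>
    and_congr_right fun _ => and_congr (homRel_mk φ.2).symm (homRel_mk γ.2).symm

variable (T) in
theorem hom_ext {f g : R ⟶ R'} (h : ∀ {s : S} {c : T.K.obj s ⟶ R.carrier}
    {d : T.K.obj s ⟶ R'.carrier}, T.HomRel f c d ↔ T.HomRel g c d) : f = g := by
  obtain ⟨φ, rfl⟩ := Quotient.exists_rep f
  obtain ⟨γ, rfl⟩ := Quotient.exists_rep g
  refine Quotient.sound ⟨T.le_of_forces fun a ha => ?_, T.le_of_forces fun a ha => ?_⟩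
  · exact forces_iff_rel.2 ((homRel_mk γ.2).1 (h.1 ((homRel_mk φ.2).2 (forces_iff_rel.1 ha))))
  · exact forces_iff_rel.2 ((homRel_mk φ.2).1 (h.2 ((homRel_mk γ.2).2 (forces_iff_rel.1 ha))))

variable (T)

/-- A generalised element of the partial equivalence relation `R` at the stage `s`: an
equivalence class of local elements. -/
structure Elt (R : X.PER) (s : S) where
  mem : ∀ {t : S}, (t ⟶ s) → (T.K.obj t ⟶ R.carrier) → Prop
  res : ∀ {r t : S} (l : r ⟶ t) {k : t ⟶ s} {c : T.K.obj t ⟶ R.carrier}, mem k c →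
    mem (l ≫ k) (T.K.map l ≫ c)
  of_cov : ∀ {r t : S} {e : r ⟶ t}, J.Cov e → ∀ {k : t ⟶ s} {c : T.K.obj t ⟶ R.carrier},
    mem (e ≫ k) (T.K.map e ≫ c) → mem k c
  rel : ∀ {t : S} {k : t ⟶ s} {c d : T.K.obj t ⟶ R.carrier}, mem k c → mem k d → T.Rel R.rel c d
  of_rel : ∀ {t : S} {k : t ⟶ s} {c d : T.K.obj t ⟶ R.carrier}, mem k c → T.Rel R.rel c d →
    mem k d
  exists_mem : ∃ (t : S) (e : t ⟶ s) (c : T.K.obj t ⟶ R.carrier), J.Cov e ∧ mem e c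

variable {T}

namespace Elt

/-- A single name on a single cover determines the whole class: after pulling the cover back, any
other name is related to a restriction of this one, and `of_rel` and `of_cov` transport it to β. -/
theorem le_of_mem {α β : T.Elt R s} {e : t ⟶ s} (he : J.Cov e) {c : T.K.obj t ⟶ R.carrier}
    (hα : α.mem e c) (hβ : β.mem e c) {r : S} {k : r ⟶ s} {d : T.K.obj r ⟶ R.carrier}
    (hd : α.mem k d) : β.mem k d := by
  obtain ⟨p, a, b, hb, hab⟩ := J.exists_pullback he k
  have h₁ := α.res a hα
  have h₂ := α.res b hd
  have h₃ := β.res a hβ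
  rw [← hab] at h₂
  refine β.of_cov hb ?_
  rw [← hab]
  exact β.of_rel h₃ (α.rel h₁ h₂)

@[ext]
theorem ext {α β : T.Elt R s} (h : ∀ {t : S} (k : t ⟶ s) (c : T.K.obj t ⟶ R.carrier),
    α.mem k c ↔ β.mem k c) : α = β := by
  obtain ⟨m⟩ := α
  obtain ⟨m'⟩ := β
  obtain rfl : @m = @m' := by
    funext t k c
    exact propext (h k c)
  rfl

theorem eq_of_mem {α β : T.Elt R s} {e : t ⟶ s} (he : J.Cov e) {c : T.K.obj t ⟶ R.carrier}
    (hα : α.mem e c) (hβ : β.mem e c) : α = β :=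
  Elt.ext fun _ _ => ⟨le_of_mem he hα hβ, le_of_mem he hβ hα⟩

theorem eq_of_mem_id {α β : T.Elt R s} {c : T.K.obj s ⟶ R.carrier}
    (hα : α.mem (𝟙 s) c) (hβ : β.mem (𝟙 s) c) : α = β :=
  eq_of_mem (J.id s) hα hβ

/-- Restriction of generalised elements. -/
def restrict (k : t ⟶ s) (α : T.Elt R s) : T.Elt R t where
  mem l c := α.mem (l ≫ k) c
  res l _ _ h := by
    have := α.res l h
    rwa [← Category.assoc] at this
  of_cov he _ _ h := α.of_cov he (by rwa [← Category.assoc])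
  rel h h' := α.rel h h'
  of_rel h h' := α.of_rel h h'
  exists_mem := by
    obtain ⟨p, e, c, he, hc⟩ := α.exists_mem
    obtain ⟨q, a, b, hb, hab⟩ := J.exists_pullback he k
    exact ⟨q, b, T.K.map a ≫ c, hb, hab ▸ α.res a hc⟩

/-- The generalised element given by an element of the carrier. -/
def mk' (c : T.K.obj s ⟶ R.carrier) (h : T.Rel R.rel c c) : T.Elt R s where
  mem k d := T.Rel R.rel (T.K.map k ≫ c) d
  res l _ _ hd := by
    have := hd.res l
    rwa [← Category.assoc, ← T.K.map_comp] at this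
  of_cov he _ _ hd := Rel.of_cov he (by rwa [← Category.assoc, ← T.K.map_comp])
  rel hd hd' := hd.symm.trans hd'
  of_rel hd hd' := hd.trans hd'
  exists_mem := ⟨s, 𝟙 s, c, J.id s, by rwa [T.K.map_id, Category.id_comp]⟩

theorem mem_mk'_id {c d : T.K.obj s ⟶ R.carrier} {h : T.Rel R.rel c c} :
    (mk' c h).mem (𝟙 s) d ↔ T.Rel R.rel c d := by
  change T.Rel R.rel (T.K.map (𝟙 s) ≫ c) d ↔ _
  rw [T.K.map_id, Category.id_comp]

/-- The action of morphisms of `PER(X)` on generalised elements. -/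
def map (f : R ⟶ R') (α : T.Elt R s) : T.Elt R' s where
  mem {t} k d := ∃ (r : S) (e : r ⟶ t) (c : T.K.obj r ⟶ R.carrier),
    J.Cov e ∧ α.mem (e ≫ k) c ∧ T.HomRel f c (T.K.map e ≫ d)
  res {t' t} l k d := by
    rintro ⟨r, e, c, he, hc, hd⟩
    obtain ⟨p, a, b, hb, hab⟩ := J.exists_pullback he l
    refine ⟨p, b, T.K.map a ≫ c, hb, ?_, ?_⟩
    · rw [← Category.assoc, ← hab, Category.assoc]
      exact α.res a hc
    · rw [← Category.assoc, ← T.K.map_comp, ← hab, T.K.map_comp, Category.assoc]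
      exact hd.res a
  of_cov {t' t} e' he' k d := by
    rintro ⟨r, e, c, he, hc, hd⟩
    exact ⟨r, e ≫ e', c, J.comp he he', by rwa [Category.assoc],
      by rwa [T.K.map_comp, Category.assoc]⟩
  rel {t k d d'} := by
    rintro ⟨r, e, c, he, hc, hd⟩ ⟨r', e', c', he', hc', hd'⟩
    obtain ⟨p, a, b, hb, hab⟩ := J.exists_pullback he e'
    have h₁ := α.res a hc
    have h₂ := α.res b hc'
    rw [← Category.assoc, hab, Category.assoc] at h₁
    have h₃ := hd.res a
    have h₄ := hd'.res b
    rw [← Category.assoc, ← T.K.map_comp, hab] at h₃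
    rw [← Category.assoc, ← T.K.map_comp] at h₄
    refine Rel.of_cov (J.comp hb he') (h₃.singval (h₄.cong (α.rel h₂ h₁) h₄.right))
  of_rel {t k d d'} := by
    rintro ⟨r, e, c, he, hc, hd⟩ h
    exact ⟨r, e, c, he, hc, hd.cong hd.left (h.res e)⟩
  exists_mem := by
    obtain ⟨t, e, c, he, hc⟩ := α.exists_mem
    obtain ⟨r, e', d, he', hd⟩ := HomRel.exists_of_rel f (α.rel hc hc)
    refine ⟨r, e' ≫ e, d, J.comp he' he, r, 𝟙 r, T.K.map e' ≫ c, J.id r, ?_, ?_⟩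
    · rw [Category.id_comp]
      exact α.res e' hc
    · rwa [T.K.map_id, Category.id_comp]

theorem map_mem {f : R ⟶ R'} {α : T.Elt R s} {k : t ⟶ s} {c : T.K.obj t ⟶ R.carrier}
    {d : T.K.obj t ⟶ R'.carrier} (hc : α.mem k c) (hd : T.HomRel f c d) : (map f α).mem k d :=
  ⟨t, 𝟙 t, c, J.id t, by rwa [Category.id_comp], by rwa [T.K.map_id, Category.id_comp]⟩

theorem homRel_of_map_mem {f : R ⟶ R'} {α : T.Elt R s} {k : t ⟶ s}
    {c : T.K.obj t ⟶ R.carrier} {d : T.K.obj t ⟶ R'.carrier} (hc : α.mem k c)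
    (hd : (map f α).mem k d) : T.HomRel f c d := by
  obtain ⟨r, e, c', he, hc', h⟩ := hd
  exact HomRel.of_cov he (h.cong (α.rel hc' (α.res e hc)) h.right)

end Elt

variable (T)

/-- The embedding of `PER(X)` into the category of presheaves on the stages. -/
def toPsh : X.PER ⥤ Psh S where
  obj R :=
    { obj := T.Elt R
      res := Elt.restrict
      res_id := fun α => Elt.ext fun k c => by
        change α.mem (k ≫ 𝟙 _) c ↔ _
        rw [Category.comp_id]
      res_res := fun l k α => Elt.ext fun m c => by
        change α.mem ((m ≫ l) ≫ k) c ↔ α.mem (m ≫ l ≫ k) c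
        rw [Category.assoc] }
  map f :=
    { app := Elt.map f
      app_res := fun k α => Elt.ext fun l c => exists_congr fun r => exists_congr fun e =>
        exists_congr fun c => and_congr_right fun he => by
          change α.mem ((e ≫ l) ≫ k) c ∧ _ ↔ α.mem (e ≫ l ≫ k) c ∧ _
          rw [Category.assoc] }
  map_id R := Psh.hom_ext fun s α => by
    obtain ⟨t, e, c, he, hc⟩ := α.exists_mem
    exact Elt.eq_of_mem he (Elt.map_mem hc (homRel_id.2 (α.rel hc hc))) hc
  map_comp f g := Psh.hom_ext fun s α => by
    obtain ⟨t, e, c, he, hc⟩ := α.exists_mem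
    obtain ⟨t', e', d, he', hd⟩ := HomRel.exists_of_rel f (α.rel hc hc)
    obtain ⟨t'', e'', d', he'', hd'⟩ := HomRel.exists_of_rel g hd.right
    have h₁ := α.res e'' (α.res e' hc)
    have h₂ := hd.res e''
    refine Elt.eq_of_mem (J.comp he'' (J.comp he' he))
      (Elt.map_mem h₁ (homRel_comp.2 ⟨_, 𝟙 _, T.K.map e'' ≫ d, J.id _, ?_, ?_⟩))
      (Elt.map_mem (Elt.map_mem h₁ h₂) hd')
    · rwa [T.K.map_id, Category.id_comp]
    · rwa [T.K.map_id, Category.id_comp]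

theorem toPsh_isSheaf (R : X.PER) : (T.toPsh.obj R).IsSheaf J where
  sep {t s e} he α β h := by
    obtain ⟨r, e', c, he', hc⟩ := (Elt.restrict e α).exists_mem
    refine Elt.eq_of_mem (J.comp he' he) hc ?_
    have h : Elt.restrict e α = Elt.restrict e β := h
    rw [h] at hc
    exact hc
  glue {t s e} he (α : T.Elt R t) hα := by
    -- Compatibility of α with e: whether c is a member along a depends only on the composite of a
    -- with e. This makes the class β below single-valued up to the relation of R.
    have key : ∀ {r : S} (a b : r ⟶ t) {c : T.K.obj r ⟶ R.carrier}, a ≫ e = b ≫ e →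
        α.mem a c → α.mem b c := by
      intro r a b c hab h
      have : Elt.restrict a α = Elt.restrict b α := hα a b hab
      have h' : (Elt.restrict a α).mem (𝟙 _) c := by
        change α.mem (𝟙 _ ≫ a) c
        rwa [Category.id_comp]
      rw [this] at h'
      change α.mem (𝟙 _ ≫ b) c at h'
      rwa [Category.id_comp] at h'
    let β : T.Elt R s :=
      { mem := fun {q} k c => ∃ (r : S) (e' : r ⟶ q) (l : r ⟶ t), J.Cov e' ∧ l ≫ e = e' ≫ k ∧
          α.mem l (T.K.map e' ≫ c)
        res := by
          rintro q' q m k c ⟨r, e', l, he', hl, hc⟩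
          obtain ⟨p, a, b, hb, hab⟩ := J.exists_pullback he' m
          refine ⟨p, b, a ≫ l, hb, ?_, ?_⟩
          · rw [Category.assoc, hl, reassoc_of% hab]
          · rw [← Category.assoc, ← T.K.map_comp, ← hab, T.K.map_comp, Category.assoc]
            exact α.res a hc
        of_cov := by
          rintro q' q m hm k c ⟨r, e', l, he', hl, hc⟩
          exact ⟨r, e' ≫ m, l, J.comp he' hm, by rw [hl, Category.assoc],
            by rwa [T.K.map_comp, Category.assoc]⟩
        rel := by
          rintro q k c d ⟨r, e', l, he', hl, hc⟩ ⟨r', e'', l', he'', hl', hd⟩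
          obtain ⟨p, a, b, hb, hab⟩ := J.exists_pullback he' e''
          have h₁ := α.res a hc
          have h₂ := α.res b hd
          have h₃ := key _ (b ≫ l') (by
            rw [Category.assoc, Category.assoc, hl, hl', reassoc_of% hab]) h₁
          refine Rel.of_cov (J.comp hb he'') ?_
          rw [← Category.assoc, ← T.K.map_comp, hab] at h₃
          rw [← Category.assoc, ← T.K.map_comp] at h₂
          exact α.rel h₃ h₂
        of_rel := by
          rintro q k c d ⟨r, e', l, he', hl, hc⟩ h
          exact ⟨r, e', l, he', hl, α.of_rel hc (h.res e')⟩
        exists_mem := by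
          obtain ⟨r, e', c, he', hc⟩ := α.exists_mem
          refine ⟨r, e' ≫ e, c, J.comp he' he, r, 𝟙 r, e', J.id r, ?_, ?_⟩
          · rw [Category.id_comp]
          · rwa [T.K.map_id, Category.id_comp] }
    refine ⟨β, ?_⟩
    obtain ⟨r, e', c, he', hc⟩ := α.exists_mem
    refine Elt.eq_of_mem he' (c := c) ?_ hc
    refine ⟨r, 𝟙 r, e', J.id r, ?_, ?_⟩
    · rw [Category.id_comp]
    · rwa [T.K.map_id, Category.id_comp]

/-- A presentation of the presheaf `F` by a predicate of `X`: the relation `N c y` says that the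
element `c` of `I` is a name of `y`, and `κ c d` says that `c` and `d` are names of the same
element. -/
structure IsPresentation (F : Psh.{w'} S) (I : C)
    (N : ∀ {s : S}, (T.K.obj s ⟶ I) → F.obj s → Prop) (κ : X.Pred (I ⨯ I)) : Prop where
  res : ∀ {t s : S} (k : t ⟶ s) {c : T.K.obj s ⟶ I} {y : F.obj s}, N c y →
    N (T.K.map k ≫ c) (F.res k y)
  eq : ∀ {s : S} {c : T.K.obj s ⟶ I} {y y' : F.obj s}, N c y → N c y' → y = y'
  exists_name : ∀ {s : S} (y : F.obj s), ∃ (t : S) (e : t ⟶ s) (c : T.K.obj t ⟶ I),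
    J.Cov e ∧ N c (F.res e y)
  rel_iff : ∀ {s : S} {c d : T.K.obj s ⟶ I}, T.Rel κ c d ↔ ∃ y, N c y ∧ N d y

variable {T}

/-- Naming is local because c names some element iff κ(c, c) is forced, and forcing is local. The
sheaf condition then identifies the element named. -/
theorem IsPresentation.of_cov {F : Psh.{w'} S} {I : C}
    {N : ∀ {s : S}, (T.K.obj s ⟶ I) → F.obj s → Prop} {κ : X.Pred (I ⨯ I)}
    (h : T.IsPresentation F I N κ) (hF : F.IsSheaf J) {e : t ⟶ s} (he : J.Cov e)
    {c : T.K.obj s ⟶ I} {y : F.obj s} (hy : N (T.K.map e ≫ c) (F.res e y)) : N c y := by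
  obtain ⟨y', hy', -⟩ := h.rel_iff.1 (Rel.of_cov he (h.rel_iff.2 ⟨_, hy, hy⟩))
  obtain rfl : y = y' := hF.sep he (h.eq hy (h.res e hy'))
  exact hy'

variable (T) in
theorem isPresentation_toPsh (R : X.PER) :
    T.IsPresentation (T.toPsh.obj R) R.carrier (fun {s} c α => α.mem (𝟙 s) c) R.rel where
  res {t s} k {c} {α} h := by
    change α.mem (𝟙 _ ≫ k) _
    have := α.res k h
    rw [Category.id_comp]
    rwa [Category.comp_id] at this
  eq h h' := Elt.eq_of_mem_id h h'
  exists_name {s} α := by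
    obtain ⟨t, e, c, he, hc⟩ := α.exists_mem
    refine ⟨t, e, c, he, ?_⟩
    change α.mem (𝟙 _ ≫ e) _
    rwa [Category.id_comp]
  rel_iff {s c d} :=
    ⟨fun h => ⟨Elt.mk' c (h.trans h.symm), Elt.mem_mk'_id.2 (h.trans h.symm),
      Elt.mem_mk'_id.2 h⟩, fun ⟨α, h, h'⟩ => α.rel h h'⟩

/-- The graph of a map between presented sheaves is a predicate of `X`. -/
theorem IsPresentation.exists_graph {F G : Psh.{w'} S} {I I' : C}
    {N : ∀ {s : S}, (T.K.obj s ⟶ I) → F.obj s → Prop} {κ : X.Pred (I ⨯ I)}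
    {N' : ∀ {s : S}, (T.K.obj s ⟶ I') → G.obj s → Prop} {κ' : X.Pred (I' ⨯ I')}
    (h : T.IsPresentation F I N κ) (h' : T.IsPresentation G I' N' κ') (hG : G.IsSheaf J)
    (η : F ⟶ G) : ∃ γ : X.Pred (I ⨯ I'),
      ∀ {s : S} {c : T.K.obj s ⟶ I} {d : T.K.obj s ⟶ I'},
        T.Rel γ c d ↔ ∃ y, N c y ∧ N' d (η.app y) := by
  -- The predicate κ(c, c) is the image of a stage s, whose map a names a generic element y of F. On
  -- a cover t of s, the element η(y) also gets a name b. The graph is then "for some r in t, c is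
  -- κ-related to the name of y at r and d is κ'-related to b at r".
  obtain ⟨s, a, ha⟩ := T.exists_isEx (at₂ κ (𝟙 I) (𝟙 I))
  have hs := (ha _).1 le_rfl
  obtain ⟨y, hy, -⟩ := h.rel_iff.1 (forces_at₂.1 hs)
  rw [Category.comp_id] at hy
  obtain ⟨t, e, b, he, hb⟩ := h'.exists_name (η.app y)
  rw [← η.app_res] at hb
  let P := (I ⨯ I') ⨯ T.K.obj t
  let p : X.Pred P := meet (at₂ κ (prod.fst ≫ prod.fst) (prod.snd ≫ T.K.map e ≫ a))
    (meet (at₂ κ' (prod.fst ≫ prod.snd) (prod.snd ≫ b)) (X.reindex prod.snd (T.pred t)))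
  refine ⟨ex prod.fst p, fun {q c d} => ?_⟩
  refine Iff.trans forces_ex ?_
  have key : ∀ {r : S} (m : T.K.obj r ⟶ P), T.Forces p m ↔
      T.Rel κ (m ≫ prod.fst ≫ prod.fst) (m ≫ prod.snd ≫ T.K.map e ≫ a) ∧
      T.Rel κ' (m ≫ prod.fst ≫ prod.snd) (m ≫ prod.snd ≫ b) ∧
      T.pred r ≤ X.reindex (m ≫ prod.snd) (T.pred t) := by
    intro r m
    simp only [p, forces_meet, forces_at₂, forces_reindex]
    rfl
  constructor
  · rintro ⟨r, e', m, he', hm, hmp⟩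
    have h₁ : m ≫ prod.fst ≫ prod.fst = T.K.map e' ≫ c := by simpa using hm =≫ prod.fst
    have h₂ : m ≫ prod.fst ≫ prod.snd = T.K.map e' ≫ d := by simpa using hm =≫ prod.snd
    obtain ⟨h₃, h₄, h₅⟩ := (key m).1 hmp
    -- The witness in the base satisfies the predicate of t, so it is a map of stages and y can be
    -- restricted along it.
    obtain ⟨l, hl⟩ := T.exists_map _ h₅
    rw [h₁, ← Category.assoc, ← hl, h.rel_iff] at h₃
    rw [h₂, ← Category.assoc, ← hl, h'.rel_iff] at h₄
    obtain ⟨x, hx, hx'⟩ := h₃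
    obtain ⟨z, hz, hz'⟩ := h₄
    obtain rfl : x = F.res l (F.res e y) := h.eq hx' (h.res l (h.res e hy))
    obtain rfl : z = G.res l (η.app (F.res e y)) := h'.eq hz' (h'.res l hb)
    obtain ⟨x, hxc, -⟩ := h.rel_iff.1 (Rel.of_cov he' (h.rel_iff.2 ⟨_, hx, hx⟩))
    refine ⟨x, hxc, h'.of_cov hG he' ?_⟩
    rw [← η.app_res, h.eq (h.res e' hxc) hx, η.app_res]
    exact hz
  · rintro ⟨x, hx, hx'⟩
    have h₁ : T.Forces (at₂ κ (𝟙 I) (𝟙 I)) c := forces_at₂.2 (by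
      rw [Category.comp_id]
      exact h.rel_iff.2 ⟨x, hx, hx⟩)
    obtain ⟨r, e', l, he', hl⟩ := (IsEx.forces_iff ha).1 h₁
    obtain ⟨r', a', b', hb', hab⟩ := J.exists_pullback he l
    have hl' : T.K.map a' ≫ T.K.map e ≫ a = T.K.map (b' ≫ e') ≫ c := by
      rw [T.K.map_comp, Category.assoc, ← hl, ← Category.assoc, ← T.K.map_comp, hab, T.K.map_comp,
        Category.assoc]
    have hxy : F.res (b' ≫ e') x = F.res a' (F.res e y) :=
      h.eq (h.res (b' ≫ e') hx) (hl' ▸ h.res a' (h.res e hy))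
    refine ⟨r', b' ≫ e', prod.lift (T.K.map (b' ≫ e') ≫ prod.lift c d) (T.K.map a'),
      J.comp hb' he', by simp, (key _).2 ⟨?_, ?_, ?_⟩⟩
    · rw [lift_fst_comp, lift_snd_comp, Category.assoc, lift_fst, hl', h.rel_iff]
      exact ⟨_, h.res _ hx, h.res _ hx⟩
    · rw [lift_fst_comp, lift_snd_comp, Category.assoc, lift_snd, h'.rel_iff]
      refine ⟨_, h'.res _ hx', ?_⟩
      rw [← η.app_res, hxy, η.app_res]
      exact h'.res _ hb
    · rw [lift_snd]
      exact T.pred_le a'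

/-- The relation of f is recovered by applying f to the elements `Elt.mk' c`. -/
instance : T.toPsh.Faithful where
  map_injective {R R'} f g hfg := by
    have key : ∀ {f g : R ⟶ R'}, T.toPsh.map f = T.toPsh.map g → ∀ {s : S}
        {c : T.K.obj s ⟶ R.carrier} {d : T.K.obj s ⟶ R'.carrier},
          T.HomRel f c d → T.HomRel g c d := by
      intro f g hfg s c d h
      have hc := Elt.mem_mk'_id (h := h.left).2 h.left
      have h₁ := Elt.map_mem hc h
      have h₂ : Elt.map f _ = Elt.map g _ := Psh.congr_app hfg (Elt.mk' c h.left)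
      rw [h₂] at h₁
      exact Elt.homRel_of_map_mem hc h₁
    exact T.hom_ext ⟨key hfg, key hfg.symm⟩

/-- The graph of η is a functional relation, and the morphism it defines agrees with η on names,
hence on all elements by separatedness. -/
instance : T.toPsh.Full where
  map_surjective {R R'} η := by
    obtain ⟨γ, hγ⟩ := (T.isPresentation_toPsh R).exists_graph (T.isPresentation_toPsh R')
      (T.toPsh_isSheaf R') η
    have H : IsFunctionalRel R R' γ := by
      refine T.isFunctionalRel_of_rel ?_ ?_ ?_ ?_
      · intro s c d h
        obtain ⟨y, hy, hy'⟩ := hγ.1 h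
        exact ⟨y.rel hy hy, (η.app y).rel hy' hy'⟩
      · intro s c c' d d' h hc hd
        obtain ⟨y, hy, hy'⟩ := hγ.1 h
        exact hγ.2 ⟨y, y.of_rel hy hc, (η.app y).of_rel hy' hd⟩
      · intro s c d d' h h'
        obtain ⟨y, hy, hy'⟩ := hγ.1 h
        obtain ⟨z, hz, hz'⟩ := hγ.1 h'
        obtain rfl : y = z := Elt.eq_of_mem_id hy hz
        exact (η.app y).rel hy' hz'
      · intro s c h
        have hc := Elt.mem_mk'_id (h := h).2 h
        obtain ⟨t, e, d, he, hd⟩ := (T.isPresentation_toPsh R').exists_name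
          (η.app (Elt.mk' c h : T.Elt R s))
        refine ⟨t, e, d, he, hγ.2 ⟨_, (T.isPresentation_toPsh R).res e hc, ?_⟩⟩
        exact (Psh.app_res η e (show (T.toPsh.obj R).obj s from Elt.mk' c h)).symm ▸ hd
    let f : R ⟶ R' := toAntisymmetrization _ ⟨γ, H⟩
    refine ⟨f, Psh.hom_ext fun s α => ?_⟩
    obtain ⟨t, e, c, he, hc⟩ := (T.isPresentation_toPsh R).exists_name α
    obtain ⟨r, e', d, he', hd⟩ := (T.isPresentation_toPsh R').exists_name
      (η.app ((T.toPsh.obj R).res e α))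
    have h₁ := (T.isPresentation_toPsh R).res e' hc
    have e₁ := Psh.app_res η e' ((T.toPsh.obj R).res e α)
    rw [← e₁] at hd
    have h₂ := Elt.map_mem (f := f) h₁ ((homRel_mk H).2 (hγ.2 ⟨_, h₁, hd⟩))
    refine (T.toPsh_isSheaf R').sep (J.comp he' he)
      ((Psh.app_res_res (T.toPsh.map f) e' e α).symm.trans (Eq.trans ?_ (Psh.app_res_res η e' e α)))
    exact Elt.eq_of_mem_id h₂ hd

/-- The partial equivalence relation given by a presentation. -/
def IsPresentation.per {F : Psh.{w'} S} {I : C}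
    {N : ∀ {s : S}, (T.K.obj s ⟶ I) → F.obj s → Prop} {κ : X.Pred (I ⨯ I)}
    (h : T.IsPresentation F I N κ) : X.PER where
  carrier := I
  rel := κ
  symm a b := T.le_of_forces fun c hc => by
    rw [forces_at₂, h.rel_iff] at hc ⊢
    obtain ⟨y, hy, hy'⟩ := hc
    exact ⟨y, hy', hy⟩
  trans a b c := T.le_of_forces fun d hd => by
    rw [forces_meet, forces_at₂, forces_at₂, h.rel_iff, h.rel_iff] at hd
    rw [forces_at₂, h.rel_iff]
    obtain ⟨⟨y, hy, hy'⟩, ⟨z, hz, hz'⟩⟩ := hd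
    obtain rfl := h.eq hy' hz
    exact ⟨y, hy, hz'⟩

/-- A presented sheaf lies in the image of `PER(X)`. -/
theorem IsPresentation.nonempty_iso {F : Psh.{max v v₁ u₁} S} {I : C}
    {N : ∀ {s : S}, (T.K.obj s ⟶ I) → F.obj s → Prop} {κ : X.Pred (I ⨯ I)}
    (h : T.IsPresentation F I N κ) (hF : F.IsSheaf J) :
    Nonempty (F ≅ T.toPsh.obj h.per) := by
  refine Psh.exists_iso (G := T.toPsh.obj h.per) ⟨fun {s} y =>
    { mem := fun k c => N c (F.res k y)
      res := fun {_ _} l {k c} hc => by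
        rw [← F.res_res]
        exact h.res l hc
      of_cov := fun {_ _ _} he {k c} hc => h.of_cov hF he (by rwa [F.res_res])
      rel := fun hc hd => h.rel_iff.2 ⟨_, hc, hd⟩
      of_rel := fun {t k c d} hc hd => by
        obtain ⟨z, hz, hz'⟩ := h.rel_iff.1 hd
        rwa [h.eq hc hz]
      exists_mem := h.exists_name y }, fun k x => Elt.ext fun l c => ?_⟩ fun s => ⟨?_, ?_⟩
  · change N c _ ↔ N c _
    rw [F.res_res]
  · intro y z hyz
    obtain ⟨t, e, c, he, hc⟩ := h.exists_name y
    refine hF.sep he (h.eq hc ?_)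
    have := congrArg (fun α : T.Elt h.per s => α.mem e c) hyz
    exact this.mp hc
  · intro (α : T.Elt h.per s)
    -- Surjectivity: the elements of F named by the members of the class α form a matching family,
    -- since related names name the same element.
    obtain ⟨y, hy⟩ := hF.exists_amalgamation (fun {t} k x => ∃ c, α.mem k c ∧ N c x)
      (by
        rintro r t l k x ⟨c, hc, hx⟩
        exact ⟨_, α.res l hc, h.res l hx⟩)
      (by
        rintro t k x x' ⟨c, hc, hx⟩ ⟨c', hc', hx'⟩
        obtain ⟨z, hz, hz'⟩ := h.rel_iff.1 (α.rel hc hc')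
        rw [h.eq hx hz, h.eq hx' hz'])
      (by
        obtain ⟨t, e, c, he, hc⟩ := α.exists_mem
        obtain ⟨x, hx, -⟩ := h.rel_iff.1 (α.rel hc hc)
        exact ⟨t, e, x, he, c, hc, hx⟩)
    refine ⟨y, ?_⟩
    obtain ⟨t, e, c, he, hc⟩ := α.exists_mem
    obtain ⟨x, hx, -⟩ := h.rel_iff.1 (α.rel hc hc)
    refine Elt.eq_of_mem he (c := c) ?_ hc
    change N c (F.res e y)
    rwa [hy e x ⟨c, hc, hx⟩]

end Stages

end

end FiberedPreorder

/-! ### Both categories of relations as categories of presented sheaves on |A| -/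

theorem CategoryTheory.ObjectProperty.nonempty_equivalence {C D : Type*} [Category* C]
    [Category* D] (F : C ⥤ D) [F.Full] [F.Faithful] (P : ObjectProperty D)
    (h : ∀ X, P (F.obj X)) (h' : ∀ Y, P Y → ∃ X, Nonempty (Y ≅ F.obj X)) :
    Nonempty (C ≌ P.FullSubcategory) := by
  have : (P.lift F h).EssSurj := ⟨fun Y => by
    obtain ⟨X, ⟨i⟩⟩ := h' Y.obj Y.property
    exact ⟨X, ⟨P.isoMk i.symm⟩⟩⟩
  have : (P.lift F h).IsEquivalence := {}
  exact ⟨(P.lift F h).asEquivalence⟩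

namespace FiberedPreorder

section

variable {E : Type u} [Category.{v} E] [Regular E] (A : FiberedPreorder.{w} E) [A.HasFiniteMeets]

/-- The coverage on `|A|` by the cover-cartesian maps. -/
def coverage : SingletonCoverage A.Total where
  Cov _ _ e := Total.CoverCartesian e
  id := Total.CoverCartesian.id
  comp := Total.CoverCartesian.comp
  exists_pullback he g := he.exists_pullback g

variable {A}

/-- The span in the order of `D A` becomes a cover-cartesian map once its apex is given the
reindexed predicate of s. -/
theorem D.le_reindex_iff {s : A.Total} {I : E} (p : A.DPred I) (a : s.base ⟶ I) :
    (⟨s.base, 𝟙 s.base, s.pred⟩ : A.DPred s.base) ≤ DPred.reindex a p ↔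
      ∃ (t : A.Total) (e : t ⟶ s) (b : t.base ⟶ DPred.dom p), Total.CoverCartesian e ∧
        e.base ≫ a = b ≫ DPred.map p ∧ t.pred ≤ A.reindex b (DPred.pred p) := by
  rw [← DPred.adj]
  constructor
  · rintro ⟨L, e, f, he, h, hl⟩
    refine ⟨⟨L, A.reindex e s.pred⟩, ⟨e, le_rfl⟩, f, ⟨he, le_rfl⟩, ?_, hl⟩
    rw [← h]
    exact congrArg (e ≫ ·) (Category.id_comp a).symm
  · rintro ⟨t, e, b, he, h, hl⟩
    refine ⟨t.base, e.base, b, he.1, ?_, he.2.trans hl⟩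
    rw [← h]
    exact congrArg (e.base ≫ ·) (Category.id_comp a)

/-- This is the form in which the pre-stack condition enters the argument: inequalities in A descend
along covers. -/
theorem IsPrestack.le_of_coverCartesian (hA : A.IsPrestack) {s t : A.Total} {e : t ⟶ s}
    (he : Total.CoverCartesian e) {φ : A.Pred s.base} (h : t.pred ≤ A.reindex e.base φ) :
    s.pred ≤ φ :=
  hA e.base he.1 _ _ (he.2.trans h)

/-- The stages for `D A`. -/
noncomputable def IsPrestack.stages (hA : A.IsPrestack) : Stages A.D A.coverage where
  K := { obj := Total.base, map := Total.Hom.base }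
  pred s := ⟨s.base, 𝟙 s.base, s.pred⟩
  pred_le {t s} k := (D.le_reindex_iff _ _).2 ⟨t, 𝟙 t, k.base, Total.CoverCartesian.id t,
    (Category.id_comp _).trans (Category.comp_id _).symm, Total.Hom.le k⟩
  -- The order of `D A` compares the two predicates only after passing to a cover; by the pre-stack
  -- condition they are then comparable in A itself, which gives a map of |A|.
  exists_map {t s} c h := by
    obtain ⟨r, e, b, he, hb, hl⟩ := (D.le_reindex_iff _ _).1 h
    obtain rfl : e.base ≫ c = b := hb.trans (Category.comp_id b)
    exact ⟨⟨c, hA.le_of_coverCartesian he (hl.trans (A.reindex_comp_le _ _ _))⟩, rfl⟩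
  le_of_cov {t s e} he p h := by
    obtain ⟨r, e', b, he', hb, hl⟩ := (D.le_reindex_iff _ _).1 h
    have := he'.comp he
    exact ⟨r.base, e'.base ≫ e.base, b, this.1, (Category.comp_id _).trans hb, this.2.trans hl⟩
  exists_of_le_ex {s I' I} u p a h := by
    have h' := h.trans (A.D.reindex_mono a ((isEx_ex u p (DPred.ex u p)).2
      ((DPred.adj u p _).1 le_rfl)))
    obtain ⟨t, e, b, he, hb, hl⟩ := (D.le_reindex_iff _ _).1 h'
    refine ⟨t, e, b ≫ DPred.map p, he, (Category.assoc _ _ _).trans hb.symm, ?_⟩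
    exact (D.le_reindex_iff _ _).2 ⟨t, 𝟙 t, b, Total.CoverCartesian.id t, Category.id_comp _, hl⟩
  exists_isEx {I} p := ⟨⟨DPred.dom p, DPred.pred p⟩, DPred.map p, fun θ => by
    refine Iff.trans ?_ (DPred.adj (DPred.map p) ⟨DPred.dom p, 𝟙 _, DPred.pred p⟩ θ)
    have h₁ : p ≤ (⟨DPred.dom p, 𝟙 _, DPred.pred p⟩ : A.DPred (DPred.dom p)).ex (DPred.map p) :=
      DPred.le_of_hom (𝟙 _) ((Category.id_comp _).trans (Category.id_comp _)) (A.le_reindex_id _)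
    have h₂ : (⟨DPred.dom p, 𝟙 _, DPred.pred p⟩ : A.DPred (DPred.dom p)).ex (DPred.map p) ≤ p :=
      DPred.le_of_hom (𝟙 _) ((Category.id_comp _).trans (Category.id_comp _).symm)
        (A.le_reindex_id _)
    exact ⟨fun h => h₂.trans h, fun h => h₁.trans h⟩⟩

/-- The predicate `p(a)` of `D A` holds at the stage `s`. -/
def DPred.Forces {s : A.Total} {I : E} (p : A.DPred I) (a : s.base ⟶ I) : Prop :=
  ∃ (t : A.Total) (e : t ⟶ s) (b : t.base ⟶ p.dom), Total.CoverCartesian e ∧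
    e.base ≫ a = b ≫ p.map ∧ t.pred ≤ A.reindex b p.pred

/-- The predicate `ρ(a, b)` of `D A` holds at the stage `s`. -/
def DPred.Rel {s : A.Total} {I I' : E} (p : A.DPred (I ⨯ I')) (a : s.base ⟶ I)
    (b : s.base ⟶ I') : Prop :=
  p.Forces (prod.lift a b)

theorem IsPrestack.forces_iff (hA : A.IsPrestack) {s : A.Total} {I : E} {p : A.DPred I}
    {a : s.base ⟶ I} : hA.stages.Forces (p : A.D.Pred I) (a : hA.stages.K.obj s ⟶ I) ↔
      p.Forces a :=
  D.le_reindex_iff p a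

/-- A presentation of a presheaf on `|A|` by a predicate of `D A`. -/
structure DPresentation (F : Psh.{max u v w} A.Total) (I : E)
    (N : ∀ {s : A.Total}, (s.base ⟶ I) → F.obj s → Prop) (κ : A.DPred (I ⨯ I)) : Prop where
  res : ∀ {t s : A.Total} (k : t ⟶ s) {c : s.base ⟶ I} {y : F.obj s}, N c y →
    N (k.base ≫ c) (F.res k y)
  eq : ∀ {s : A.Total} {c : s.base ⟶ I} {y y' : F.obj s}, N c y → N c y' → y = y'
  exists_name : ∀ {s : A.Total} (y : F.obj s), ∃ (t : A.Total) (e : t ⟶ s) (c : t.base ⟶ I),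
    Total.CoverCartesian e ∧ N c (F.res e y)
  rel_iff : ∀ {s : A.Total} {c d : s.base ⟶ I}, κ.Rel c d ↔ ∃ y, N c y ∧ N d y

theorem IsPrestack.isPresentation_iff (hA : A.IsPrestack) {F : Psh.{max u v w} A.Total} {I : E}
    {N : ∀ {s : A.Total}, (s.base ⟶ I) → F.obj s → Prop} {κ : A.DPred (I ⨯ I)} :
    DPresentation F I N κ ↔ hA.stages.IsPresentation F I N κ :=
  ⟨fun h => ⟨h.res, h.eq, h.exists_name, fun {_ _ _} => hA.forces_iff.trans h.rel_iff⟩,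
    fun h => ⟨h.res, h.eq, h.exists_name, fun {_ _ _} => hA.forces_iff.symm.trans h.rel_iff⟩⟩

theorem siev.top_le_reindex_iff {s x : A.Total} (p : A.siev.Pred x) (a : s ⟶ x) :
    A.siev.top s ≤ A.siev.reindex a p ↔ ∃ (t : A.Total) (e : t ⟶ s) (b : t ⟶ SievPred.dom p),
      Total.CoverCartesian e ∧ e ≫ a = b ≫ SievPred.map p := by
  have h₁ : A.siev.top s ≤ (⟨s, 𝟙 s⟩ : SievPred s) :=
    SievPred.le_of_hom (SievPred.map _) (Category.comp_id _)
  have h₂ : (⟨s, 𝟙 s⟩ : SievPred s) ≤ A.siev.top s := le_top (X := A.siev) _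
  have h₃ := SievPred.adj a ⟨s, 𝟙 s⟩ p
  constructor
  · intro h
    obtain ⟨t, e, b, he, hb⟩ := h₃.2 (h₂.trans h)
    exact ⟨t, e, b, he, by rw [← hb]; exact congrArg (e ≫ ·) (Category.id_comp a).symm⟩
  · rintro ⟨t, e, b, he, hb⟩
    exact h₁.trans (h₃.1 ⟨t, e, b, he, by
      rw [← hb]; exact congrArg (e ≫ ·) (Category.id_comp a)⟩)

variable (A) in
/-- The stages for the fibration of sieves. -/
noncomputable def sievStages : Stages A.siev A.coverage where
  K := 𝟭 _
  pred s := A.siev.top s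
  pred_le k := HasFiniteMeets.reindex_top _ _ (fun φ => le_top φ) _
  exists_map c _ := ⟨c, rfl⟩
  le_of_cov {t s e} he p h := by
    obtain ⟨r, e', b, he', hb⟩ := (siev.top_le_reindex_iff p e).1 h
    have h₁ : A.siev.top s ≤ (⟨s, 𝟙 s⟩ : SievPred s) :=
      SievPred.le_of_hom (SievPred.map _) (Category.comp_id _)
    exact h₁.trans ⟨r, e' ≫ e, b, he'.comp he, (Category.comp_id _).trans hb⟩
  exists_of_le_ex {s I' I} u p a h := by
    have h' := h.trans (A.siev.reindex_mono a ((isEx_ex u p (SievPred.ex u p)).2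
      ((SievPred.adj u p _).1 le_rfl)))
    obtain ⟨t, e, b, he, hb⟩ := (siev.top_le_reindex_iff _ _).1 h'
    refine ⟨t, e, b ≫ SievPred.map p, he, (Category.assoc _ _ _).trans hb.symm, ?_⟩
    exact (siev.top_le_reindex_iff _ _).2
      ⟨t, 𝟙 t, b, Total.CoverCartesian.id t, Category.id_comp _⟩
  exists_isEx {I} p := ⟨SievPred.dom p, SievPred.map p, fun θ => by
    refine Iff.trans ?_ (siev.top_le_reindex_iff θ (SievPred.map p)).symm
    exact Iff.rfl⟩

theorem sievStages_forces_iff {s x : A.Total} {p : A.siev.Pred x} {a : s ⟶ x} :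
    A.sievStages.Forces p a ↔ ∃ (t : A.Total) (e : t ⟶ s) (b : t ⟶ SievPred.dom p),
      Total.CoverCartesian e ∧ e ≫ a = b ≫ SievPred.map p :=
  siev.top_le_reindex_iff p a

theorem sievStages_rel_iff {s x y : A.Total} {p : A.siev.Pred (x ⨯ y)} {c : s ⟶ x}
    {d : s ⟶ y} : A.sievStages.Rel p (c : A.sievStages.K.obj s ⟶ x) d ↔
      ∃ (t : A.Total) (e : t ⟶ s) (b : t ⟶ SievPred.dom p), Total.CoverCartesian e ∧
        e ≫ c = b ≫ SievPred.map p ≫ prod.fst ∧ e ≫ d = b ≫ SievPred.map p ≫ prod.snd := by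
  refine (sievStages_forces_iff (a := prod.lift c d)).trans ?_
  refine exists_congr fun t => exists_congr fun e => exists_congr fun b =>
    and_congr_right fun _ => ⟨fun h => ⟨?_, ?_⟩, fun h => ?_⟩
  · rw [← Category.assoc, ← h, Category.assoc, prod.lift_fst]
  · rw [← Category.assoc, ← h, Category.assoc, prod.lift_snd]
  · refine prod.hom_ext ?_ ?_
    · rw [Category.assoc, Category.assoc, ← h.1, prod.lift_fst]
    · rw [Category.assoc, Category.assoc, ← h.2, prod.lift_snd]

variable (A) in
/-- The sheaves on `|A|` that are presented by a predicate of `D A`. -/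
def IsPresented : ObjectProperty (Psh.{max u v w} A.Total) :=
  fun F => F.IsSheaf A.coverage ∧ ∃ (I : E) (N : ∀ {s : A.Total}, (s.base ⟶ I) → F.obj s → Prop)
    (κ : A.DPred (I ⨯ I)), DPresentation F I N κ

theorem IsPrestack.nonempty_sheafCat_equivalence (hA : A.IsPrestack) :
    Nonempty (A.D.SheafCat ≌ A.IsPresented.FullSubcategory) := by
  refine ObjectProperty.nonempty_equivalence hA.stages.toPsh _ (fun R => ?_) fun F hF => ?_
  · exact ⟨hA.stages.toPsh_isSheaf R, R.carrier, _, R.rel,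
      hA.isPresentation_iff.2 (hA.stages.isPresentation_toPsh R)⟩
  · obtain ⟨hF, I, N, κ, h⟩ := hF
    rw [hA.isPresentation_iff] at h
    exact ⟨h.per, h.nonempty_iso hF⟩

/-- The names become the maps s.base ⟶ x.base that underlie a map s ⟶ x. Such a lift is unique, and
its existence is a local condition by the pre-stack property, so the same relation, seen over the
base, is a presentation in `D A`. -/
theorem IsPrestack.isPresented_of_siev (hA : A.IsPrestack) {F : Psh.{max u v w} A.Total}
    (hF : F.IsSheaf A.coverage) {x : A.Total}
    {N : ∀ {s : A.Total}, (s ⟶ x) → F.obj s → Prop} {κ : A.siev.Pred (x ⨯ x)}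
    (h : A.sievStages.IsPresentation F x N κ) : A.IsPresented F := by
  let u : (x ⨯ x).base ⟶ x.base ⨯ x.base :=
    prod.lift (prod.fst : x ⨯ x ⟶ x).base (prod.snd : x ⨯ x ⟶ x).base
  refine ⟨hF, x.base, fun {s} c y => ∃ c' : s ⟶ x, c'.base = c ∧ N c' y,
    (⟨(SievPred.dom κ).base, (SievPred.map κ).base ≫ u, (SievPred.dom κ).pred⟩ : A.DPred _),
    ?_, ?_, ?_, ?_⟩
  · rintro t s k c y ⟨c, rfl, hc⟩
    exact ⟨k ≫ c, rfl, h.res k hc⟩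
  · rintro s c y y' ⟨c, rfl, hc⟩ ⟨c', hcc', hc'⟩
    obtain rfl := Total.hom_ext hcc'
    exact h.eq hc hc'
  · intro s y
    obtain ⟨t, e, c, he, hc⟩ := h.exists_name y
    exact ⟨t, e, Total.Hom.base c, he, c, rfl, hc⟩
  · intro s c d
    constructor
    · rintro ⟨t, e, b, he, hb, hl⟩
      let k : t ⟶ SievPred.dom κ := ⟨b, hl⟩
      have h₁ : e.base ≫ c = (k ≫ SievPred.map κ ≫ prod.fst).base := by
        have := hb =≫ prod.fst
        simp only [u, Category.assoc, lift_fst] at this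
        exact this
      have h₂ : e.base ≫ d = (k ≫ SievPred.map κ ≫ prod.snd).base := by
        have := hb =≫ prod.snd
        simp only [u, Category.assoc, lift_snd] at this
        exact this
      let c' : s ⟶ x := ⟨c, hA.le_of_coverCartesian he
        ((Total.Hom.le _).trans (h₁ ▸ A.reindex_comp_le _ _ _))⟩
      let d' : s ⟶ x := ⟨d, hA.le_of_coverCartesian he
        ((Total.Hom.le _).trans (h₂ ▸ A.reindex_comp_le _ _ _))⟩
      have h₃ : e ≫ c' = k ≫ SievPred.map κ ≫ prod.fst := Total.hom_ext h₁
      have h₄ : e ≫ d' = k ≫ SievPred.map κ ≫ prod.snd := Total.hom_ext h₂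
      have : A.sievStages.Rel κ (c' : A.sievStages.K.obj s ⟶ x) d' :=
        sievStages_rel_iff.2 ⟨t, e, k, he, h₃, h₄⟩
      obtain ⟨y, hy, hy'⟩ := h.rel_iff.1 this
      exact ⟨y, ⟨c', rfl, hy⟩, ⟨d', rfl, hy'⟩⟩
    · rintro ⟨y, ⟨c, rfl, hc⟩, ⟨d, rfl, hd⟩⟩
      obtain ⟨t, e, k, he, h₁, h₂⟩ := sievStages_rel_iff.1 (h.rel_iff.2 ⟨y, hc, hd⟩)
      refine ⟨t, e, k.base, he, ?_, Total.Hom.le k⟩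
      have h₁' := congrArg Total.Hom.base h₁
      have h₂' := congrArg Total.Hom.base h₂
      simp only [Total.comp_base] at h₁' h₂'
      ext
      · simpa [u] using h₁'
      · simpa [u] using h₂'

/-- The sieve is the pullback of p along u in E, with the predicate of x added as a conjunct so that
the projection is a map of |A|. -/
theorem exists_sievPred {x : A.Total} {I : E} (u : x.base ⟶ I)
    (p : A.DPred I) : ∃ q : A.siev.Pred x, ∀ {s : A.Total} (a : s ⟶ x),
      A.sievStages.Forces q (a : A.sievStages.K.obj s ⟶ x) ↔ p.Forces (a.base ≫ u) := by
  let q : SievPred x := ⟨⟨pullback (DPred.map p) u,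
    meet (A.reindex (pullback.fst (DPred.map p) u) (DPred.pred p))
      (A.reindex (pullback.snd (DPred.map p) u) x.pred)⟩,
    ⟨pullback.snd (DPred.map p) u, meet_le_right _ _⟩⟩
  refine ⟨q, fun {s} a => ?_⟩
  refine sievStages_forces_iff.trans ⟨?_, ?_⟩
  · rintro ⟨t, e, b, he, hb⟩
    have hb' : e.base ≫ a.base = b.base ≫ pullback.snd (DPred.map p) u :=
      congrArg Total.Hom.base hb
    refine ⟨t, e, b.base ≫ pullback.fst (DPred.map p) u, he, ?_, ?_⟩
    · rw [reassoc_of% hb', Category.assoc, pullback.condition]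
    · have := meet_le_left (X := A) (A.reindex (pullback.fst p.map u) p.pred)
        (A.reindex (pullback.snd p.map u) x.pred)
      exact (Total.Hom.le b).trans ((A.reindex_mono _ this).trans (A.le_reindex_comp _ _ _))
  · rintro ⟨t, e, b, he, hb, hl⟩
    refine ⟨t, e, ⟨pullback.lift b (e.base ≫ a.base) (by rw [← hb, Category.assoc]),
      le_reindex_meet _ ?_ ?_⟩, he, Total.hom_ext ?_⟩
    · exact hl.trans (reindex_le_of_eq (pullback.lift_fst _ _ _) _)
    · exact (Total.Hom.le (e ≫ a)).trans (reindex_le_of_eq (pullback.lift_snd _ _ _) _)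
    · exact (pullback.lift_snd _ _ _).symm

/-- Totality costs nothing over |A|: the extent p of a partial equivalence relation in `D A` is
itself an object x of |A|. Every name factors locally through x, and the relation pulled back to x
is reflexive. -/
theorem IsPrestack.nonempty_presheafCat_equivalence (hA : A.IsPrestack) :
    Nonempty (A.PresheafCat ≌ A.IsPresented.FullSubcategory) := by
  refine ObjectProperty.nonempty_equivalence
    (ObjectProperty.ι _ ⋙ A.sievStages.toPsh) _ (fun R => ?_) fun F hF => ?_
  · exact hA.isPresented_of_siev (F := A.sievStages.toPsh.obj R.obj) (x := R.obj.carrier)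
      (N := fun {s} c α => Stages.Elt.mem α (𝟙 s) c) (A.sievStages.toPsh_isSheaf R.obj)
      (A.sievStages.isPresentation_toPsh R.obj)
  · obtain ⟨hF, I, N, κ, h⟩ := hF
    let p : A.DPred I := at₂ (X := A.D) κ (𝟙 I) (𝟙 I)
    have hp : ∀ {s : A.Total} {c : s.base ⟶ I}, p.Forces c ↔ κ.Rel c c := by
      intro s c
      rw [← hA.forces_iff]
      refine Stages.forces_at₂.trans ?_
      have : prod.lift (c ≫ 𝟙 I) (c ≫ 𝟙 I) = prod.lift c c := by rw [Category.comp_id]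
      exact (iff_of_eq (congrArg (fun m : s.base ⟶ I ⨯ I =>
        hA.stages.Forces (κ : A.D.Pred (I ⨯ I)) m) this)).trans hA.forces_iff
    let x : A.Total := ⟨p.dom, p.pred⟩
    obtain ⟨κ', hκ'⟩ := exists_sievPred (x := x ⨯ x)
      (prod.lift ((prod.fst : x ⨯ x ⟶ x).base ≫ p.map) ((prod.snd : x ⨯ x ⟶ x).base ≫ p.map)) κ
    have hrel : ∀ {s : A.Total} {c d : s ⟶ x}, A.sievStages.Rel κ'
        (c : A.sievStages.K.obj s ⟶ x) d ↔ κ.Rel (c.base ≫ p.map) (d.base ≫ p.map) := by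
      intro s c d
      refine (hκ' (prod.lift c d)).trans ?_
      have h₁ := congrArg Total.Hom.base (prod.lift_fst c d)
      have h₂ := congrArg Total.Hom.base (prod.lift_snd c d)
      simp only [Total.comp_base] at h₁ h₂
      rw [prod.comp_lift, reassoc_of% h₁, reassoc_of% h₂]
      exact Iff.rfl
    have h' : A.sievStages.IsPresentation F x (fun {s} c y => N (Total.Hom.base c ≫ p.map) y)
        κ' := by
      refine ⟨?_, ?_, ?_, ?_⟩
      · intro t s k c y hy
        have : N (k.base ≫ Total.Hom.base c ≫ p.map) (F.res k y) := h.res k hy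
        rwa [← Category.assoc] at this
      · exact fun hy hy' => h.eq hy hy'
      · intro s y
        obtain ⟨t, e, c, he, hc⟩ := h.exists_name y
        -- A name c satisfies κ(c, c), so on a further cover it comes from a map into x.
        obtain ⟨t', e', b, he', hb, hl⟩  := hp.2 (h.rel_iff.2 ⟨_, hc, hc⟩)
        refine ⟨t', e' ≫ e, (⟨b, hl⟩ : t' ⟶ x), he'.comp he, ?_⟩
        have := h.res e' hc
        rw [F.res_res] at this
        exact hb ▸ this
      · exact hrel.trans h.rel_iff
    refine ⟨⟨h'.per, fun θ => A.sievStages.le_of_forces fun {s} a _ => ?_⟩, h'.nonempty_iso hF⟩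
    refine Stages.forces_at₂.2 (hrel.2 (hp.1 ?_))
    let b : s ⟶ x := a ≫ 𝟙 x
    exact ⟨s, 𝟙 s, b.base, Total.CoverCartesian.id s, Category.id_comp _, Total.Hom.le b⟩

end

end FiberedPreorder

/-! ### Pullbacks and exponentials of presheaves -/

section

universe w' v₁ u₁

namespace Psh

section

variable {S : Type u₁} [Category.{v₁} S] {J : SingletonCoverage S} {X Y Z : Psh.{w'} S}

/-- The pullback of presheaves. -/
def pb (f : Y ⟶ X) (g : Z ⟶ X) : Psh.{w'} S where
  obj s := {p : Y.obj s × Z.obj s // f.app p.1 = g.app p.2}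
  res k p := ⟨(Y.res k p.1.1, Z.res k p.1.2), by rw [app_res, app_res, p.2]⟩
  res_id p := Subtype.ext (Prod.ext (Y.res_id _) (Z.res_id _))
  res_res l k p := Subtype.ext (Prod.ext (Y.res_res _ _ _) (Z.res_res _ _ _))

/-- The first projection. -/
def pbFst (f : Y ⟶ X) (g : Z ⟶ X) : pb f g ⟶ Y := ⟨fun p => p.1.1, fun _ _ => rfl⟩

/-- The second projection. -/
def pbSnd (f : Y ⟶ X) (g : Z ⟶ X) : pb f g ⟶ Z := ⟨fun p => p.1.2, fun _ _ => rfl⟩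

theorem pb_condition (f : Y ⟶ X) (g : Z ⟶ X) : pbFst f g ≫ f = pbSnd f g ≫ g :=
  hom_ext fun _ p => p.2

/-- The universal map into the pullback. -/
def pbLift {f : Y ⟶ X} {g : Z ⟶ X} {T : Psh.{w'} S} (a : T ⟶ Y) (b : T ⟶ Z)
    (h : a ≫ f = b ≫ g) : T ⟶ pb f g :=
  ⟨fun x => ⟨(a.app x, b.app x), congr_app h x⟩,
    fun k x => Subtype.ext (Prod.ext (app_res a k x) (app_res b k x))⟩

theorem IsSheaf.pb (hX : X.IsSheaf J) (hY : Y.IsSheaf J) (hZ : Z.IsSheaf J) (f : Y ⟶ X)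
    (g : Z ⟶ X) : (pb f g).IsSheaf J where
  sep he _ _ h := Subtype.ext (Prod.ext (hY.sep he (congrArg (fun p => p.1.1) h))
    (hZ.sep he (congrArg (fun p => p.1.2) h)))
  glue {t s e} he p hp := by
    obtain ⟨y, hy⟩ := hY.glue he p.1.1 fun a b h => congrArg (fun p => p.1.1) (hp a b h)
    obtain ⟨z, hz⟩ := hZ.glue he p.1.2 fun a b h => congrArg (fun p => p.1.2) (hp a b h)
    exact ⟨⟨(y, z), hX.sep he (by rw [← app_res, ← app_res, hy, hz, p.2])⟩,
      Subtype.ext (Prod.ext hy hz)⟩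

/-- An element of the exponential of `f` and `g` over `X`. -/
structure ExpElt (f : Y ⟶ X) (g : Z ⟶ X) (s : S) where
  base : X.obj s
  toFun : ∀ {t : S} (k : t ⟶ s) (y : Y.obj t), f.app y = X.res k base → Z.obj t
  app_toFun : ∀ {t : S} (k : t ⟶ s) (y : Y.obj t) (h : f.app y = X.res k base),
    g.app (toFun k y h) = X.res k base
  res_toFun : ∀ {r t : S} (l : r ⟶ t) (k : t ⟶ s) (y : Y.obj t) (h : f.app y = X.res k base)
    (h' : f.app (Y.res l y) = X.res (l ≫ k) base),
    Z.res l (toFun k y h) = toFun (l ≫ k) (Y.res l y) h'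

namespace ExpElt

variable {f : Y ⟶ X} {g : Z ⟶ X} {s t : S}

theorem toFun_congr (α : ExpElt f g s) {k k' : t ⟶ s} (hk : k = k') {y y' : Y.obj t}
    (hy : y = y') (h : f.app y = X.res k α.base) (h' : f.app y' = X.res k' α.base) :
    α.toFun k y h = α.toFun k' y' h' := by
  subst hk
  subst hy
  rfl

theorem congr_toFun {α β : ExpElt f g s} (e : α = β) (k : t ⟶ s) (y : Y.obj t)
    (h : f.app y = X.res k α.base) (h' : f.app y = X.res k β.base) :
    α.toFun k y h = β.toFun k y h' := by
  subst e
  rfl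

theorem ext {α β : ExpElt f g s} (hb : α.base = β.base)
    (h : ∀ {t : S} (k : t ⟶ s) (y : Y.obj t) (h : f.app y = X.res k α.base)
      (h' : f.app y = X.res k β.base), α.toFun k y h = β.toFun k y h') : α = β := by
  obtain ⟨x, a, _, _⟩ := α
  obtain ⟨x', b, _, _⟩ := β
  obtain rfl : x = x' := hb
  obtain rfl : @a = @b := by
    funext t k y h'
    exact h k y h' h'
  rfl

end ExpElt

theorem app_res_eq {f : Y ⟶ X} {r t s : S} (l : r ⟶ t) {k : t ⟶ s} {y : Y.obj t} {x : X.obj s}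
    (h : f.app y = X.res k x) : f.app (Y.res l y) = X.res (l ≫ k) x := by
  rw [app_res, h, X.res_res]

/-- A fibrewise function may be given by a stable, single-valued relation that has values only
locally; the sheaf condition on Z supplies the actual values. This serves both for gluing and for
reading a function off a name. -/
theorem exists_expElt (hX : X.IsSheaf J) (hZ : Z.IsSheaf J) (f : Y ⟶ X) (g : Z ⟶ X) {s : S}
    (x : X.obj s) (R : ∀ {t : S}, (t ⟶ s) → Y.obj t → Z.obj t → Prop)
    (hres : ∀ {r t : S} (l : r ⟶ t) {k : t ⟶ s} {y : Y.obj t} {z : Z.obj t}, R k y z →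
      R (l ≫ k) (Y.res l y) (Z.res l z))
    (heq : ∀ {t : S} {k : t ⟶ s} {y : Y.obj t} {z z' : Z.obj t}, R k y z → R k y z' → z = z')
    (happ : ∀ {t : S} {k : t ⟶ s} {y : Y.obj t} {z : Z.obj t}, R k y z → g.app z = f.app y)
    (hex : ∀ {t : S} (k : t ⟶ s) (y : Y.obj t), f.app y = X.res k x → ∃ (r : S) (e : r ⟶ t)
      (z : Z.obj r), J.Cov e ∧ R (e ≫ k) (Y.res e y) z) :
    ∃ α : ExpElt f g s, α.base = x ∧ ∀ {t : S} (k : t ⟶ s) (y : Y.obj t) (z : Z.obj t)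
      (h : f.app y = X.res k α.base), R k y z → α.toFun k y h = z := by
  have key : ∀ {t : S} (k : t ⟶ s) (y : Y.obj t), f.app y = X.res k x → ∃ z : Z.obj t,
      ∀ {r : S} (l : r ⟶ t) (z' : Z.obj r), R (l ≫ k) (Y.res l y) z' → Z.res l z = z' := by
    intro t k y h
    refine hZ.exists_amalgamation (fun l z' => R (l ≫ k) (Y.res l y) z') ?_ heq (hex k y h)
    intro r t' l k' z' hz'
    have := hres l hz'
    rwa [Y.res_res, ← Category.assoc] at this
  choose a ha using @key
  refine ⟨⟨x, a, fun {t} k y h => ?_, fun {r t} l k y h h' => ?_⟩, rfl, ?_⟩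
  · obtain ⟨r, e, z, he, hz⟩ := hex k y h
    refine hX.sep he ?_
    rw [← app_res, ha k y h e z hz, happ hz, ← h, app_res]
  · obtain ⟨q, e, z, he, hz⟩ := hex _ _ h'
    refine hZ.sep he ?_
    rw [ha _ _ h' e z hz, Z.res_res, ha k y h (e ≫ l) z]
    rwa [Y.res_res, ← Category.assoc] at hz
  · intro t k y z h hz
    have := ha k y h (𝟙 t) z (by rwa [Category.id_comp, Y.res_id])
    rwa [Z.res_id] at this

end

section

variable {S : Type u₁} [Category.{v₁} S] {J : SingletonCoverage S}
  {X Y Z : Psh.{max w' u₁ v₁} S}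

/-- The exponential of `f` and `g` over `X`. -/
def exp (f : Y ⟶ X) (g : Z ⟶ X) : Psh.{max w' u₁ v₁} S where
  obj s := ExpElt f g s
  res l α :=
    { base := X.res l α.base
      toFun := fun k y h => α.toFun (k ≫ l) y (by rw [h, X.res_res])
      app_toFun := fun k y h => by rw [α.app_toFun, X.res_res]
      res_toFun := fun m k y h h' => by
        rw [α.res_toFun m (k ≫ l) y _ (app_res_eq m (by rw [h, X.res_res]))]
        exact α.toFun_congr (Category.assoc _ _ _).symm rfl _ _ }
  res_id α := ExpElt.ext (X.res_id _) fun k y h h' => α.toFun_congr (Category.comp_id k) rfl _ _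
  res_res m l α := ExpElt.ext (X.res_res _ _ _) fun k y h h' =>
    α.toFun_congr (Category.assoc _ _ _) rfl _ _

theorem IsSheaf.exp (hX : X.IsSheaf J) (hZ : Z.IsSheaf J) (f : Y ⟶ X) (g : Z ⟶ X) :
    (exp f g).IsSheaf J where
  sep {t s e} he (α : ExpElt f g s) (β : ExpElt f g s) h := by
    have hb : α.base = β.base := hX.sep he (congrArg ExpElt.base h)
    refine ExpElt.ext hb fun {r} k y hk hk' => ?_
    obtain ⟨p, a, b, hb, hab⟩ := J.exists_pullback he k
    refine hZ.sep hb ?_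
    have key : ∀ (γ : ExpElt f g s) (h : f.app y = X.res k γ.base)
        (h' : f.app (Y.res b y) = X.res a (X.res e γ.base)), Z.res b (γ.toFun k y h) =
          γ.toFun (a ≫ e) (Y.res b y) (by rw [h', X.res_res]) := fun γ h h' => by
      rw [γ.res_toFun b k y h (app_res_eq b h)]
      exact γ.toFun_congr hab.symm rfl _ _
    have key' : ∀ γ : ExpElt f g s, f.app y = X.res k γ.base →
        f.app (Y.res b y) = X.res a (X.res e γ.base) := fun γ h => by
      rw [app_res_eq b h, X.res_res, hab]
    rw [key α hk (key' α hk), key β hk' (key' β hk')]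
    exact ExpElt.congr_toFun h a (Y.res b y) (key' α hk) (key' β hk')
  glue {t s e} he (α : ExpElt f g t) hα := by
    obtain ⟨x, hx⟩ := hX.glue he α.base fun a b h => congrArg ExpElt.base (hα a b h)
    -- The glued function is prescribed by α at the maps k that factor through e; the matching
    -- condition makes this independent of the factorisation, and every k factors so on a cover.
    obtain ⟨β, rfl, hβ⟩ := exists_expElt hX hZ f g x
      (fun {r} k y z => ∃ (a : r ⟶ t) (h : f.app y = X.res a α.base), a ≫ e = k ∧
        α.toFun a y h = z)
      (by
        rintro r r' l k y z ⟨a, h, rfl, rfl⟩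
        exact ⟨l ≫ a, app_res_eq l h, Category.assoc _ _ _, (α.res_toFun l a y h _).symm⟩)
      (by
        rintro r k y z z' ⟨a, h, hk, rfl⟩ ⟨b, h', hk', rfl⟩
        have h₁ := hα a b (hk.trans hk'.symm)
        have := ExpElt.congr_toFun h₁ (𝟙 r) y (h.trans (X.res_id _).symm)
          (h'.trans (X.res_id _).symm)
        refine Eq.trans ?_ (this.trans ?_)
        · exact α.toFun_congr (Category.id_comp a).symm rfl _ _
        · exact α.toFun_congr (Category.id_comp b) rfl _ _)
      (by
        rintro r k y z ⟨a, h, hk, rfl⟩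
        rw [α.app_toFun, h])
      (by
        intro r k y h
        obtain ⟨p, a, b, hb, hab⟩ := J.exists_pullback he k
        have h' : f.app (Y.res b y) = X.res a α.base := by
          rw [app_res_eq b h, ← hx, X.res_res, hab]
        exact ⟨p, b, _, hb, a, h', hab, rfl⟩)
    refine ⟨β, ExpElt.ext hx fun {r} k y h h' => ?_⟩
    exact hβ (k ≫ e) y _ _ ⟨k, h', rfl, rfl⟩

/-- The structure map of the exponential. -/
def expBase (f : Y ⟶ X) (g : Z ⟶ X) : exp f g ⟶ X := ⟨ExpElt.base, fun _ _ => rfl⟩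

/-- The evaluation map. -/
def expEval (f : Y ⟶ X) (g : Z ⟶ X) : pb f (expBase f g) ⟶ Z where
  app {s} p := ExpElt.toFun p.1.2 (𝟙 s) p.1.1 (p.2.trans (X.res_id _).symm)
  app_res {t s} k p := by
    obtain ⟨⟨y, α⟩, h⟩ := p
    change ExpElt f g s at α
    change f.app y = α.base at h
    have h₁ : f.app y = X.res (𝟙 s) α.base := h.trans (X.res_id _).symm
    refine Eq.trans ?_ (α.res_toFun k (𝟙 s) y h₁ (app_res_eq k h₁)).symm
    exact α.toFun_congr (by rw [Category.id_comp, Category.comp_id]) rfl _ _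

theorem expEval_comp (f : Y ⟶ X) (g : Z ⟶ X) :
    expEval f g ≫ g = pbFst f (expBase f g) ≫ f := hom_ext fun s p => by
  refine (ExpElt.app_toFun p.1.2 (𝟙 s) p.1.1 _).trans ?_
  rw [X.res_id]
  exact p.2.symm

/-- The transpose of a map. -/
def expCurry {f : Y ⟶ X} {g : Z ⟶ X} {T : Psh.{max w' u₁ v₁} S} (t : T ⟶ X) (a : pb f t ⟶ Z)
    (h : a ≫ g = pbFst f t ≫ f) : T ⟶ exp f g where
  app {s} τ :=
    { base := t.app τ
      toFun := fun k y hy => a.app ⟨(y, T.res k τ), by rw [app_res, hy]⟩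
      app_toFun := fun k y hy => by
        exact (congr_app h _).trans hy
      res_toFun := fun l k y hy hy' => by
        refine (app_res a l _).symm.trans ?_
        exact congrArg a.app (Subtype.ext (Prod.ext rfl (T.res_res _ _ _))) }
  app_res {r s} k τ := ExpElt.ext (app_res t k τ) fun l y hy hy' =>
    congrArg a.app (Subtype.ext (Prod.ext rfl (T.res_res _ _ _)))

theorem expCurry_unique {f : Y ⟶ X} {g : Z ⟶ X} {T : Psh.{max w' u₁ v₁} S} (t : T ⟶ X)
    (a : pb f t ⟶ Z) (h : a ≫ g = pbFst f t ≫ f) (k : T ⟶ exp f g)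
    (hk : k ≫ expBase f g = t)
    (hk' : pbLift (g := expBase f g) (pbFst f t) (pbSnd f t ≫ k)
      (by rw [pb_condition, Category.assoc, hk]) ≫ expEval f g = a) : k = expCurry t a h := by
  subst hk
  subst hk'
  refine hom_ext fun s τ => ExpElt.ext rfl fun {r} l y hy hy' => ?_
  have h₁ := app_res k l τ
  have h₂ : f.app y = X.res (𝟙 r) (ExpElt.base (k.app (T.res l τ))) :=
    (hy.trans (congrArg ExpElt.base h₁).symm).trans (X.res_id _).symm
  have h₃ : f.app y = X.res (𝟙 r) (ExpElt.base ((exp f g).res l (k.app τ))) :=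
    hy.trans (X.res_id _).symm
  -- The value of k(τ) along l equals the value of k(l^* τ) along the identity, by naturality of k;
  -- the latter is what the evaluation map sees.
  refine Eq.trans ?_ (ExpElt.congr_toFun h₁ (𝟙 r) y h₂ h₃).symm
  exact ExpElt.toFun_congr _ (Category.id_comp l).symm rfl _ _

theorem expCurry_eval {f : Y ⟶ X} {g : Z ⟶ X} {T : Psh.{max w' u₁ v₁} S} (t : T ⟶ X)
    (a : pb f t ⟶ Z) (h : a ≫ g = pbFst f t ≫ f) :
    pbLift (g := expBase f g) (pbFst f t) (pbSnd f t ≫ expCurry t a h) (pb_condition f t) ≫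
      expEval f g = a :=
  hom_ext fun _ _ => congrArg a.app (Subtype.ext (Prod.ext rfl (T.res_id _)))

end

end Psh

end

/-! ### Implication and universal quantification in terms of forcing -/

namespace FiberedPreorder

section

universe w' v₁ u₁

variable {C : Type u} [Category.{v} C] [HasFiniteLimits C] {S : Type u₁} [Category.{v₁} S]
  {X : FiberedPreorder.{w} C} [X.IsExistential] {J : SingletonCoverage S}

/-- The semantics of `∀ b, u(b) = a → p(b) → q(b)`. -/
def Stages.AllImp (T : Stages X J) {I I' : C} (u : I' ⟶ I) (p q : X.Pred I') {s : S}
    (a : T.K.obj s ⟶ I) : Prop :=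
  ∀ {t : S} (k : t ⟶ s) (b : T.K.obj t ⟶ I'), b ≫ u = T.K.map k ≫ a → T.Forces p b → T.Forces q b

namespace Stages

variable (T : Stages X J)

/-- The predicate is ∀_u (p → q). Beck–Chevalley along a and stability of → reduce forcing at a to
an inequality over the pullback of u and a, and that inequality is tested on stages. A map from a
stage t that satisfies the reindexed `pred s` is the same as a map of stages t ⟶ s together with an
element b over it. -/
theorem exists_forces_iff_allImp (h : X.HasImplication) (h' : X.HasUniversalQuantification)
    {I I' : C} (u : I' ⟶ I) (p q : X.Pred I') :
    ∃ r : X.Pred I, ∀ {s : S} {a : T.K.obj s ⟶ I}, T.Forces r a ↔ T.AllImp u p q a := by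
  obtain ⟨χ, hχ⟩ := h.1 p q
  obtain ⟨r, hr⟩ := h'.1 u χ
  refine ⟨r, fun {s a} => ?_⟩
  have h₁ := h'.2 (IsPullback.of_hasPullback u a) χ r hr (T.pred s)
  have h₂ := h.2 (pullback.fst u a) _ _ _ hχ (X.reindex (pullback.snd u a) (T.pred s)) _
    (isMeet_meet _ _)
  refine h₁.trans (h₂.trans ⟨fun H t k b hb hp => ?_, fun H => T.le_of_forces fun {t} c hc => ?_⟩)
  · have h₃ : T.Forces (meet (X.reindex (pullback.snd u a) (T.pred s))
        (X.reindex (pullback.fst u a) p)) (pullback.lift b (T.K.map k) hb) := by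
      rw [forces_meet, forces_reindex, forces_reindex, pullback.lift_fst, pullback.lift_snd]
      exact ⟨T.pred_le k, hp⟩
    have h₄ := h₃.mono H
    rwa [forces_reindex, pullback.lift_fst] at h₄
  · rw [forces_meet, forces_reindex, forces_reindex] at hc
    obtain ⟨k, hk⟩ := T.exists_map _ hc.1
    rw [forces_reindex]
    exact H k _ (by rw [hk, Category.assoc, Category.assoc, pullback.condition]) hc.2

section

variable (h : ∀ {I I' : C} (u : I' ⟶ I) (p q : X.Pred I'), ∃ r : X.Pred I,
  ∀ {s : S} {a : T.K.obj s ⟶ I}, T.Forces r a ↔ T.AllImp u p q a)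

theorem forces_top {s : S} {I : C} (a : T.K.obj s ⟶ I) : T.Forces (X.top I) a :=
  HasFiniteMeets.reindex_top a _ (fun φ => le_top φ) _

include h in
-- Taking the antecedent to be ⊤ gives the right adjoint. Beck–Chevalley is required for every right
-- adjoint value ψ; these are all equivalent, so ψ satisfies the same forcing clause, and that
-- clause is stable under pullback.
theorem hasUniversalQuantification : X.HasUniversalQuantification := by
  have hr : ∀ {I I' : C} (u : I' ⟶ I) (φ : X.Pred I'), ∃ r, X.IsAll u φ r ∧
      ∀ {s : S} {a : T.K.obj s ⟶ I}, T.Forces r a ↔ T.AllImp u (X.top _) φ a := by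
    intro I I' u φ
    obtain ⟨r, hr⟩ := h u (X.top _) φ
    refine ⟨r, fun θ => ⟨fun H => T.le_of_forces fun {s} b hb => ?_,
      fun H => T.le_of_forces fun {s} a ha => ?_⟩, hr⟩
    · exact hr.1 ((forces_reindex.1 hb).mono H) (𝟙 s) b (by simp) (T.forces_top b)
    · refine hr.2 fun k b hb _ => Forces.mono H (forces_reindex.2 ?_)
      rw [hb]
      exact ha.res k
  refine ⟨fun u φ => (hr u φ).imp fun _ h => h.1, ?_⟩
  intro P I' K I v' u' u v sq φ ψ hψ
  obtain ⟨r, hr, hr'⟩ := hr u φ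
  have hψ' : ∀ {s : S} {a : T.K.obj s ⟶ I}, T.Forces ψ a ↔ T.AllImp u (X.top _) φ a :=
    ⟨fun H => hr'.1 (H.mono ((hr ψ).2 ((hψ ψ).1 le_rfl))),
      fun H => (hr'.2 H).mono ((hψ r).2 ((hr r).1 le_rfl))⟩
  refine fun θ => ⟨fun H => T.le_of_forces fun {s} b hb => ?_,
    fun H => T.le_of_forces fun {s} a ha => ?_⟩
  · have := forces_reindex.1 ((forces_reindex.1 hb).mono H)
    refine forces_reindex.2 (hψ'.1 this (𝟙 s) _ ?_ (T.forces_top _))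
    rw [T.K.map_id, Category.id_comp, Category.assoc, Category.assoc, sq.w]
  · refine forces_reindex.2 (hψ'.2 fun {t} k b hb _ => ?_)
    have hw : b ≫ u = (T.K.map k ≫ a) ≫ v := hb.trans (Category.assoc _ _ _).symm
    have := Forces.mono H (a := sq.lift b _ hw) (forces_reindex.2 (by
      rw [sq.lift_snd]
      exact ha.res k))
    rwa [forces_reindex, sq.lift_fst] at this

include h in
-- Taking u to be the identity gives implication. As for ∀, any implication χ has the same forcing
-- clause as the constructed one, and this clause is visibly stable under reindexing.
theorem hasImplication : X.HasImplication := by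
  have hr : ∀ {I : C} (φ ψ : X.Pred I), ∃ r, IsImp φ ψ r ∧
      ∀ {s : S} {a : T.K.obj s ⟶ I}, T.Forces r a ↔
        ∀ {t : S} (k : t ⟶ s), T.Forces φ (T.K.map k ≫ a) → T.Forces ψ (T.K.map k ≫ a) := by
    intro I φ ψ
    obtain ⟨r, hr⟩ := h (𝟙 I) φ ψ
    have hr' : ∀ {s : S} {a : T.K.obj s ⟶ I}, T.Forces r a ↔
        ∀ {t : S} (k : t ⟶ s), T.Forces φ (T.K.map k ≫ a) → T.Forces ψ (T.K.map k ≫ a) := by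
      refine hr.trans ⟨fun H t k h => H k _ (Category.comp_id _) h, fun H t k b hb h => ?_⟩
      obtain rfl := (Category.comp_id b).symm.trans hb
      exact H k h
    refine ⟨r, fun θ μ hμ => ⟨fun H => T.le_of_forces fun {s} a ha => ?_,
      fun H => T.le_of_forces fun {s} a ha => ?_⟩, hr'⟩
    · have h₁ := (hμ μ).1 le_rfl
      have := hr'.1 ((ha.mono h₁.1).mono H) (𝟙 s)
      rw [T.K.map_id, Category.id_comp] at this
      exact this (ha.mono h₁.2)
    · refine hr'.2 fun k hk => Forces.mono H ?_
      exact Forces.mono ((hμ _).2 ⟨meet_le_left θ φ, meet_le_right _ _⟩)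
        (forces_meet.2 ⟨ha.res k, hk⟩)
  refine ⟨fun φ ψ => (hr φ ψ).imp fun _ h => h.1, ?_⟩
  intro I' I u φ ψ χ hχ
  obtain ⟨r, hr, hr'⟩ := hr φ ψ
  have hχ' : ∀ {s : S} {a : T.K.obj s ⟶ I}, T.Forces χ a ↔
      ∀ {t : S} (k : t ⟶ s), T.Forces φ (T.K.map k ≫ a) → T.Forces ψ (T.K.map k ≫ a) :=
    ⟨fun H => hr'.1 (H.mono ((hr χ _ (isMeet_meet _ _)).2 ((hχ χ _ (isMeet_meet _ _)).1 le_rfl))),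
      fun H => (hr'.2 H).mono
        ((hχ r _ (isMeet_meet _ _)).2 ((hr r _ (isMeet_meet _ _)).1 le_rfl))⟩
  refine fun θ μ hμ => ⟨fun H => T.le_of_forces fun {s} a ha => ?_,
      fun H => T.le_of_forces fun {s} a ha => ?_⟩
  · have h₁ := (hμ μ).1 le_rfl
    have := hχ'.1 (forces_reindex.1 ((ha.mono h₁.1).mono H)) (𝟙 s)
    rw [T.K.map_id, Category.id_comp] at this
    exact forces_reindex.2 (this (forces_reindex.1 (ha.mono h₁.2)))
  · refine forces_reindex.2 (hχ'.2 fun k hk => ?_)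
    rw [← Category.assoc, ← forces_reindex] at hk ⊢
    refine Forces.mono H ?_
    exact Forces.mono ((hμ _).2 ⟨meet_le_left θ _, meet_le_right _ _⟩)
        (forces_meet.2 ⟨ha.res k, hk⟩)

end

end Stages

end

/-! ### Definable predicates of `D A` -/

section

variable {E : Type u} [Category.{v} E] [Regular E] {A : FiberedPreorder.{w} E} [A.HasFiniteMeets]

/-- A property of generalised elements at stages that is given by a predicate of `D A`. -/
def Rep {I : E} (P : ∀ s : A.Total, (s.base ⟶ I) → Prop) : Prop :=
  ∃ p : A.DPred I, ∀ (s : A.Total) (a : s.base ⟶ I), p.Forces a ↔ P s a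

namespace Rep

variable {I I' I'' : E} {P Q : ∀ s : A.Total, (s.base ⟶ I) → Prop}

theorem congr (h : Rep P) (h' : ∀ s a, P s a ↔ Q s a) : Rep Q :=
  h.imp fun _ hp s a => (hp s a).trans (h' s a)

theorem res (hA : A.IsPrestack) (h : Rep P) {s t : A.Total} {a : s.base ⟶ I} (ha : P s a)
    (k : t ⟶ s) : P t (k.base ≫ a) := by
  obtain ⟨p, hp⟩ := h
  exact (hp _ _).1 (hA.forces_iff.1 ((hA.forces_iff.2 ((hp _ _).2 ha)).res k))

theorem of_cov (hA : A.IsPrestack) (h : Rep P) {s t : A.Total} {e : t ⟶ s}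
    (he : Total.CoverCartesian e) {a : s.base ⟶ I} (ha : P t (e.base ≫ a)) : P s a := by
  obtain ⟨p, hp⟩ := h
  exact (hp _ _).1 (hA.forces_iff.1 (Stages.Forces.of_cov he (hA.forces_iff.2 ((hp _ _).2 ha))))

theorem and (hA : A.IsPrestack) (hP : Rep P) (hQ : Rep Q) : Rep fun s a => P s a ∧ Q s a := by
  obtain ⟨p, hp⟩ := hP
  obtain ⟨q, hq⟩ := hQ
  refine ⟨meet (X := A.D) p q, fun s a => ?_⟩
  exact hA.forces_iff.symm.trans (Stages.forces_meet.trans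
    (and_congr (hA.forces_iff.trans (hp s a)) (hA.forces_iff.trans (hq s a))))

theorem comap (hA : A.IsPrestack) (hP : Rep P) (u : I' ⟶ I) :
    Rep fun (s : A.Total) (a : s.base ⟶ I') => P s (a ≫ u) := by
  obtain ⟨p, hp⟩ := hP
  refine ⟨A.D.reindex u p, fun s a => ?_⟩
  exact hA.forces_iff.symm.trans (Stages.forces_reindex.trans
    (hA.forces_iff.trans (hp s (a ≫ u))))

theorem ex (hA : A.IsPrestack) {P : ∀ s : A.Total, (s.base ⟶ I') → Prop} (hP : Rep P)
    (u : I' ⟶ I) : Rep fun (s : A.Total) (a : s.base ⟶ I) => ∃ (t : A.Total) (e : t ⟶ s)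
      (b : t.base ⟶ I'), Total.CoverCartesian e ∧ b ≫ u = e.base ≫ a ∧ P t b := by
  obtain ⟨p, hp⟩ := hP
  refine ⟨FiberedPreorder.ex (X := A.D) u p, fun s a => ?_⟩
  refine hA.forces_iff.symm.trans (Stages.forces_ex.trans ?_)
  refine exists_congr fun t => exists_congr fun e => exists_congr fun b => ?_
  exact and_congr Iff.rfl (and_congr Iff.rfl (hA.forces_iff.trans (hp _ _)))

theorem exists_of_prod (hA : A.IsPrestack) {P : ∀ s : A.Total, (s.base ⟶ I ⨯ I') → Prop}
    (hP : Rep P) : Rep fun (s : A.Total) (a : s.base ⟶ I) => ∃ (t : A.Total) (e : t ⟶ s)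
      (b : t.base ⟶ I'), Total.CoverCartesian e ∧ P t (prod.lift (e.base ≫ a) b) := by
  refine (hP.ex hA prod.fst).congr fun s a => ?_
  refine exists_congr fun t => exists_congr fun e => ⟨?_, ?_⟩
  · rintro ⟨b, he, hb, h⟩
    refine ⟨b ≫ prod.snd, he, ?_⟩
    rwa [← hb, ← prod.comp_lift, prod.lift_fst_snd, Category.comp_id]
  · rintro ⟨b, he, h⟩
    exact ⟨_, he, prod.lift_fst _ _, h⟩

theorem rel (hA : A.IsPrestack) (ρ : A.DPred (I ⨯ I')) (u : I'' ⟶ I) (u' : I'' ⟶ I') :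
    Rep fun (s : A.Total) (a : s.base ⟶ I'') => ρ.Rel (a ≫ u) (a ≫ u') := by
  refine (comap (P := fun s a => ρ.Forces a) hA ⟨ρ, fun s a => Iff.rfl⟩
    (prod.lift u u')).congr fun s a => ?_
  rw [prod.comp_lift]
  rfl

/-- By descent along covers, forcing this predicate of `D A` amounts to the inequality in A itself.
Quantifying over maps t ⟶ x of |A| thus becomes quantifying over maps of the base with a definable
side condition. -/
theorem pred (hA : A.IsPrestack) (x : A.Total) :
    Rep fun (s : A.Total) (a : s.base ⟶ x.base) => s.pred ≤ A.reindex a x.pred := by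
  refine ⟨⟨x.base, 𝟙 _, x.pred⟩, fun s a => ⟨?_, fun h => ?_⟩⟩
  · rintro ⟨t, e, b, he, hb, hl⟩
    obtain rfl : e.base ≫ a = b := hb.trans (Category.comp_id b)
    exact hA.le_of_coverCartesian he (hl.trans (A.reindex_comp_le _ _ _))
  · exact ⟨s, 𝟙 s, a, Total.CoverCartesian.id s,
      (Category.id_comp _).trans (Category.comp_id _).symm, h⟩

/-- A factorisation on a cover descends because a regular epimorphism has the lifting property
against the mono m. -/
theorem factors {M : E} (m : M ⟶ I) [Mono m] :
    Rep fun (s : A.Total) (a : s.base ⟶ I) => ∃ b, b ≫ m = a := by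
  refine ⟨⟨M, m, A.top M⟩, fun s a => ⟨?_, ?_⟩⟩
  · rintro ⟨t, e, b, he, hb, -⟩
    have := he.1
    have sq : CommSq b e.base m a := ⟨hb.symm⟩
    exact ⟨sq.lift, sq.fac_right⟩
  · rintro ⟨b, rfl⟩
    exact ⟨s, 𝟙 s, b, Total.CoverCartesian.id s, Category.id_comp _,
      HasFiniteMeets.reindex_top b _ (fun φ => le_top φ) _⟩

theorem eq (u u' : I ⟶ I') : Rep fun (s : A.Total) (a : s.base ⟶ I) => a ≫ u = a ≫ u' := by
  refine (factors (equalizer.ι u u')).congr fun s a => ⟨?_, fun h => ?_⟩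
  · rintro ⟨b, rfl⟩
    rw [Category.assoc, Category.assoc, equalizer.condition]
  · exact ⟨equalizer.lift a h, equalizer.lift_ι _ _⟩

/-- A predicate of `D A` is a map from the base of an object of |A|; that object is the stage of the
generic solution. -/
theorem exists_generic (hP : Rep P) : ∃ (x : A.Total) (a : x.base ⟶ I),
    P x a ∧ ∀ {s : A.Total} {b : s.base ⟶ I}, P s b → ∃ (t : A.Total) (e : t ⟶ s) (l : t ⟶ x),
      Total.CoverCartesian e ∧ l.base ≫ a = e.base ≫ b := by
  obtain ⟨p, hp⟩ := hP
  refine ⟨⟨p.dom, p.pred⟩, p.map, (hp _ _).1 ?_, fun {s b} hb => ?_⟩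
  · exact ⟨_, 𝟙 _, 𝟙 _, Total.CoverCartesian.id _, rfl, A.le_reindex_id _⟩
  · obtain ⟨t, e, b', he, h, hl⟩ := (hp _ _).2 hb
    exact ⟨t, e, ⟨b', hl⟩, he, h.symm⟩

theorem allImp (hA : A.IsPrestack) (h : A.D.HasImplication)
    (h' : A.D.HasUniversalQuantification) {P Q : ∀ s : A.Total, (s.base ⟶ I ⨯ I') → Prop}
    (hP : Rep P) (hQ : Rep Q) : Rep fun (s : A.Total) (a : s.base ⟶ I) => ∀ (t : A.Total)
      (k : t ⟶ s) (b : t.base ⟶ I'), P t (prod.lift (k.base ≫ a) b) →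
        Q t (prod.lift (k.base ≫ a) b) := by
  obtain ⟨p, hp⟩ := hP
  obtain ⟨q, hq⟩ := hQ
  obtain ⟨r, hr⟩ := hA.stages.exists_forces_iff_allImp h h' (prod.fst : I ⨯ I' ⟶ I) p q
  refine ⟨r, fun s a => hA.forces_iff.symm.trans (hr.trans ⟨fun H t k b hb => ?_,
    fun H t k b hb hpb => ?_⟩)⟩
  · exact (hq _ _).1 (hA.forces_iff.1 (H k _ (prod.lift_fst _ _)
      (hA.forces_iff.2 ((hp _ _).2 hb))))
  · refine hA.forces_iff.2 ((hq _ _).2 ?_)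
    have e : prod.lift (k.base ≫ a) (b ≫ prod.snd) = b := by
      ext
      · rw [prod.lift_fst]
        exact hb.symm
      · rw [prod.lift_snd]
    have := H t k (b ≫ prod.snd)
    rw [e] at this
    exact this ((hp _ _).1 (hA.forces_iff.1 hpb))

end Rep

namespace DPresentation

variable {F G : Psh.{max u v w} A.Total} {I I' : E}
  {N : ∀ {s : A.Total}, (s.base ⟶ I) → F.obj s → Prop} {κ : A.DPred (I ⨯ I)}
  {N' : ∀ {s : A.Total}, (s.base ⟶ I') → G.obj s → Prop} {κ' : A.DPred (I' ⨯ I')}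

theorem of_cov (hA : A.IsPrestack) (h : DPresentation F I N κ) (hF : F.IsSheaf A.coverage)
    {s t : A.Total} {e : t ⟶ s} (he : Total.CoverCartesian e) {c : s.base ⟶ I} {y : F.obj s}
    (hy : N (e.base ≫ c) (F.res e y)) : N c y :=
  (hA.isPresentation_iff.1 h).of_cov hF he hy

theorem exists_graph (hA : A.IsPrestack) (h : DPresentation F I N κ)
    (h' : DPresentation G I' N' κ') (hG : G.IsSheaf A.coverage) (η : F ⟶ G) :
    ∃ γ : A.DPred (I ⨯ I'), ∀ {s : A.Total} {c : s.base ⟶ I} {d : s.base ⟶ I'},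
      γ.Rel c d ↔ ∃ y, N c y ∧ N' d (η.app y) := by
  obtain ⟨γ, hγ⟩ := (hA.isPresentation_iff.1 h).exists_graph (hA.isPresentation_iff.1 h') hG η
  exact ⟨γ, fun {s c d} => hA.forces_iff.symm.trans hγ⟩

theorem of_rep {N : ∀ {s : A.Total}, (s.base ⟶ I) → F.obj s → Prop}
    (res : ∀ {t s : A.Total} (k : t ⟶ s) {c : s.base ⟶ I} {y : F.obj s}, N c y →
      N (k.base ≫ c) (F.res k y))
    (eq : ∀ {s : A.Total} {c : s.base ⟶ I} {y y' : F.obj s}, N c y → N c y' → y = y')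
    (exists_name : ∀ {s : A.Total} (y : F.obj s), ∃ (t : A.Total) (e : t ⟶ s) (c : t.base ⟶ I),
      Total.CoverCartesian e ∧ N c (F.res e y))
    (rep : Rep fun (s : A.Total) (c : s.base ⟶ I ⨯ I) => ∃ y : F.obj s, N (c ≫ prod.fst) y ∧
      N (c ≫ prod.snd) y) : ∃ κ, DPresentation F I N κ := by
  obtain ⟨κ, hκ⟩ := rep
  refine ⟨κ, res, eq, exists_name, fun {s c d} => (hκ _ _).trans ?_⟩
  dsimp only
  rw [prod.lift_fst, prod.lift_snd]

end DPresentation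

end

end FiberedPreorder

/-! ### Full subcategories of presheaves closed under pullbacks and exponentials -/

/-- Allowing arbitrary pullback squares lets the concrete presheaf pullbacks replace the chosen
ones. -/
theorem isLocallyCartesianClosed_of_exists_isPullback (C : Type u) [Category.{v} C]
    [HasFiniteLimits C]
    (h : ∀ {X Y Z : C} (f : Y ⟶ X) (g : Z ⟶ X), ∃ (W : C) (w : W ⟶ X) (P : C) (p₁ : P ⟶ Y)
      (p₂ : P ⟶ W) (ev : P ⟶ Z), IsPullback p₁ p₂ f w ∧ ev ≫ g = p₁ ≫ f ∧
      ∀ (T : C) (t : T ⟶ X), ∃ (Q : C) (q₁ : Q ⟶ Y) (q₂ : Q ⟶ T), IsPullback q₁ q₂ f t ∧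
        ∀ a : Q ⟶ Z, a ≫ g = q₁ ≫ f → ∃! k : T ⟶ W, k ≫ w = t ∧
          ∀ m : Q ⟶ P, m ≫ p₁ = q₁ → m ≫ p₂ = q₂ ≫ k → m ≫ ev = a) :
    IsLocallyCartesianClosed C := by
  refine isLocallyCartesianClosed_of_exists_eval C fun {X Y Z} f g => ?_
  obtain ⟨W, w, P, p₁, p₂, ev, sq, hev, H⟩ := h f g
  let i := sq.isoPullback
  have hi₁ : i.inv ≫ p₁ = pullback.fst f w := sq.isoPullback_inv_fst
  have hi₂ : i.inv ≫ p₂ = pullback.snd f w := sq.isoPullback_inv_snd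
  refine ⟨W, w, i.inv ≫ ev, by rw [Category.assoc, hev, reassoc_of% hi₁], fun T t a ha => ?_⟩
  obtain ⟨Q, q₁, q₂, sq', H'⟩ := H T t
  let j := sq'.isoPullback
  have hj₁ : j.inv ≫ q₁ = pullback.fst f t := sq'.isoPullback_inv_fst
  have hj₂ : j.inv ≫ q₂ = pullback.snd f t := sq'.isoPullback_inv_snd
  obtain ⟨k, ⟨hk, hk'⟩, hu⟩ := H' (j.hom ≫ a) (by
    rw [Category.assoc, ha, ← hj₁, Category.assoc, j.hom_inv_id_assoc])
  refine ⟨k, ⟨hk, fun m h₁ h₂ => ?_⟩, fun k' hk'' => hu k' ⟨hk''.1, fun m h₁ h₂ => ?_⟩⟩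
  · have := hk' (j.hom ≫ m ≫ i.inv)
      (by rw [Category.assoc, Category.assoc, hi₁, h₁, ← hj₁, j.hom_inv_id_assoc])
      (by rw [Category.assoc, Category.assoc, hi₂, h₂, ← hj₂, Category.assoc,
        j.hom_inv_id_assoc])
    rw [Category.assoc, Category.assoc] at this
    exact (cancel_epi _).1 this
  · have := hk''.2 (j.inv ≫ m ≫ i.hom)
      (by rw [← hi₁, Category.assoc, Category.assoc, i.hom_inv_id_assoc, h₁, hj₁])
      (by rw [← hi₂, Category.assoc, Category.assoc, i.hom_inv_id_assoc, h₂, ← hj₂,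
        Category.assoc])
    rw [Category.assoc, Category.assoc, i.hom_inv_id_assoc] at this
    rw [← this, j.hom_inv_id_assoc]

namespace Psh

section

universe w' v₁ u₁

variable {S : Type u₁} [Category.{v₁} S] {X Y Z : Psh.{w'} S}

theorem isPullback_pb (f : Y ⟶ X) (g : Z ⟶ X) : IsPullback (pbFst f g) (pbSnd f g) f g :=
  IsPullback.of_isLimit' ⟨pb_condition f g⟩ (PullbackCone.IsLimit.mk _
    (fun s => pbLift s.fst s.snd s.condition) (fun _ => rfl) (fun _ => rfl)
    fun _ _ h₁ h₂ => hom_ext fun _ x => Subtype.ext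
      (Prod.ext (congr_app h₁ x) (congr_app h₂ x)))

/-- The terminal presheaf. -/
def punit (S : Type u₁) [Category.{v₁} S] : Psh.{w'} S where
  obj _ := PUnit
  res _ x := x
  res_id _ := rfl
  res_res _ _ _ := rfl

theorem punit_isSheaf (J : SingletonCoverage S) : (punit.{w'} S).IsSheaf J :=
  ⟨fun _ _ _ _ => rfl, fun _ z _ => ⟨z, rfl⟩⟩

variable {P : ObjectProperty (Psh.{w'} S)}
  (hpb : ∀ {X Y Z : Psh.{w'} S} (f : Y ⟶ X) (g : Z ⟶ X), P X → P Y → P Z → P (pb f g))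

theorem isPullback_homMk_pb {X Y Z : P.FullSubcategory} (f : Y ⟶ X) (g : Z ⟶ X)
    (h : P (pb f.hom g.hom)) :
    IsPullback (ObjectProperty.homMk (pbFst f.hom g.hom) : ⟨_, h⟩ ⟶ Y)
      (ObjectProperty.homMk (pbSnd f.hom g.hom) : ⟨_, h⟩ ⟶ Z) f g :=
  IsPullback.of_map P.ι (ObjectProperty.hom_ext _ (pb_condition _ _))
    (isPullback_pb f.hom g.hom)

include hpb in
theorem hasFiniteLimits_fullSubcategory (h : P (punit S)) :
    HasFiniteLimits P.FullSubcategory := by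
  have : HasTerminal P.FullSubcategory := by
    have : ∀ X : P.FullSubcategory, Unique (X ⟶ ⟨punit S, h⟩) := fun X =>
      ⟨⟨ObjectProperty.homMk ⟨fun _ => ⟨⟩, fun _ _ => rfl⟩⟩, fun f => rfl⟩
    exact hasTerminal_of_unique ⟨punit S, h⟩
  have : HasPullbacks P.FullSubcategory := by
    have : ∀ {X Y Z : P.FullSubcategory} (f : Y ⟶ X) (g : Z ⟶ X), HasPullback f g := by
      intro X Y Z f g
      exact (isPullback_homMk_pb f g (hpb f.hom g.hom X.2 Y.2 Z.2)).hasPullback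
    exact hasPullbacks_of_hasLimit_cospan _
  exact hasFiniteLimits_of_hasTerminal_and_pullbacks

end

section

universe w' v₁ u₁

variable {S : Type u₁} [Category.{v₁} S]

theorem isLocallyCartesianClosed_fullSubcategory {P : ObjectProperty (Psh.{max w' u₁ v₁} S)}
    (hpb : ∀ {X Y Z : Psh.{max w' u₁ v₁} S} (f : Y ⟶ X) (g : Z ⟶ X), P X → P Y → P Z →
      P (pb f g)) (h : P (punit S))
    (hexp : ∀ {X Y Z : Psh.{max w' u₁ v₁} S} (f : Y ⟶ X) (g : Z ⟶ X), P X → P Y → P Z →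
      P (exp f g)) : IsLocallyCartesianClosed P.FullSubcategory := by
  have := hasFiniteLimits_fullSubcategory hpb h
  refine isLocallyCartesianClosed_of_exists_isPullback _ fun {X Y Z} f g => ?_
  have hW := hexp f.hom g.hom X.2 Y.2 Z.2
  let w : (⟨_, hW⟩ : P.FullSubcategory) ⟶ X := ObjectProperty.homMk (expBase f.hom g.hom)
  have hP := hpb f.hom w.hom X.2 Y.2 hW
  refine ⟨_, w, _, _, _, (ObjectProperty.homMk (expEval f.hom g.hom) : ⟨_, hP⟩ ⟶ Z),
    isPullback_homMk_pb f w hP, ObjectProperty.hom_ext _ (expEval_comp _ _), fun T t => ?_⟩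
  have hQ := hpb f.hom t.hom X.2 Y.2 T.2
  refine ⟨_, _, _, isPullback_homMk_pb f t hQ, fun a ha => ?_⟩
  have ha' : a.hom ≫ g.hom = pbFst f.hom t.hom ≫ f.hom := congrArg InducedCategory.Hom.hom ha
  refine ⟨ObjectProperty.homMk (expCurry t.hom a.hom ha'), ⟨rfl, fun m h₁ h₂ => ?_⟩,
    fun k hk => ObjectProperty.hom_ext _ ?_⟩
  · apply ObjectProperty.hom_ext
    refine Eq.trans ?_ (expCurry_eval t.hom a.hom ha')
    have : m.hom = pbLift (g := expBase f.hom g.hom) (pbFst f.hom t.hom)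
        (pbSnd f.hom t.hom ≫ expCurry t.hom a.hom ha') (pb_condition f.hom t.hom) :=
      hom_ext fun r x => Subtype.ext (Prod.ext (congr_app (congrArg InducedCategory.Hom.hom h₁) x)
        (congr_app (congrArg InducedCategory.Hom.hom h₂) x))
    exact congrArg (· ≫ expEval f.hom g.hom) this
  · obtain ⟨hk, hk'⟩ := hk
    have hk₁ : k.hom ≫ expBase f.hom g.hom = t.hom := congrArg InducedCategory.Hom.hom hk
    refine expCurry_unique t.hom a.hom ha' k.hom hk₁ ?_
    exact congrArg InducedCategory.Hom.hom (hk' (ObjectProperty.homMk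
      (pbLift (g := expBase f.hom g.hom) (pbFst f.hom t.hom) (pbSnd f.hom t.hom ≫ k.hom)
      (by rw [pb_condition, Category.assoc, hk₁]))) rfl rfl)

end

end Psh

/-! ### Finite limits of presented sheaves -/

namespace FiberedPreorder

section

variable {E : Type u} [Category.{v} E] [Regular E] {A : FiberedPreorder.{w} E} [A.HasFiniteMeets]
  {X Y Z : Psh.{max u v w} A.Total}

theorem isPresented_punit : A.IsPresented (Psh.punit A.Total) := by
  refine ⟨Psh.punit_isSheaf _, ⊤_ E, fun {_} _ _ => True, ?_⟩
  refine DPresentation.of_rep (fun _ _ _ _ => trivial) (fun _ _ => rfl)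
    (fun {s} y => ⟨s, 𝟙 s, terminal.from _, Total.CoverCartesian.id s, trivial⟩) ?_
  exact (Rep.eq (𝟙 _) (𝟙 _)).congr fun s a => ⟨fun _ => ⟨⟨⟩, trivial, trivial⟩, fun _ => rfl⟩

/-- A pair is named by a pair of names. That the components have the same image in X is expressed by
the two graphs: locally, some i names both images. -/
theorem IsPrestack.isPresented_pb (hA : A.IsPrestack) (f : Y ⟶ X) (g : Z ⟶ X)
    (hX : A.IsPresented X) (hY : A.IsPresented Y) (hZ : A.IsPresented Z) :
    A.IsPresented (Psh.pb f g) := by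
  obtain ⟨hX, I, N, κ, h⟩ := hX
  obtain ⟨hY, I₁, N₁, κ₁, h₁⟩ := hY
  obtain ⟨hZ, I₂, N₂, κ₂, h₂⟩ := hZ
  obtain ⟨γ₁, hγ₁⟩ := h₁.exists_graph hA h hX f
  obtain ⟨γ₂, hγ₂⟩ := h₂.exists_graph hA h hX g
  refine ⟨hX.pb hY hZ f g, I₁ ⨯ I₂,
    fun {s} c p => N₁ (c ≫ prod.fst) p.1.1 ∧ N₂ (c ≫ prod.snd) p.1.2, ?_⟩
  refine DPresentation.of_rep ?_ ?_ ?_ ?_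
  · rintro t s k c p ⟨hp₁, hp₂⟩
    rw [Category.assoc, Category.assoc]
    exact ⟨h₁.res k hp₁, h₂.res k hp₂⟩
  · rintro s c p p' ⟨hp₁, hp₂⟩ ⟨hp₁', hp₂'⟩
    exact Subtype.ext (Prod.ext (h₁.eq hp₁ hp₁') (h₂.eq hp₂ hp₂'))
  · intro s p
    obtain ⟨t, e, c, he, hc⟩ := h₁.exists_name p.1.1
    obtain ⟨r, e', d, he', hd⟩ := h₂.exists_name (Z.res e p.1.2)
    refine ⟨r, e' ≫ e, prod.lift (e'.base ≫ c) d, he'.comp he, ?_⟩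
    rw [prod.lift_fst, prod.lift_snd]
    refine ⟨?_, ?_⟩
    · have := h₁.res e' hc
      rwa [Y.res_res] at this
    · rwa [Z.res_res] at hd
  · have r₁ := Rep.rel hA κ₁ (prod.fst ≫ prod.fst : (I₁ ⨯ I₂) ⨯ (I₁ ⨯ I₂) ⟶ I₁)
      (prod.snd ≫ prod.fst)
    have r₂ := Rep.rel hA κ₂ (prod.fst ≫ prod.snd : (I₁ ⨯ I₂) ⨯ (I₁ ⨯ I₂) ⟶ I₂)
      (prod.snd ≫ prod.snd)
    have r₃ := Rep.rel hA γ₁ (prod.fst ≫ prod.fst ≫ prod.fst :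
      ((I₁ ⨯ I₂) ⨯ (I₁ ⨯ I₂)) ⨯ I ⟶ I₁) prod.snd
    have r₄ := Rep.rel hA γ₂ (prod.fst ≫ prod.fst ≫ prod.snd :
      ((I₁ ⨯ I₂) ⨯ (I₁ ⨯ I₂)) ⨯ I ⟶ I₂) prod.snd
    refine (r₁.and hA (r₂.and hA ((r₃.and hA r₄).exists_of_prod hA))).congr fun s a => ?_
    simp only [lift_fst_comp, lift_snd, h₁.rel_iff, h₂.rel_iff, hγ₁, hγ₂, Category.assoc]
    constructor
    · rintro ⟨⟨y, hy, hy'⟩, ⟨z, hz, hz'⟩, t, e, i, he, ⟨y₁, hy₁, hi⟩, ⟨z₁, hz₁, hi'⟩⟩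
      refine ⟨⟨(y, z), hX.sep he ?_⟩, ⟨hy, hz⟩, hy', hz'⟩
      obtain rfl := h₁.eq hy₁ (h₁.res e hy)
      obtain rfl := h₂.eq hz₁ (h₂.res e hz)
      rw [← Psh.app_res, ← Psh.app_res]
      exact h.eq hi hi'
    · rintro ⟨⟨⟨y, z⟩, hyz⟩, ⟨hy, hz⟩, hy', hz'⟩
      obtain ⟨t, e, i, he, hi⟩ := h.exists_name (f.app y)
      refine ⟨⟨y, hy, hy'⟩, ⟨z, hz, hz'⟩, t, e, i, he, ⟨_, h₁.res e hy, ?_⟩, _, h₂.res e hz, ?_⟩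
      · rwa [Psh.app_res]
      · rw [Psh.app_res]
        exact hyz ▸ hi

end

end FiberedPreorder

/-! ### Power objects -/

/-- The generalised element `v` of `V` belongs to the generalised element `p` of `Q`, for the
relation `m` between `Q` and `V`. -/
def PairMem {E : Type u} [Category.{v} E] [HasBinaryProducts E] {M Q V K : E} (m : M ⟶ Q ⨯ V)
    (p : K ⟶ Q) (v : K ⟶ V) : Prop :=
  ∃ b : K ⟶ M, b ≫ m = prod.lift p v

theorem PairMem.comp {E : Type u} [Category.{v} E] [HasBinaryProducts E] {M Q V K L : E}
    {m : M ⟶ Q ⨯ V} {p : K ⟶ Q} {v : K ⟶ V} (h : PairMem m p v) (k : L ⟶ K) :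
    PairMem m (k ≫ p) (k ≫ v) := by
  obtain ⟨b, hb⟩ := h
  exact ⟨k ≫ b, by rw [Category.assoc, hb, prod.comp_lift]⟩

open CartesianMonoidalCategory in
/-- Existence of power objects. -/
theorem IsElementaryTopos.exists_power {E : Type u} [Category.{v} E] [IsElementaryTopos E]
    (V : E) : ∃ (Q M : E) (m : M ⟶ Q ⨯ V), Mono m ∧ ∀ {K N : E} (n : N ⟶ K ⨯ V), Mono n →
      ∃ g : K ⟶ Q, ∀ {L : E} (l : L ⟶ K) (v : L ⟶ V),
        PairMem m (l ≫ g) v ↔ PairMem n l v := by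
  obtain ⟨_, ⟨_⟩⟩ := IsElementaryTopos.isCartesianClosed (E := E)
  let Ω := HasSubobjectClassifier.Ω E
  let Q := (ihom V).obj Ω
  -- The evaluation of the power object, with the factors swapped. The membership relation is the
  -- subobject where it is true.
  let θ : Q ⨯ V ⟶ Ω := lift prod.snd prod.fst ≫ (ihom.ev V).app Ω
  let tr := Subobject.Classifier.χ₀ _ (Q ⨯ V) ≫ HasSubobjectClassifier.truth E
  refine ⟨Q, _, equalizer.ι θ tr, inferInstance, fun {K N} n _ => ?_⟩
  let χ := HasSubobjectClassifier.χ n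
  let g : K ⟶ Q := MonoidalClosed.curry (prod.lift (snd V K) (fst V K) ≫ χ)
  refine ⟨g, fun {L} l v => ?_⟩
  have h₁ : prod.lift (l ≫ g) v ≫ θ = prod.lift l v ≫ χ := by
    have e₁ : lift v (l ≫ g) = lift v l ≫ MonoidalCategory.whiskerLeft V g := by simp
    calc prod.lift (l ≫ g) v ≫ θ = lift v (l ≫ g) ≫ (ihom.ev V).app Ω := by
          rw [← Category.assoc, comp_lift, prod.lift_fst, prod.lift_snd]
      _ = lift v l ≫ MonoidalClosed.uncurry g := by
          rw [e₁, Category.assoc, MonoidalClosed.uncurry_eq]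
      _ = prod.lift l v ≫ χ := by
          rw [MonoidalClosed.uncurry_curry, ← Category.assoc, prod.comp_lift, lift_fst, lift_snd]
  have h₂ : prod.lift (l ≫ g) v ≫ tr = Subobject.Classifier.χ₀ _ L ≫
      HasSubobjectClassifier.truth E := by
    rw [← Category.assoc]
    congr 1
    exact Subsingleton.elim _ _
  refine Iff.trans ?_ (ToposRegular.factors_iff n (prod.lift l v)).symm
  rw [← h₁, ← h₂]
  constructor
  · rintro ⟨b, hb⟩
    rw [← hb, Category.assoc, Category.assoc, equalizer.condition]
  · intro h
    exact ⟨equalizer.lift _ h, equalizer.lift_ι _ _⟩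

/-! ### Names for the elements of an exponential, and their definability -/

namespace FiberedPreorder

section

variable {E : Type u} [Category.{v} E] [Regular E] {A : FiberedPreorder.{w} E} [A.HasFiniteMeets]
  {X Y Z : Psh.{max u v w} A.Total} {I I₁ I₂ : E}
  {N : ∀ {s : A.Total}, (s.base ⟶ I) → X.obj s → Prop} {κ : A.DPred (I ⨯ I)}
  {N₁ : ∀ {s : A.Total}, (s.base ⟶ I₁) → Y.obj s → Prop} {κ₁ : A.DPred (I₁ ⨯ I₁)}
  {N₂ : ∀ {s : A.Total}, (s.base ⟶ I₂) → Z.obj s → Prop} {κ₂ : A.DPred (I₂ ⨯ I₂)}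

/-- A generic element of a presented sheaf over a presented sheaf, with names. -/
theorem DPresentation.exists_generic (hA : A.IsPrestack) (h : DPresentation X I N κ)
    (h₁ : DPresentation Y I₁ N₁ κ₁) (hX : X.IsSheaf A.coverage) (f : Y ⟶ X) :
    ∃ (x : A.Total) (y : Y.obj x) (i : x.base ⟶ I) (c : x.base ⟶ I₁), N i (f.app y) ∧ N₁ c y ∧
      ∀ {s : A.Total} (y' : Y.obj s) (i' : s.base ⟶ I), N i' (f.app y') →
        ∃ (t : A.Total) (e : t ⟶ s) (l : t ⟶ x), Total.CoverCartesian e ∧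
          l.base ≫ i = e.base ≫ i' ∧ Y.res l y = Y.res e y' := by
  obtain ⟨γ, hγ⟩ := h₁.exists_graph hA h hX f
  -- The generic solution of the graph of f carries a name of y and a name of its image at once.
  obtain ⟨x, a, ha, H⟩ := Rep.exists_generic (P := fun s (c : s.base ⟶ I₁ ⨯ I) => γ.Forces c)
    ⟨γ, fun _ _ => Iff.rfl⟩
  obtain ⟨y, hy, hy'⟩ := (hγ (c := a ≫ prod.fst) (d := a ≫ prod.snd)).1 (by
    rwa [DPred.Rel, ← prod.comp_lift, prod.lift_fst_snd, Category.comp_id])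
  refine ⟨x, y, a ≫ prod.snd, a ≫ prod.fst, hy', hy, fun {s} y' i' hi => ?_⟩
  obtain ⟨t, e, c, he, hc⟩ := h₁.exists_name y'
  have hi' := h.res e hi
  rw [← Psh.app_res] at hi'
  obtain ⟨r, e', l, he', hl⟩ := H ((hγ (c := c) (d := e.base ≫ i')).2 ⟨_, hc, hi'⟩)
  refine ⟨r, e' ≫ e, l, he'.comp he, ?_, ?_⟩
  · rw [← Category.assoc, hl, Category.assoc, prod.lift_snd, Total.comp_base, Category.assoc]
  · have hc' := h₁.res e' hc
    have hy₁ := h₁.res l hy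
    rw [← Category.assoc, hl, Category.assoc, prod.lift_fst] at hy₁
    rw [h₁.eq hy₁ hc', Y.res_res]

variable {x : A.Total} {M Q : E}

/-- The relation named by `w` is total. -/
def ExpTotal (i : x.base ⟶ I) (m : M ⟶ Q ⨯ (x.base ⨯ I₂)) {s : A.Total}
    (w : s.base ⟶ I ⨯ Q) : Prop :=
  ∀ (t : A.Total) (k : t ⟶ s) (l : t ⟶ x), l.base ≫ i = k.base ≫ w ≫ prod.fst →
    ∃ (r : A.Total) (e : r ⟶ t) (d : r.base ⟶ I₂), Total.CoverCartesian e ∧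
      PairMem m (e.base ≫ k.base ≫ w ≫ prod.snd) (prod.lift (e.base ≫ l.base) d)

variable (N N₂) in
/-- The relations named by `w` and `w'` agree with each other. -/
def ExpCompat (y : Y.obj x) (g : Z ⟶ X) (i : x.base ⟶ I) (m : M ⟶ Q ⨯ (x.base ⨯ I₂))
    {s : A.Total} (w w' : s.base ⟶ I ⨯ Q) : Prop :=
  ∀ (t : A.Total) (k : t ⟶ s) (l l' : t ⟶ x) (d d' : t.base ⟶ I₂),
    l.base ≫ i = k.base ≫ w ≫ prod.fst → l'.base ≫ i = k.base ≫ w' ≫ prod.fst →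
    PairMem m (k.base ≫ w ≫ prod.snd) (prod.lift l.base d) →
    PairMem m (k.base ≫ w' ≫ prod.snd) (prod.lift l'.base d') → Y.res l y = Y.res l' y →
    ∃ z, N₂ d z ∧ N₂ d' z ∧ N (k.base ≫ w ≫ prod.fst) (g.app z)

variable (N N₂) in
/-- The element `α` of the exponential is named by `w`. -/
structure ExpName (y : Y.obj x) (f : Y ⟶ X) (g : Z ⟶ X) (i : x.base ⟶ I)
    (m : M ⟶ Q ⨯ (x.base ⨯ I₂)) {s : A.Total} (w : s.base ⟶ I ⨯ Q)
    (α : Psh.ExpElt f g s) : Prop where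
  base : N (w ≫ prod.fst) α.base
  val : ∀ (t : A.Total) (k : t ⟶ s) (l : t ⟶ x) (d : t.base ⟶ I₂),
    l.base ≫ i = k.base ≫ w ≫ prod.fst →
    PairMem m (k.base ≫ w ≫ prod.snd) (prod.lift l.base d) →
    ∀ hl : f.app (Y.res l y) = X.res k α.base, N₂ d (α.toFun k (Y.res l y) hl)
  total : ExpTotal i m w

/-- The quantifier over l : t ⟶ x is one over elements of x.base satisfying the predicate of x, so
the condition is a ∀ of an implication with an existential conclusion. -/
theorem rep_expTotal (hA : A.IsPrestack) (hi : A.D.HasImplication)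
    (hu : A.D.HasUniversalQuantification) (i : x.base ⟶ I) (m : M ⟶ Q ⨯ (x.base ⨯ I₂)) [Mono m] :
    Rep fun (s : A.Total) (w : s.base ⟶ I ⨯ Q) => ExpTotal i m w := by
  have r₁ := (Rep.pred hA x).comap hA (prod.snd : (I ⨯ Q) ⨯ x.base ⟶ x.base)
  have r₂ := Rep.eq (A := A) (prod.snd ≫ i : (I ⨯ Q) ⨯ x.base ⟶ I) (prod.fst ≫ prod.fst)
  have r₃ := ((Rep.factors (A := A) m).comap hA (prod.lift (prod.fst ≫ prod.fst ≫ prod.snd)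
    (prod.lift (prod.fst ≫ prod.snd) prod.snd) :
      ((I ⨯ Q) ⨯ x.base) ⨯ I₂ ⟶ Q ⨯ (x.base ⨯ I₂))).exists_of_prod hA
  refine (Rep.allImp hA hi hu (r₁.and hA r₂) r₃).congr fun s w => ?_
  simp only [prod.comp_lift, lift_fst_comp, lift_snd, lift_snd_comp, Category.assoc]
  constructor
  · intro H t k l hl
    obtain ⟨r, e, d, he, h⟩ := H t k l.base ⟨Total.Hom.le l, hl⟩
    exact ⟨r, e, d, he, h⟩
  · rintro H t k b ⟨hb, hb'⟩
    obtain ⟨r, e, d, he, h⟩ := H t k ⟨b, hb⟩ hb'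
    exact ⟨r, e, d, he, h⟩

/-- Each clause is translated into a predicate through names: equality of the restrictions of y
becomes κ₁ applied to the restrictions of its name c, and the clauses on z become κ₂ and the graph
of g. -/
theorem rep_expCompat (hA : A.IsPrestack) (hi : A.D.HasImplication)
    (hu : A.D.HasUniversalQuantification) (h : DPresentation X I N κ)
    (h₁ : DPresentation Y I₁ N₁ κ₁) (h₂ : DPresentation Z I₂ N₂ κ₂) (hX : X.IsSheaf A.coverage)
    {y : Y.obj x} {c : x.base ⟶ I₁} (hc : N₁ c y) (g : Z ⟶ X) (i : x.base ⟶ I)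
    (m : M ⟶ Q ⨯ (x.base ⨯ I₂)) [Mono m] :
    Rep fun (s : A.Total) (w : s.base ⟶ (I ⨯ Q) ⨯ (I ⨯ Q)) =>
      ExpCompat N N₂ y g i m (w ≫ prod.fst) (w ≫ prod.snd) := by
  obtain ⟨γ, hγ⟩ := h₂.exists_graph hA h hX g
  let V := x.base ⨯ I₂
  let U := ((I ⨯ Q) ⨯ (I ⨯ Q)) ⨯ (V ⨯ V)
  let j : U ⟶ x.base := prod.snd ≫ prod.fst ≫ prod.fst
  let j' : U ⟶ x.base := prod.snd ≫ prod.snd ≫ prod.fst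
  let i₁ : U ⟶ I := prod.fst ≫ prod.fst ≫ prod.fst
  let i₂ : U ⟶ I := prod.fst ≫ prod.snd ≫ prod.fst
  let d : U ⟶ I₂ := prod.snd ≫ prod.fst ≫ prod.snd
  let d' : U ⟶ I₂ := prod.snd ≫ prod.snd ≫ prod.snd
  have r₁ := (Rep.pred hA x).comap hA j
  have r₂ := (Rep.pred hA x).comap hA j'
  have r₃ := Rep.eq (A := A) (j ≫ i) i₁
  have r₄ := Rep.eq (A := A) (j' ≫ i) i₂
  have r₅ := (Rep.factors (A := A) m).comap hA
    (prod.lift (prod.fst ≫ prod.fst ≫ prod.snd) (prod.snd ≫ prod.fst) : U ⟶ Q ⨯ V)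
  have r₆ := (Rep.factors (A := A) m).comap hA
    (prod.lift (prod.fst ≫ prod.snd ≫ prod.snd) (prod.snd ≫ prod.snd) : U ⟶ Q ⨯ V)
  have r₇ := Rep.rel hA κ₁ (j ≫ c) (j' ≫ c)
  have r₈ := Rep.rel hA κ₂ d d'
  have r₉ := Rep.rel hA γ d i₁
  refine (Rep.allImp hA hi hu (r₁.and hA (r₂.and hA (r₃.and hA (r₄.and hA (r₅.and hA
    (r₆.and hA r₇)))))) (r₈.and hA r₉)).congr fun s w => ?_
  have e : ∀ {t : A.Total} (k : t ⟶ s) (b : t.base ⟶ V ⨯ V),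
      prod.lift (k.base ≫ w) b ≫ j = b ≫ prod.fst ≫ prod.fst ∧
      prod.lift (k.base ≫ w) b ≫ j' = b ≫ prod.snd ≫ prod.fst ∧
      prod.lift (k.base ≫ w) b ≫ i₁ = k.base ≫ w ≫ prod.fst ≫ prod.fst ∧
      prod.lift (k.base ≫ w) b ≫ i₂ = k.base ≫ w ≫ prod.snd ≫ prod.fst ∧
      prod.lift (k.base ≫ w) b ≫ d = b ≫ prod.fst ≫ prod.snd ∧
      prod.lift (k.base ≫ w) b ≫ d' = b ≫ prod.snd ≫ prod.snd := by
    intro t k b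
    simp only [j, j', i₁, i₂, d, d', lift_fst_comp, lift_snd_comp, Category.assoc, and_self]
  have e₁ := fun {t : A.Total} (k : t ⟶ s) (b : t.base ⟶ V ⨯ V) => (e k b).1
  have e₂ := fun {t : A.Total} (k : t ⟶ s) (b : t.base ⟶ V ⨯ V) => (e k b).2.1
  have e₃ := fun {t : A.Total} (k : t ⟶ s) (b : t.base ⟶ V ⨯ V) => (e k b).2.2.1
  have e₄ := fun {t : A.Total} (k : t ⟶ s) (b : t.base ⟶ V ⨯ V) => (e k b).2.2.2.1
  have e₅ := fun {t : A.Total} (k : t ⟶ s) (b : t.base ⟶ V ⨯ V) => (e k b).2.2.2.2.1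
  have e₆ := fun {t : A.Total} (k : t ⟶ s) (b : t.base ⟶ V ⨯ V) => (e k b).2.2.2.2.2
  have e₁' := fun {t : A.Total} (k : t ⟶ s) (b : t.base ⟶ V ⨯ V) {L : E} (q : x.base ⟶ L) =>
    (Category.assoc _ _ _).symm.trans ((e₁ k b) =≫ q)
  have e₂' := fun {t : A.Total} (k : t ⟶ s) (b : t.base ⟶ V ⨯ V) {L : E} (q : x.base ⟶ L) =>
    (Category.assoc _ _ _).symm.trans ((e₂ k b) =≫ q)
  simp only [e₁, e₂, e₃, e₄, e₅, e₆, e₁', e₂', prod.comp_lift, lift_fst_comp, lift_snd_comp,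
    Category.assoc, h₁.rel_iff, h₂.rel_iff, hγ]
  constructor
  · intro H t k l l' d d' hl hl' hm hm' hy
    have := H t k (prod.lift (prod.lift l.base d) (prod.lift l'.base d'))
    simp only [lift_fst_comp, lift_snd_comp, lift_fst, lift_snd] at this
    obtain ⟨⟨z, hz, hz'⟩, z', hz₁, hz₂⟩ := this ⟨Total.Hom.le l, Total.Hom.le l',
      hl.trans (by simp only [Category.assoc]), hl'.trans (by simp only [Category.assoc]),
      by simpa only [PairMem, Category.assoc] using hm,
      by simpa only [PairMem, Category.assoc] using hm', _, h₁.res l hc, hy ▸ h₁.res l' hc⟩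
    obtain rfl := h₂.eq hz hz₁
    exact ⟨z, hz, hz', by simpa only [Category.assoc] using hz₂⟩
  · rintro H t k b ⟨hb, hb', hl, hl', hm, hm', z, hz, hz'⟩
    let l : t ⟶ x := ⟨_, hb⟩
    let l' : t ⟶ x := ⟨_, hb'⟩
    obtain ⟨z, hz₁, hz₂, hz₃⟩ := H t k l l' (b ≫ prod.fst ≫ prod.snd) (b ≫ prod.snd ≫ prod.snd)
      (by simpa only [Category.assoc, l] using hl) (by simpa only [Category.assoc, l'] using hl')
      (by
        simp only [l, PairMem, Category.assoc]
        rw [show prod.lift (b ≫ prod.fst ≫ prod.fst) (b ≫ prod.fst ≫ prod.snd) =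
          b ≫ prod.fst by ext <;> simp]
        exact hm)
      (by
        simp only [l', PairMem, Category.assoc]
        rw [show prod.lift (b ≫ prod.snd ≫ prod.fst) (b ≫ prod.snd ≫ prod.snd) =
          b ≫ prod.snd by ext <;> simp]
        exact hm')
      (by
        have h₃ : N₁ (l.base ≫ c) z := by simpa only [Category.assoc, l] using hz
        have h₄ : N₁ (l'.base ≫ c) z := by simpa only [Category.assoc, l'] using hz'
        rw [h₁.eq (h₁.res l hc) h₃, h₁.eq (h₁.res l' hc) h₄])
    exact ⟨⟨z, hz₁, hz₂⟩, z, hz₁, by simpa only [Category.assoc] using hz₃⟩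

end

end FiberedPreorder

/-! ### Exponentials of presented sheaves -/

namespace FiberedPreorder

section

variable {E : Type u} [Category.{v} E] [Regular E] {A : FiberedPreorder.{w} E} [A.HasFiniteMeets]
  {X Y Z : Psh.{max u v w} A.Total} {I I₁ I₂ : E}
  {N : ∀ {s : A.Total}, (s.base ⟶ I) → X.obj s → Prop} {κ : A.DPred (I ⨯ I)}
  {N₂ : ∀ {s : A.Total}, (s.base ⟶ I₂) → Z.obj s → Prop} {κ₂ : A.DPred (I₂ ⨯ I₂)}
  {x : A.Total} {M Q : E} {y : Y.obj x} {f : Y ⟶ X} {g : Z ⟶ X} {i : x.base ⟶ I}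
  {m : M ⟶ Q ⨯ (x.base ⨯ I₂)}

/-- Only the cartesian half of the hypothesis matters: a lift in the base is automatically a map of
|A|. -/
theorem Total.CoverCartesian.exists_lift {s t r : A.Total} {e : t ⟶ s}
    (he : Total.CoverCartesian e) (k : r ⟶ s) (b : r.base ⟶ t.base)
    (h : b ≫ e.base = k.base) : ∃ l : r ⟶ t, l.base = b ∧ l ≫ e = k := by
  refine ⟨⟨b, ?_⟩, rfl, Total.hom_ext h⟩
  refine (Total.Hom.le k).trans ?_
  rw [← h]
  exact (A.reindex_comp_le _ _ _).trans (A.reindex_mono b he.2)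

theorem Total.CoverCartesian.of_isRegularEpi (s : A.Total) {K : E} (e : K ⟶ s.base)
    (he : IsRegularEpi e) :
    Total.CoverCartesian (⟨e, le_rfl⟩ : (⟨K, A.reindex e s.pred⟩ : A.Total) ⟶ s) :=
  ⟨he, le_rfl⟩

/-- `y` is a generic element of `Y` over `X`, whose image in `X` is named by `i`. -/
structure IsGeneric (N : ∀ {s : A.Total}, (s.base ⟶ I) → X.obj s → Prop) (f : Y ⟶ X)
    (y : Y.obj x) (i : x.base ⟶ I) : Prop where
  name : N i (f.app y)
  exists_eq : ∀ {s : A.Total} (y' : Y.obj s) (i' : s.base ⟶ I), N i' (f.app y') →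
    ∃ (t : A.Total) (e : t ⟶ s) (l : t ⟶ x), Total.CoverCartesian e ∧
      l.base ≫ i = e.base ≫ i' ∧ Y.res l y = Y.res e y'

namespace ExpName

variable {s t : A.Total} {w w' : s.base ⟶ I ⨯ Q} {α β : Psh.ExpElt f g s}

theorem res (h : DPresentation X I N κ) (hα : ExpName N N₂ y f g i m w α) (k : t ⟶ s) :
    ExpName N N₂ y f g i m (k.base ≫ w) ((Psh.exp f g).res k α) where
  base := by
    rw [Category.assoc]
    exact h.res k hα.base
  val r l j d hj hm hl := by
    refine hα.val r (l ≫ k) j d (hj.trans ?_) ?_ _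
    · simp only [Total.comp_base, Category.assoc]
    · simpa only [Total.comp_base, Category.assoc] using hm
  total r l j hj := by
    obtain ⟨q, e, d, he, hd⟩ := hα.total r (l ≫ k) j (hj.trans (by
      simp only [Total.comp_base, Category.assoc]))
    exact ⟨q, e, d, he, by simpa only [Total.comp_base, Category.assoc] using hd⟩

/-- Every element of Y over the base is locally a restriction of the generic y. There, totality
supplies a d related to it, and this d names the value of both functions. -/
theorem eq (h : DPresentation X I N κ) (h₂ : DPresentation Z I₂ N₂ κ₂)
    (hZ : Z.IsSheaf A.coverage) (hy : IsGeneric N f y i) (hα : ExpName N N₂ y f g i m w α)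
    (hβ : ExpName N N₂ y f g i m w β) : α = β := by
  refine Psh.ExpElt.ext (h.eq hα.base hβ.base) fun {r} k y' h₃ h₄ => ?_
  obtain ⟨t, e, l, he, hl, hly⟩ := hy.exists_eq y' (k.base ≫ w ≫ prod.fst)
    (h₃ ▸ h.res k hα.base)
  have hl' : l.base ≫ i = (e ≫ k).base ≫ w ≫ prod.fst :=
    hl.trans (Category.assoc _ _ _).symm
  obtain ⟨t', e', d, he', hd⟩ := hα.total t (e ≫ k) l hl'
  have hl'' : (e' ≫ l).base ≫ i = (e' ≫ e ≫ k).base ≫ w ≫ prod.fst := by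
    rw [Total.comp_base, Category.assoc, hl', Total.comp_base _ (e ≫ k), Category.assoc]
  have hm : PairMem m ((e' ≫ e ≫ k).base ≫ w ≫ prod.snd) (prod.lift (e' ≫ l).base d) := by
    rw [Total.comp_base _ (e ≫ k), Category.assoc]
    exact hd
  have hy' : Y.res (e' ≫ l) y = Y.res (e' ≫ e) y' := by
    rw [← Y.res_res, hly, Y.res_res]
  have key : ∀ (γ : Psh.ExpElt f g s) (hγ : ExpName N N₂ y f g i m w γ)
      (h : f.app y' = X.res k γ.base), N₂ d (Z.res (e' ≫ e) (γ.toFun k y' h)) := by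
    intro γ hγ h
    have h₅ := Psh.app_res_eq (e' ≫ e) h
    rw [γ.res_toFun _ _ _ h h₅]
    have h₆ : f.app (Y.res (e' ≫ l) y) = X.res (e' ≫ e ≫ k) γ.base := by
      rw [hy', h₅, Category.assoc]
    have := hγ.val _ _ _ d hl'' hm h₆
    rwa [γ.toFun_congr (Category.assoc _ _ _).symm hy' h₆ h₅] at this
  exact hZ.sep (A.coverage.comp he' he) (h₂.eq (key α hα h₃) (key β hβ h₄))

/-- Both relations are read off the same function, so the common z is its value at the restriction
of y. -/
theorem compat (h : DPresentation X I N κ) (hy : IsGeneric N f y i)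
    (hα : ExpName N N₂ y f g i m w α) (hα' : ExpName N N₂ y f g i m w' α) :
    ExpCompat N N₂ y g i m w w' := by
  intro t k l l' d d' hl hl' hm hm' hll
  have hb : f.app (Y.res l y) = X.res k α.base := by
    rw [Psh.app_res]
    exact h.eq (hl ▸ h.res l hy.name) (h.res k hα.base)
  refine ⟨α.toFun k _ hb, hα.val t k l d hl hm hb, ?_, ?_⟩
  · have hb' : f.app (Y.res l' y) = X.res k α.base := hll ▸ hb
    have := hα'.val t k l' d' hl' hm' hb'
    rwa [α.toFun_congr rfl hll.symm hb' hb] at this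
  · rw [α.app_toFun]
    exact h.res k hα.base

/-- The value at y' is the z named by some d related to an l with l^* y = y'. Compatibility of w
with itself makes z exist, be unique and lie over the right element of X; totality makes such d
exist locally. Compatibility of w with w' shows that w' names the same function. -/
theorem exists_of_compat (hA : A.IsPrestack) (h : DPresentation X I N κ)
    (h₂ : DPresentation Z I₂ N₂ κ₂) (hX : X.IsSheaf A.coverage) (hZ : Z.IsSheaf A.coverage)
    (hy : IsGeneric N f y i) {b : X.obj s} (hb : N (w ≫ prod.fst) b) (hb' : N (w' ≫ prod.fst) b)
    (ht : ExpTotal i m w) (ht' : ExpTotal i m w') (hc : ExpCompat N N₂ y g i m w w)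
    (hc' : ExpCompat N N₂ y g i m w w') :
    ∃ α, ExpName N N₂ y f g i m w α ∧ ExpName N N₂ y f g i m w' α := by
  have hlocal : ∀ {t : A.Total} (k : t ⟶ s) (y' : Y.obj t), f.app y' = X.res k b →
      ∃ (r : A.Total) (e : r ⟶ t) (l : r ⟶ x) (d : r.base ⟶ I₂), Total.CoverCartesian e ∧
        l.base ≫ i = (e ≫ k).base ≫ w ≫ prod.fst ∧
        PairMem m ((e ≫ k).base ≫ w ≫ prod.snd) (prod.lift l.base d) ∧
        Y.res l y = Y.res e y' := by
    intro t k y' hy'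
    obtain ⟨r, e, l, he, hl, hly⟩ := hy.exists_eq y' (k.base ≫ w ≫ prod.fst)
      (hy' ▸ h.res k hb)
    have hl' : l.base ≫ i = (e ≫ k).base ≫ w ≫ prod.fst := hl.trans (Category.assoc _ _ _).symm
    obtain ⟨q, e', d, he', hd⟩ := ht r (e ≫ k) l hl'
    refine ⟨q, e' ≫ e, e' ≫ l, d, he'.comp he, ?_, ?_, ?_⟩
    · rw [Total.comp_base, Category.assoc, hl']
      simp only [Total.comp_base, Category.assoc]
    · simpa only [Total.comp_base, Category.assoc] using hd
    · rw [← Y.res_res, hly, Y.res_res]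
  obtain ⟨α, rfl, hα⟩ := Psh.exists_expElt hX hZ f g b
    (fun {t} k y' z => ∃ (l : t ⟶ x) (d : t.base ⟶ I₂), l.base ≫ i = k.base ≫ w ≫ prod.fst ∧
      PairMem m (k.base ≫ w ≫ prod.snd) (prod.lift l.base d) ∧ Y.res l y = y' ∧ N₂ d z)
    (by
      rintro r t j k y' z ⟨l, d, hl, hm, rfl, hz⟩
      refine ⟨j ≫ l, j.base ≫ d, ?_, ?_, (Y.res_res _ _ _).symm, h₂.res j hz⟩
      · rw [Total.comp_base, Category.assoc, hl, Total.comp_base, Category.assoc]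
      · have := hm.comp j.base
        rw [prod.comp_lift] at this
        simpa only [Total.comp_base, Category.assoc] using this)
    (by
      rintro t k y' z z' ⟨l, d, hl, hm, rfl, hz⟩ ⟨l', d', hl', hm', hll, hz'⟩
      obtain ⟨z₀, hz₀, hz₀', -⟩ := hc t k l l' d d' hl hl' hm hm' hll.symm
      rw [h₂.eq hz hz₀, h₂.eq hz' hz₀'])
    (by
      rintro t k y' z ⟨l, d, hl, hm, rfl, hz⟩
      obtain ⟨z₀, hz₀, -, hg⟩ := hc t k l l d d hl hl hm hm rfl
      obtain rfl := h₂.eq hz hz₀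
      rw [Psh.app_res]
      exact h.eq hg (hl ▸ h.res l hy.name))
    (by
      intro t k y' hy'
      obtain ⟨r, e, l, d, he, hl, hm, hly⟩ := hlocal k y' hy'
      obtain ⟨z, hz, -⟩ := hc r (e ≫ k) l l d d hl hl hm hm rfl
      exact ⟨r, e, z, he, l, d, hl, hm, hly, hz⟩)
  refine ⟨α, ⟨hb, fun t k l d hl hm hlb => ?_, ht⟩, ⟨hb', fun t k l' d' hl' hm' hlb => ?_, ht'⟩⟩
  · obtain ⟨z, hz, -⟩ := hc t k l l d d hl hl hm hm rfl
    rwa [hα k _ z hlb ⟨l, d, hl, hm, rfl, hz⟩]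
  · obtain ⟨r, e, l, d, he, hl, hm, hly⟩ := hlocal k _ hlb
    obtain ⟨z, hz, hz', -⟩ := hc' r (e ≫ k) l (e ≫ l') d (e.base ≫ d') hl
      (by
        rw [Total.comp_base, Category.assoc, hl', Total.comp_base, Category.assoc])
      hm
      (by
        have := hm'.comp e.base
        rw [prod.comp_lift] at this
        simpa only [Total.comp_base, Category.assoc] using this)
      (by rw [hly, Y.res_res])
    refine h₂.of_cov hA hZ he ?_
    rw [α.res_toFun e k _ hlb (Psh.app_res_eq e hlb),
      hα (e ≫ k) _ z _ ⟨l, d, hl, hm, hly, hz⟩]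
    exact hz'

end ExpName

end

section

variable {E : Type u} [Category.{v} E] [IsElementaryTopos E] {A : FiberedPreorder.{w} E}
  [A.HasFiniteMeets] {X Y Z : Psh.{max u v w} A.Total} {I I₂ : E}
  {N : ∀ {s : A.Total}, (s.base ⟶ I) → X.obj s → Prop} {κ : A.DPred (I ⨯ I)}
  {N₂ : ∀ {s : A.Total}, (s.base ⟶ I₂) → Z.obj s → Prop} {κ₂ : A.DPred (I₂ ⨯ I₂)}
  {x : A.Total} {M Q : E} {y : Y.obj x} {f : Y ⟶ X} {g : Z ⟶ X} {i : x.base ⟶ I}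
  {m : M ⟶ Q ⨯ (x.base ⨯ I₂)}

/-- Evaluate α at the universal place where y lies over its base; the value has a name d on a cover
p'. The image in E of p'.base in s.base ⨯ (x.base ⨯ I₂) is a relation between s.base and x.base ⨯
I₂, and the power object turns it into q : s.base ⟶ Q. -/
theorem ExpName.exists_name (hA : A.IsPrestack) (h : DPresentation X I N κ)
    (h₂ : DPresentation Z I₂ N₂ κ₂) (hZ : Z.IsSheaf A.coverage)
    (hy : IsGeneric N f y i)
    (hm : ∀ {K L : E} (n : L ⟶ K ⨯ (x.base ⨯ I₂)), Mono n → ∃ q : K ⟶ Q, ∀ {K' : E}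
      (l : K' ⟶ K) (v : K' ⟶ x.base ⨯ I₂), PairMem m (l ≫ q) v ↔ PairMem n l v)
    {s : A.Total} (α : Psh.ExpElt f g s) {i' : s.base ⟶ I} (hi : N i' α.base) :
    ∃ w : s.base ⟶ I ⨯ Q, ExpName N N₂ y f g i m w α := by
  -- With the greatest predicate on I, i and i' are maps of |A|, so their pullback classifies pairs
  -- l, k of maps of stages with equal composites to I.
  let o : A.Total := ⟨I, A.top I⟩
  have ho : ∀ {t : A.Total} (b : t.base ⟶ I), t.pred ≤ A.reindex b (A.top I) := fun b =>
    HasFiniteMeets.reindex_top b _ (fun φ => le_top φ) _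
  obtain ⟨p, l, a, sq, sq', -⟩ := Total.hasPullback (⟨i, ho i⟩ : x ⟶ o) (⟨i', ho i'⟩ : s ⟶ o)
  have hla : l.base ≫ i = a.base ≫ i' := congrArg Total.Hom.base sq.w
  have hb : f.app (Y.res l y) = X.res a α.base := by
    rw [Psh.app_res]
    exact h.eq (h.res l hy.name) (hla ▸ h.res a hi)
  obtain ⟨p', e, d, he, hd⟩ := h₂.exists_name (α.toFun a _ hb)
  obtain ⟨L, e₀, n, _, hn, hen⟩ := ToposRegular.exists_image
    (prod.lift (e.base ≫ a.base) (prod.lift (e.base ≫ l.base) d))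
  have he₀ := ToposRegular.isRegularEpi_of_epi e₀
  obtain ⟨q, hq⟩ := hm n hn
  refine ⟨prod.lift i' q, ⟨by rwa [prod.lift_fst], fun t k l' d' hl' hmem hlb => ?_, ?_⟩⟩
  · rw [prod.lift_fst] at hl'
    rw [prod.lift_snd, hq] at hmem
    obtain ⟨b, hb'⟩ := hmem
    -- Membership in the image only gives a preimage in p'.base after passing to the cover t' of t,
    -- pulled back from e₀.
    have hw : pullback.fst e₀ b ≫ prod.lift (e.base ≫ a.base) (prod.lift (e.base ≫ l.base) d) =
        pullback.snd e₀ b ≫ prod.lift k.base (prod.lift l'.base d') := by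
      rw [← hen, ← hb', pullback.condition_assoc]
    have hreg : IsRegularEpi (pullback.snd e₀ b) := inferInstance
    have hu := Total.CoverCartesian.of_isRegularEpi t _ hreg
    let t' : A.Total := ⟨pullback e₀ b, A.reindex (pullback.snd e₀ b) t.pred⟩
    let u : t' ⟶ t := ⟨pullback.snd e₀ b, le_rfl⟩
    have w₁ : pullback.fst e₀ b ≫ e.base ≫ a.base = u.base ≫ k.base := by
      simpa using hw =≫ prod.fst
    have w₂ : pullback.fst e₀ b ≫ e.base ≫ l.base = u.base ≫ l'.base := by
      simpa using hw =≫ prod.snd ≫ prod.fst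
    have w₃ : pullback.fst e₀ b ≫ d = u.base ≫ d' := by
      simpa using hw =≫ prod.snd ≫ prod.snd
    let n' : t' ⟶ p := sq.lift (u ≫ l') (u ≫ k) (Total.hom_ext (by
      change (u.base ≫ l'.base) ≫ i = (u.base ≫ k.base) ≫ i'
      rw [Category.assoc, Category.assoc, hl']))
    have hn₁ : n' ≫ l = u ≫ l' := sq.lift_fst _ _ _
    have hn₂ : n' ≫ a = u ≫ k := sq.lift_snd _ _ _
    -- The preimage is a map of the base only. Its composite with e underlies the map n' of |A|, and
    -- e is cover-cartesian, so it is a map of stages, along which the name d may be restricted.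
    obtain ⟨z, hz, hz'⟩ := he.exists_lift n' (pullback.fst e₀ b) (sq'.hom_ext
      ((Category.assoc _ _ _).trans (w₂.trans (congrArg Total.Hom.base hn₁).symm))
      ((Category.assoc _ _ _).trans (w₁.trans (congrArg Total.Hom.base hn₂).symm)))
    have hd' := h₂.res z hd
    rw [hz, w₃, Z.res_res, hz'] at hd'
    refine h₂.of_cov hA hZ hu ?_
    have e₁ := α.res_toFun n' a _ hb (Psh.app_res_eq n' hb)
    have e₂ := α.res_toFun u k _ hlb (Psh.app_res_eq u hlb)
    have e₃ := α.toFun_congr hn₂ (show Y.res n' (Y.res l y) = Y.res u (Y.res l' y) by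
      rw [Y.res_res, Y.res_res, hn₁]) (Psh.app_res_eq n' hb) (Psh.app_res_eq u hlb)
    rw [e₁, e₃, ← e₂] at hd'
    exact hd'
  · intro t k l' hl'
    rw [prod.lift_fst] at hl'
    let n' : t ⟶ p := sq.lift l' k (Total.hom_ext hl')
    have hn₁ : n' ≫ l = l' := sq.lift_fst _ _ _
    have hn₂ : n' ≫ a = k := sq.lift_snd _ _ _
    obtain ⟨r, b, e', he', hbe⟩ := he.exists_pullback n'
    refine ⟨r, e', b.base ≫ d, he', ?_⟩
    rw [prod.lift_snd, ← Category.assoc, hq]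
    refine ⟨b.base ≫ e₀, ?_⟩
    have h₁ : b ≫ e ≫ a = e' ≫ k := by rw [reassoc_of% hbe, hn₂]
    have h₂ : b ≫ e ≫ l = e' ≫ l' := by rw [reassoc_of% hbe, hn₁]
    have h₁' : b.base ≫ e.base ≫ a.base = e'.base ≫ k.base := congrArg Total.Hom.base h₁
    have h₂' : b.base ≫ e.base ≫ l.base = e'.base ≫ l'.base := congrArg Total.Hom.base h₂
    rw [Category.assoc, hen, prod.comp_lift, prod.comp_lift, h₁', h₂']

theorem IsPrestack.isPresented_exp (hA : A.IsPrestack) (hi : A.D.HasImplication)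
    (hu : A.D.HasUniversalQuantification) (f : Y ⟶ X) (g : Z ⟶ X) (hX : A.IsPresented X)
    (hY : A.IsPresented Y) (hZ : A.IsPresented Z) : A.IsPresented (Psh.exp f g) := by
  obtain ⟨hX, I, N, κ, h⟩ := hX
  obtain ⟨hY, I₁, N₁, κ₁, h₁⟩ := hY
  obtain ⟨hZ, I₂, N₂, κ₂, h₂⟩ := hZ
  obtain ⟨x, y, i, c, hi', hc, H⟩ := h.exists_generic hA h₁ hX f
  have hy : IsGeneric N f y i := ⟨hi', H⟩
  obtain ⟨Q, M, m, _, hm⟩ := IsElementaryTopos.exists_power (x.base ⨯ I₂)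
  refine ⟨hX.exp hZ f g, I ⨯ Q, fun {s} w α => ExpName N N₂ y f g i m w α, ?_⟩
  refine DPresentation.of_rep (fun k _ _ hα => hα.res h k) (fun hα hβ => hα.eq h h₂ hZ hy hβ)
    (fun {s} α => ?_) ?_
  · obtain ⟨t, e, c, he, hc⟩ := h.exists_name (Psh.ExpElt.base α)
    obtain ⟨w, hw⟩ := ExpName.exists_name hA h h₂ hZ hy hm ((Psh.exp f g).res e α) hc
    exact ⟨t, e, w, he, hw⟩
  -- Two names have a common element iff their first components name the same base, both are total,
  -- and they are compatible with each other and the first with itself; each of these is definable.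
  · let W := I ⨯ Q
    have r₁ := Rep.rel hA κ (prod.fst ≫ prod.fst : W ⨯ W ⟶ I) (prod.snd ≫ prod.fst)
    have r₂ := (rep_expTotal hA hi hu i m).comap hA (prod.fst : W ⨯ W ⟶ W)
    have r₃ := (rep_expTotal hA hi hu i m).comap hA (prod.snd : W ⨯ W ⟶ W)
    have r₄ := rep_expCompat hA hi hu h h₁ h₂ hX hc g i m
    have r₅ := r₄.comap hA (prod.lift prod.fst prod.fst : W ⨯ W ⟶ W ⨯ W)
    refine (r₁.and hA (r₂.and hA (r₃.and hA (r₄.and hA r₅)))).congr fun s w => ?_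
    simp only [h.rel_iff, Category.assoc, lift_fst, lift_snd]
    constructor
    · rintro ⟨⟨b, hb, hb'⟩, ht, ht', hc', hc⟩
      exact ExpName.exists_of_compat hA h h₂ hX hZ hy (by rwa [Category.assoc])
        (by rwa [Category.assoc]) ht ht' hc hc'
    · rintro ⟨α, hα, hα'⟩
      refine ⟨⟨α.base, ?_, ?_⟩, hα.total, hα'.total, hα.compat h hy hα', hα.compat h hy hα⟩
      · rw [← Category.assoc]
        exact hα.base
      · rw [← Category.assoc]
        exact hα'.base

theorem IsPrestack.isLocallyCartesianClosed_isPresented (hA : A.IsPrestack)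
    (hi : A.D.HasImplication) (hu : A.D.HasUniversalQuantification) :
    IsLocallyCartesianClosed A.IsPresented.FullSubcategory :=
  Psh.isLocallyCartesianClosed_fullSubcategory.{w} (fun f g => hA.isPresented_pb f g)
    isPresented_punit fun f g => hA.isPresented_exp hi hu f g

end

end FiberedPreorder

/-! ### Recovering implication and universal quantification from local exponentials -/

namespace FiberedPreorder

section

variable {E : Type u} [Category.{v} E] [Regular E] {A : FiberedPreorder.{w} E} [A.HasFiniteMeets]
  {I I' : E}

namespace DPred

theorem rep_forces (p : A.DPred I) : Rep fun (s : A.Total) (a : s.base ⟶ I) => p.Forces a :=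
  ⟨p, fun _ _ => Iff.rfl⟩

theorem forces_top {s : A.Total} (a : s.base ⟶ I) : (A.D.top I : A.DPred I).Forces a :=
  (D.le_reindex_iff _ _).1 (HasFiniteMeets.reindex_top (X := A.D) a _ (fun φ => le_top φ) _)

/-- The presheaf of generalised elements that satisfy a predicate of `D A`. -/
def psh (hA : A.IsPrestack) (p : A.DPred I) : Psh.{max u v w} A.Total where
  obj s := ULift.{max u w} {a : s.base ⟶ I // p.Forces a}
  res k a := ⟨k.base ≫ a.down.1, p.rep_forces.res hA a.down.2 k⟩
  res_id _ := ULift.ext _ _ (Subtype.ext (Category.id_comp _))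
  res_res _ _ _ := ULift.ext _ _ (Subtype.ext (Category.assoc _ _ _).symm)

theorem psh_isSheaf (hA : A.IsPrestack) (p : A.DPred I) : (p.psh hA).IsSheaf A.coverage where
  sep {t s e} he x y h := by
    have := he.1
    exact ULift.ext _ _ (Subtype.ext ((cancel_epi e.base).1
      (congrArg (fun a => a.down.1) h)))
  glue {t s e} he z hz := by
    have : IsRegularEpi e.base := he.1
    -- The base of e is a coequaliser of the pair `r.left`, `r.right`. Since e is cartesian, both
    -- maps lift to |A|, so the matching condition applies to them and the glued map is induced by
    -- the coequaliser.
    let r := IsRegularEpi.getStruct e.base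
    let q : A.Total := ⟨r.W, A.reindex (r.left ≫ e.base) s.pred⟩
    let k : q ⟶ s := ⟨r.left ≫ e.base, le_rfl⟩
    obtain ⟨a, ha, ha'⟩ := Total.CoverCartesian.exists_lift he k r.left rfl
    obtain ⟨b, hb, hb'⟩ := Total.CoverCartesian.exists_lift he k r.right r.w.symm
    have h : a.base ≫ z.down.1 = b.base ≫ z.down.1 :=
      congrArg (fun a => a.down.1) (hz a b (ha'.trans hb'.symm))
    rw [ha, hb] at h
    obtain ⟨c, hc⟩ := r.desc' _ h
    exact ⟨⟨c, p.rep_forces.of_cov hA he (hc ▸ z.down.2)⟩, ULift.ext _ _ (Subtype.ext hc)⟩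

theorem exists_dPresentation_psh (hA : A.IsPrestack) (p : A.DPred I) :
    ∃ κ, DPresentation (p.psh hA) I (fun {_} c y => y.down.1 = c) κ := by
  refine DPresentation.of_rep ?_ ?_ ?_ ?_
  · rintro t s k c y rfl
    rfl
  · rintro s c y y' rfl h
    exact ULift.ext _ _ (Subtype.ext h.symm)
  · intro s y
    exact ⟨s, 𝟙 s, _, Total.CoverCartesian.id s, rfl⟩
  · refine ((Rep.eq prod.fst prod.snd).and hA (p.rep_forces.comap hA prod.fst)).congr
      fun s a => ⟨fun h => ⟨⟨_, h.2⟩, rfl, h.1⟩, ?_⟩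
    rintro ⟨y, hy, hy'⟩
    exact ⟨hy.symm.trans hy', hy ▸ y.down.2⟩

/-- The presented sheaf of generalised elements that satisfy a predicate of `D A`. -/
def presented (hA : A.IsPrestack) (p : A.DPred I) : A.IsPresented.FullSubcategory :=
  ⟨p.psh hA, p.psh_isSheaf hA, I, _, p.exists_dPresentation_psh hA⟩

/-- The map of sheaves given by composition. -/
def presentedMap (hA : A.IsPrestack) {p : A.DPred I} {q : A.DPred I'} (u : I ⟶ I')
    (h : ∀ {s : A.Total} (a : s.base ⟶ I), p.Forces a → q.Forces (a ≫ u)) :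
    p.presented hA ⟶ q.presented hA :=
  ObjectProperty.homMk ⟨fun {_} a => ⟨a.down.1 ≫ u, h _ a.down.2⟩,
    fun _ _ => ULift.ext _ _ (Subtype.ext (Category.assoc _ _ _))⟩

/-- The predicate `pred` of a stage, as a predicate of `D A`. -/
def ofTotal (s : A.Total) : A.DPred s.base := ⟨s.base, 𝟙 _, s.pred⟩

theorem forces_ofTotal (hA : A.IsPrestack) {s t : A.Total} {a : t.base ⟶ s.base} :
    (ofTotal s).Forces a ↔ t.pred ≤ A.reindex a s.pred := by
  constructor
  · rintro ⟨r, e, b, he, hb, hl⟩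
    obtain rfl : e.base ≫ a = b := hb.trans (Category.comp_id b)
    exact hA.le_of_coverCartesian he (hl.trans (A.reindex_comp_le _ _ _))
  · exact fun h => ⟨t, 𝟙 t, a, Total.CoverCartesian.id t,
      (Category.id_comp _).trans (Category.comp_id _).symm, h⟩

/-- The map from the representable presheaf of `s` given by an element of `F` at `s`. -/
def yonedaMap (hA : A.IsPrestack) {s : A.Total} (F : A.IsPresented.FullSubcategory)
    (x : F.obj.obj s) : (ofTotal s).presented hA ⟶ F :=
  ObjectProperty.homMk ⟨fun {_} a => F.obj.res ⟨a.down.1, (forces_ofTotal hA).1 a.down.2⟩ x,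
    fun k a => (F.obj.res_res k ⟨a.down.1, (forces_ofTotal hA).1 a.down.2⟩ x).symm⟩

end DPred

/-- The dependent product of the inclusion p ∧ q ⊆ p along u is a presented sheaf T over the
elements of I. An element a lifts locally to T exactly when all b over restrictions of a that
satisfy p also satisfy q, and lifting locally to T is expressed by the graph of T's structure map.
-/
theorem IsPrestack.exists_forces_iff_allImp (hA : A.IsPrestack)
    (hL : IsLocallyCartesianClosed A.IsPresented.FullSubcategory) (u : I' ⟶ I)
    (p q : A.DPred I') : ∃ r : A.DPred I, ∀ {s : A.Total} {a : s.base ⟶ I}, r.Forces a ↔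
      ∀ {t : A.Total} (k : t ⟶ s) (b : t.base ⟶ I'), b ≫ u = k.base ≫ a → p.Forces b →
        q.Forces b := by
  obtain ⟨pq, hpq⟩ := p.rep_forces.and hA q.rep_forces
  let top : A.DPred I := A.D.top I
  let f : p.presented hA ⟶ top.presented hA := DPred.presentedMap hA u fun a _ =>
    DPred.forces_top _
  let b : pq.presented hA ⟶ p.presented hA := DPred.presentedMap hA (𝟙 I') fun a ha => by
    rw [Category.comp_id]
    exact ((hpq _ _).1 ha).1
  obtain ⟨T, τ, h₁, h₂⟩ := hL.exists_forall f b
  obtain ⟨hT, I₁, N₁, κ₁, h⟩ := T.property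
  obtain ⟨κ, h'⟩ := top.exists_dPresentation_psh hA
  obtain ⟨γ, hγ⟩ := h.exists_graph hA h' (top.psh_isSheaf hA) τ.hom
  -- The image of τ in I: some name c of an element of T lies, locally, over a.
  obtain ⟨r, hr⟩ := (Rep.rel hA γ (prod.snd : I ⨯ I₁ ⟶ I₁) prod.fst).exists_of_prod hA
  refine ⟨r, fun {s a} => (hr s a).trans ?_⟩
  simp only [lift_snd, lift_fst, hγ]
  constructor
  · rintro ⟨t, e, c, he, x, -, hx⟩ t' k b' hb' hp
    obtain ⟨r', m, e', he', hme⟩ := he.exists_pullback k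
    refine q.rep_forces.of_cov hA he' ?_
    have hb : (e'.base ≫ b') ≫ u = m.base ≫ e.base ≫ a := by
      have : m.base ≫ e.base = e'.base ≫ k.base := congrArg Total.Hom.base hme
      rw [Category.assoc, hb', ← Category.assoc, ← this, Category.assoc]
    let y : (DPred.ofTotal r').presented hA ⟶ p.presented hA := DPred.yonedaMap hA _
      (⟨e'.base ≫ b', p.rep_forces.res hA hp e'⟩ : (p.psh hA).obj r')
    let x' : (DPred.ofTotal r').presented hA ⟶ T := DPred.yonedaMap hA _ (T.obj.res m x)
    -- The elements b' and x are turned into maps from the representable sheaf of r'; the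
    -- factorisation through p ∧ q is then evaluated at the identity of r'.
    obtain ⟨z, hz⟩ := h₁ y x' (ObjectProperty.hom_ext _ (Psh.hom_ext fun s' d => by
      let d' : s' ⟶ r' := ⟨d.down.1, (DPred.forces_ofTotal hA).1 d.down.2⟩
      refine Eq.trans ?_ (Psh.app_res_res τ.hom d' m x).symm
      refine ULift.ext _ _ (Subtype.ext ?_)
      change (d.down.1 ≫ e'.base ≫ b') ≫ u = (d.down.1 ≫ m.base) ≫ (τ.hom.app x).down.1
      rw [hx, Category.assoc, hb, Category.assoc]))
    have hid : (DPred.ofTotal r').Forces (𝟙 r'.base) :=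
      (DPred.forces_ofTotal hA).2 (A.le_reindex_id _)
    have hz' := congrArg (fun y => y.down.1) (Psh.congr_app
      (congrArg InducedCategory.Hom.hom hz) (s := r') ⟨𝟙 r'.base, hid⟩)
    have hzb : (z.hom.app (s := r') ⟨𝟙 r'.base, hid⟩).down.1 = e'.base ≫ b' :=
      (Category.comp_id _).symm.trans (hz'.trans (Category.id_comp _))
    exact hzb ▸ ((hpq _ _).1 (z.hom.app (s := r') ⟨𝟙 r'.base, hid⟩).down.2).2
  · intro H
    let S := (DPred.ofTotal s).presented hA
    let s' : S ⟶ top.presented hA := DPred.presentedMap hA a fun _ _ => DPred.forces_top _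
    have hP := hA.isPresented_pb f.hom s'.hom (top.presented hA).2 (p.presented hA).2 S.2
    -- The hypothesis H says precisely that the pullback of p along a lands in p ∧ q. The universal
    -- property of T then lifts a to a map from the representable sheaf of s into T.
    let z : (⟨_, hP⟩ : A.IsPresented.FullSubcategory) ⟶ pq.presented hA := ObjectProperty.homMk
      ⟨fun {t} x => ⟨x.1.1.down.1, (hpq _ _).2 ⟨x.1.1.down.2,
        H ⟨x.1.2.down.1, (DPred.forces_ofTotal hA).1 x.1.2.down.2⟩ _
          (congrArg (fun y => y.down.1) x.2) x.1.1.down.2⟩⟩, fun _ _ => rfl⟩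
    obtain ⟨k, hk⟩ := h₂ s' _ _ (Psh.isPullback_homMk_pb f s' hP) ⟨z, ObjectProperty.hom_ext _
      (Psh.hom_ext fun _ x => ULift.ext _ _ (Subtype.ext (Category.comp_id _)))⟩
    have hid : (DPred.ofTotal s).Forces (𝟙 s.base) :=
      (DPred.forces_ofTotal hA).2 (A.le_reindex_id _)
    let x : T.obj.obj s := k.hom.app (s := s) ⟨𝟙 s.base, hid⟩
    have hx : (τ.hom.app x).down.1 = a :=
      (congrArg (fun y => y.down.1) (Psh.congr_app (congrArg InducedCategory.Hom.hom hk)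
        (s := s) ⟨𝟙 s.base, hid⟩)).trans (Category.id_comp _)
    obtain ⟨t, e, c, he, hc⟩ := h.exists_name x
    refine ⟨t, e, c, he, _, hc, ?_⟩
    rw [Psh.app_res]
    exact congrArg (e.base ≫ ·) hx

theorem IsPrestack.isLocallyCartesianClosed_isPresented_iff {E : Type u} [Category.{v} E]
    [IsElementaryTopos E] {A : FiberedPreorder.{w} E} [A.HasFiniteMeets] (hA : A.IsPrestack) :
    IsLocallyCartesianClosed A.IsPresented.FullSubcategory ↔
      A.D.HasImplication ∧ A.D.HasUniversalQuantification := by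
  refine ⟨fun h => ?_, fun h => hA.isLocallyCartesianClosed_isPresented h.1 h.2⟩
  have H : ∀ {I I' : E} (u : I' ⟶ I) (p q : A.D.Pred I'), ∃ r : A.D.Pred I,
      ∀ {s : A.Total} {a : hA.stages.K.obj s ⟶ I}, hA.stages.Forces r a ↔
        hA.stages.AllImp u p q a := by
    intro I I' u p q
    obtain ⟨r, hr⟩ := hA.exists_forces_iff_allImp h u p q
    refine ⟨r, fun {s a} => hA.forces_iff.trans (hr.trans ?_)⟩
    exact forall_congr' fun t => forall_congr' fun k => forall_congr' fun b => forall_congr'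
      fun _ => imp_congr hA.forces_iff.symm hA.forces_iff.symm
  exact ⟨hA.stages.hasImplication H, hA.stages.hasUniversalQuantification H⟩

end

end FiberedPreorder

theorem theorem3p4p25 {E : Type u} [Category.{v} E] [IsElementaryTopos E]
    (A : FiberedPreorder.{w} E) [A.HasFiniteMeets] (hA : A.IsPrestack) :
    List.TFAE [A.D.HasImplication ∧ A.D.HasUniversalQuantification,
      IsLocallyCartesianClosed A.D.SheafCat,
      IsLocallyCartesianClosed A.PresheafCat] := by
  have h := hA.isLocallyCartesianClosed_isPresented_iff
  obtain ⟨e⟩ := hA.nonempty_sheafCat_equivalence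
  obtain ⟨e'⟩ := hA.nonempty_presheafCat_equivalence
  tfae_have 1 ↔ 2 := h.symm.trans
    ⟨fun h => h.of_equivalence e.symm, fun h => h.of_equivalence e⟩
  tfae_have 1 ↔ 3 := h.symm.trans
    ⟨fun h => h.of_equivalence e'.symm, fun h => h.of_equivalence e'⟩
  tfae_finish
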